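/- \textbf{Setting.} Let $d\ge 1$, let $\mathbb S^d\subset\mathbb R^{d+1}$ be the unit sphere with surface measure $\nu$ (total mass $\mathrm{area}(\mathbb S^d)$), and let $\mu$ be the normalized Haar measure on $SO(d+1)$. For $l\ge 0$ let $\mathfrak B^l$ be the space of spherical harmonics of order $l$ (restrictions to $\mathbb S^d$ of complex harmonic homogeneous polynomials of degree $l$ in $d+1$ variables), of dimension $N(d,l)=\frac{(2l+d-1)(l+d-2)!}{l!\,(d-1)!}$ for $l\ge1$ and $N(d,0)=1$, and let $\{B^l_q:1\le q\le N(d,l)\}$ be an orthonormal basis of $\mathfrak B^l$ in $L^2(\nu)$. Put $\phi^l_q(g)=\int g\,\overline{B^l_q}\,d\nu$. The Fourier–Laplace series of $g$ is $\sum_{l}\big(\sum_q\phi^l_q(g)B^l_q\big)$; it converges absolutely on $\mathbb S^d$ if $\sum_l\big|\sum_q\phi^l_q(g)B^l_q(x)\big|<\infty$ for all $x$. Let $\Delta$ be the Laplace–Beltrami operator of $\mathbb S^d$. Let $Y=m(X)+\epsilon$ and $Z=UX$, where $X\in\mathbb S^d$ has density $f_X$ with respect to $\nu$, $U\in SO(d+1)$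 has a square integrable density $f_U$ with respect to $\mu$, $\epsilon$ is integrable with $E(\epsilon\mid X)=0$, and $U$ is independent of $(X,\epsilon)$. Let $\tilde\phi^l$ be the $N(d,l)\times N(d,l)$ matrix with entries $\tilde\phi^l_{qr}=\int f_U(u)\int\overline{B^l_q(ux)}B^l_r(x)\,d\nu(x)\,d\mu(u)$; assume it is invertible for every $l$. Let $T_n>0$ and $$K_{T_n}(x,z)=\sum_{l=0}^{[T_n]}\sum_{q=1}^{N(d,l)}\Big(\sum_{r=1}^{N(d,l)}\big((\tilde\phi^l)^{-1}\big)_{qr}\overline{B^l_r(z)}\Big)B^l_q(x).$$ Let $(Z_i,Y_i)$, $i\ge1$, be i.i.d. copies of $(Z,Y)$ and $$\mathrm{EL}_m(\theta;x)=\max\Big\{\prod_{i=1}^n(nw_i):w_i>0,\ \sum_{i=1}^n w_i=1,\ \sum_{i=1}^n w_i\,\mathrm{Re}(K_{T_n}(x,Z_i))(Y_i-\theta)=0\Big\},$$ with $\max\emptyset=0$; we use $-2\log 0=+\infty$. \textbf{Theorem.} Let $\beta\ge0$ and let $k\in\mathbb N$ with $k>d/4$. Assume: \begin{itemize} \item (S1)-(i):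 there is $c_1>0$ with $\|(\tilde\phi^l)^{-1}\|_{\mathrm{op}}\le c_1l^\beta$ for all $l\ge1$; \item (A1): $f_X,m\in C^{2k}(\mathbb S^d)$; \item (A2)-(i): $f_X$ is bounded away from zero on $\mathbb S^d$; \item (T1$'$): $T_n\asymp n^{1/(4k+2\beta+d)}$; \item (B4): for some $\delta>0$, $|Y|^{2+\delta}$ is integrable and $E(|Y|^{2+\delta}\mid X)$ is almost surely bounded by a constant, and $E(\epsilon^2\mid X)$ is almost surely bounded below by a positive constant; \item (E2): $P(\mathrm{EL}_m(m(x);x)>0)\to1$ for each $x\in\mathbb S^d$; \item (B1) with $q=d$: for each $x\in\mathbb S^d$ there is $c>0$ with $E\big((\mathrm{Re}\,K_{T_n}(x,Z))^2\big)\ge c\,T_n^{2\beta+d}$ for all $n\ge1$; \item the Fourier–Laplace series of $\Delta^kf_X$ and of $\Delta^k(m f_X)$ converge absolutely on $\mathbb S^d$. \end{itemize} Then, for every $x\in\mathbb S^d$, $$-2\log\mathrm{EL}_m(m(x);x)\ \xrightarrow{\ d\ }\ \chi^2(1).$$ Hence, for every $\alpha\in(0,1)$, with $\chi^2_\alpha(1)$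 the $(1-\alpha)$ quantile of $\chi^2(1)$, a $(1-\alpha)\times100\%$ asymptotic confidence region for $m(x)$ is given by $$\{\theta\in\mathbb R:-2\log\mathrm{EL}_m(\theta;x)\le\chi^2_\alpha(1)\}=\{\theta\in\mathbb R:\mathrm{EL}_m(\theta;x)\ge\exp(-\chi^2_\alpha(1)/2)\},$$ that is, these two sets coincide and the probability that they contain $m(x)$ tends to $1-\alpha$. -/

import Mathlib

open MeasureTheory ProbabilityTheory Filter Topology
open scoped Manifold ComplexConjugate Nat

noncomputable section

namespace HyperDeconv

/-- The unit hypersphere `S^d` in `ℝ^(d+1)`. -/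
abbrev Sph (d : ℕ) : Type := Metric.sphere (0 : EuclideanSpace ℝ (Fin (d + 1))) 1

instance factFinrank (d : ℕ) :
    Fact (Module.finrank ℝ (EuclideanSpace ℝ (Fin (d + 1))) = d + 1) :=
  ⟨finrank_euclideanSpace_fin⟩

/-- The surface measure on `S^d`, of total mass `area(S^d)`. -/
def surf (d : ℕ) : Measure (Sph d) :=
  (volume : Measure (EuclideanSpace ℝ (Fin (d + 1)))).toSphere

/-- The special orthogonal group `SO(d+1)`. -/
abbrev SO (d : ℕ) : Type := Matrix.specialOrthogonalGroup (Fin (d + 1)) ℝ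

instance instMeasurableSpaceSO (d : ℕ) : MeasurableSpace (SO d) := borel _

instance instBorelSpaceSO (d : ℕ) : BorelSpace (SO d) := ⟨rfl⟩

theorem SO_mul_transpose {d : ℕ} (u : SO d) :
    (u : Matrix (Fin (d + 1)) (Fin (d + 1)) ℝ) *
      (u : Matrix (Fin (d + 1)) (Fin (d + 1)) ℝ).transpose = 1 :=
  (Matrix.mem_orthogonalGroup_iff _ _).1 (Matrix.mem_specialOrthogonalGroup_iff.1 u.2).1

theorem SO_transpose_mul {d : ℕ} (u : SO d) :
    (u : Matrix (Fin (d + 1)) (Fin (d + 1)) ℝ).transpose *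
      (u : Matrix (Fin (d + 1)) (Fin (d + 1)) ℝ) = 1 :=
  (Matrix.mem_orthogonalGroup_iff' _ _).1 (Matrix.mem_specialOrthogonalGroup_iff.1 u.2).1

instance instIsTopologicalGroupSO (d : ℕ) : IsTopologicalGroup (SO d) where
  continuous_inv := by
    refine continuous_induced_rng.2 ?_
    exact continuous_subtype_val.matrix_transpose

theorem isClosed_SO (d : ℕ) : IsClosed
    (Matrix.specialOrthogonalGroup (Fin (d + 1)) ℝ :
      Set (Matrix (Fin (d + 1)) (Fin (d + 1)) ℝ)) := by
  have h : (Matrix.specialOrthogonalGroup (Fin (d + 1)) ℝ :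
      Set (Matrix (Fin (d + 1)) (Fin (d + 1)) ℝ)) =
      {A | A * A.transpose = 1} ∩ {A | A.det = 1} := by
    ext A
    exact Matrix.mem_specialOrthogonalGroup_iff.trans
      (and_congr_left' (Matrix.mem_orthogonalGroup_iff _ _))
  rw [h]
  exact (isClosed_eq (continuous_id.matrix_mul continuous_id.matrix_transpose)
    continuous_const).inter (isClosed_eq continuous_id.matrix_det continuous_const)

theorem SO_entry_mem {d : ℕ} (u : SO d) (i j : Fin (d + 1)) :
    (u : Matrix (Fin (d + 1)) (Fin (d + 1)) ℝ) i j ∈ Set.Icc (-1 : ℝ) 1 := by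
  have h := congrFun (congrFun (SO_mul_transpose u) i) i
  rw [Matrix.mul_apply, Matrix.one_apply_eq] at h
  simp only [Matrix.transpose_apply] at h
  have h1 : (u : Matrix (Fin (d + 1)) (Fin (d + 1)) ℝ) i j *
      (u : Matrix (Fin (d + 1)) (Fin (d + 1)) ℝ) i j ≤ 1 := by
    rw [← h]
    exact Finset.single_le_sum
      (f := fun j => (u : Matrix (Fin (d + 1)) (Fin (d + 1)) ℝ) i j *
        (u : Matrix (Fin (d + 1)) (Fin (d + 1)) ℝ) i j)
      (fun k _ => mul_self_nonneg _) (Finset.mem_univ j)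
  constructor <;> nlinarith

instance instCompactSpaceSO (d : ℕ) : CompactSpace (SO d) := by
  refine isCompact_iff_compactSpace.1 ?_
  refine IsCompact.of_isClosed_subset (s := Set.pi Set.univ fun _ => Set.pi Set.univ fun _ =>
    Set.Icc (-1 : ℝ) 1) ?_ (isClosed_SO d) ?_
  · exact isCompact_univ_pi fun _ => isCompact_univ_pi fun _ => isCompact_Icc
  · intro A hA i _ j _
    exact SO_entry_mem ⟨A, hA⟩ i j

/-- The normalized Haar measure on `SO(d+1)`. -/
def haarSO (d : ℕ) : Measure (SO d) := Measure.haarMeasure ⊤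

theorem mulVec_mem_sphere {d : ℕ} (u : SO d) (x : Sph d) :
    WithLp.toLp 2 ((u : Matrix (Fin (d + 1)) (Fin (d + 1)) ℝ).mulVec x.1.ofLp) ∈
      Metric.sphere (0 : EuclideanSpace ℝ (Fin (d + 1))) 1 := by
  have hx : x.1.ofLp ⬝ᵥ x.1.ofLp = 1 := by
    have h := EuclideanSpace.real_norm_sq_eq x.1
    rw [mem_sphere_zero_iff_norm.1 x.2] at h
    simpa [dotProduct, sq] using h.symm
  have hu : ((u : Matrix (Fin (d + 1)) (Fin (d + 1)) ℝ).mulVec x.1.ofLp) ⬝ᵥ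
      ((u : Matrix (Fin (d + 1)) (Fin (d + 1)) ℝ).mulVec x.1.ofLp) = 1 := by
    rw [Matrix.dotProduct_mulVec, ← Matrix.mulVec_transpose, Matrix.mulVec_mulVec,
      SO_transpose_mul, Matrix.one_mulVec, hx]
  rw [mem_sphere_zero_iff_norm, ← sq_eq_sq₀ (norm_nonneg _) zero_le_one,
    EuclideanSpace.real_norm_sq_eq]
  simpa [dotProduct, sq] using hu

/-- The action `u x` of `u ∈ SO(d+1)` on `x ∈ S^d` by matrix multiplication. -/
def rot {d : ℕ} (u : SO d) (x : Sph d) : Sph d :=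
  ⟨WithLp.toLp 2 ((u : Matrix (Fin (d + 1)) (Fin (d + 1)) ℝ).mulVec x.1.ofLp),
    mulVec_mem_sphere u x⟩

/-! ### Spherical harmonics -/

/-- The Laplacian `∑ ∂²/∂tᵢ²` on polynomials in `d+1` variables. -/
def polyLaplacian (d : ℕ) :
    MvPolynomial (Fin (d + 1)) ℂ →ₗ[ℂ] MvPolynomial (Fin (d + 1)) ℂ :=
  ∑ i, (MvPolynomial.pderiv i).toLinearMap ∘ₗ (MvPolynomial.pderiv i).toLinearMap

/-- Restriction of a polynomial in `d+1` variables to `S^d`. -/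
def restrictSph (d : ℕ) : MvPolynomial (Fin (d + 1)) ℂ →ₗ[ℂ] (Sph d → ℂ) :=
  LinearMap.pi fun x => (MvPolynomial.aeval fun i => ((x.1 i : ℝ) : ℂ)).toLinearMap

/-- The space of spherical harmonics of order `l` in `d+1` variables: restrictions to `S^d` of
the harmonic homogeneous polynomials of degree `l`. -/
def sphHarm (d l : ℕ) : Submodule ℂ (Sph d → ℂ) :=
  (MvPolynomial.homogeneousSubmodule (Fin (d + 1)) ℂ l ⊓ LinearMap.ker (polyLaplacian d)).map
    (restrictSph d)

/-- `N(d,l)`, the dimension of the space of spherical harmonics of order `l`. -/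
def harmDim (d l : ℕ) : ℕ :=
  if l = 0 then 1 else (2 * l + d - 1) * (l + d - 2)! / (l ! * (d - 1)!)

/-- For each `l`, the functions `B l q`, `1 ≤ q ≤ N(d,l)`, form an orthonormal basis of the space
of spherical harmonics of order `l`, for the inner product of `L²(S^d)`. -/
structure IsHarmonicBasis {d : ℕ} (B : ∀ l, Fin (harmDim d l) → Sph d → ℂ) : Prop where
  mem : ∀ l q, B l q ∈ sphHarm d l
  orthonormal : ∀ l q r, ∫ x, B l q x * conj (B l r x) ∂surf d = if q = r then 1 else 0
  span : ∀ l, Submodule.span ℂ (Set.range (B l)) = sphHarm d l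

section Fourier

variable {d : ℕ} (B : ∀ l, Fin (harmDim d l) → Sph d → ℂ)

/-- The hyperspherical Fourier transform of `g` at degree `l` and order `q`. -/
def fourierCoeff (g : Sph d → ℝ) (l : ℕ) (q : Fin (harmDim d l)) : ℂ :=
  ∫ x, (g x : ℂ) * conj (B l q x) ∂surf d

/-- The Fourier-Laplace series `∑ₗ (∑_q φ^l_q(g) B^l_q)` of `g` converges absolutely on `S^d`. -/
def FourierLaplaceAbsConv (g : Sph d → ℝ) : Prop :=
  ∀ x, Summable fun l => ‖∑ q, fourierCoeff B g l q * B l q x‖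

/-- `D^l_{qr}(u)`. -/
def rotCoeff (l : ℕ) (q r : Fin (harmDim d l)) (u : SO d) : ℂ :=
  ∫ x, conj (B l q (rot u x)) * B l r x ∂surf d

/-- The rotational Fourier transform of `g` at degree `l`, an `N(d,l) × N(d,l)` matrix. -/
def rotFourier (g : SO d → ℝ) (l : ℕ) :
    Matrix (Fin (harmDim d l)) (Fin (harmDim d l)) ℂ :=
  Matrix.of fun q r => ∫ u, (g u : ℂ) * rotCoeff B l q r u ∂haarSO d

/-- The deconvolution kernel `K_t(x,z)` with truncation level `t`. -/
def deconvKernel (fU : SO d → ℝ) (t : ℝ) (x z : Sph d) : ℂ :=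
  ∑ l ∈ Finset.range (⌊t⌋₊ + 1), ∑ q, (∑ r, (rotFourier B fU l)⁻¹ q r * conj (B l r z)) * B l q x

end Fourier

/-! ### The Laplace-Beltrami operator -/

/-- The extension `y ↦ f (y / ‖y‖)` of `f : S^d → ℝ`, constant along rays, to `ℝ^(d+1) ∖ {0}`
(with the value `0` at the origin). -/
def radialExt {d : ℕ} (f : Sph d → ℝ) (y : EuclideanSpace ℝ (Fin (d + 1))) : ℝ :=
  if h : y = 0 then 0 else
    f ⟨‖y‖⁻¹ • y, by rw [mem_sphere_zero_iff_norm, norm_smul, norm_inv, norm_norm,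
      inv_mul_cancel₀ (norm_ne_zero_iff.2 h)]⟩

/-- The Laplace-Beltrami operator on `S^d`: the restriction to `S^d` of the Euclidean Laplacian of
the extension of `f` that is constant along rays. -/
def laplaceBeltrami {d : ℕ} (f : Sph d → ℝ) (x : Sph d) : ℝ :=
  Laplacian.laplacian (radialExt f) (x : EuclideanSpace ℝ (Fin (d + 1)))

/-- `f ∈ C^s(S^d)`. -/
def SmoothSph {d : ℕ} (s : ℕ) (f : Sph d → ℝ) : Prop :=
  ContMDiff (𝓡 d) 𝓘(ℝ, ℝ) (s : WithTop ℕ∞) f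

/-! ### Empirical likelihood -/

/-- The empirical likelihood ratio `max {∏ (n wᵢ) : wᵢ > 0, ∑ wᵢ = 1, ∑ wᵢ Fᵢ = 0}`; the
supremum is a maximum when the set is nonempty, and is `0` when the set is empty. -/
def empLik {n : ℕ} (F : Fin n → ℝ) : ℝ :=
  sSup {p : ℝ | ∃ w : Fin n → ℝ, (∀ i, 0 < w i) ∧ ∑ i, w i = 1 ∧ ∑ i, w i * F i = 0 ∧
    p = ∏ i, ((n : ℝ) * w i)}

/-- The empirical likelihood ratio function `EL_m(θ; x)` of the regression function at `x`, based on
the observations `(z i, y i)` and on the deconvolution kernel with truncation level `t`. -/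
def regEmpLik {d : ℕ} (B : ∀ l, Fin (harmDim d l) → Sph d → ℂ) (fU : SO d → ℝ) (t : ℝ) {n : ℕ}
    (z : Fin n → Sph d) (y : Fin n → ℝ) (x : Sph d) (θ : ℝ) : ℝ :=
  empLik fun i => (deconvKernel B fU t x (z i)).re * (y i - θ)

/-- `-2 log p`, with the value `+∞` for `p = 0`. -/
def negTwoLog (p : ℝ) : EReal := -2 * ENNReal.log (ENNReal.ofReal p)

/-- The chi-square distribution with one degree of freedom, the law of the square of a standard
normal variable. -/
def chiSqOne : Measure ℝ := (gaussianReal 0 1).map fun z => z ^ 2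

instance instIsProbabilityMeasureChiSqOne : IsProbabilityMeasure chiSqOne :=
  Measure.isProbabilityMeasure_map (by fun_prop)

/-- The `(1-α)` quantile of the chi-square distribution with one degree of freedom. -/
def chiSqOneUpper (α : ℝ) : ℝ := sInf {t : ℝ | 1 - α ≤ cdf chiSqOne t}

end HyperDeconv

end

/-!
Fix `x ∈ S^d` and write `F = Re K_T(x, Z) (Y - m(x))` for the estimating function at the true value,
with `T = T_n`. The empirical likelihood does not change when its sample is multiplied by a nonzero
constant, so that the sample may be normalized by `√(n E F²)`. The proof has three ingredients.

*Empirical likelihood.* The maximization that defines it has the concave dual `∑ log (1 + t aᵢ)`. If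
the entries `aᵢ` are small and `∑ aᵢ²` is about `1`, the dual is nearly quadratic in the relevant range
of `t`, a feasible point exists, and `-2 log EL` is close to `(∑ aᵢ)²`
(`abs_neg_two_log_empLik_sub_sq_le`). In a triangular array satisfying Lindeberg's condition, whose
means are negligible, the sum of a row is asymptotically standard normal, its squares sum to about
`1`, and its entries are uniformly small; hence `-2 log EL` converges in distribution to the square of
a normal variable (`IsLindebergArray.tendstoInDistribution_negTwoLog_empLik`).

*Bias.* Integrating over the rotation inverts the convolution: `E F` is the real part of the
Fourier-Laplace series of `(m - m(x)) f_X` at `x`, truncated at `T` (`integral_deconvKernel_rot`). The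
full series has the sum `0`. Green's identity on the sphere shows that spherical harmonics of order `l`
are eigenfunctions of the Laplace-Beltrami operator with eigenvalue `-l (l + d - 1)`
(`integral_sphere_green`, `integral_laplaceBeltrami_mul_conj`). Hence the absolute convergence of the
series of `Δ^k f_X` and `Δ^k (m f_X)` makes the truncation error `o(T^(-2k))`
(`tendsto_pow_mul_truncation_error`). That the series converges to the function itself follows from
the completeness of spherical harmonics, a consequence of the Fischer decomposition and of the
Stone-Weierstrass theorem (`eq_zero_of_forall_integral_sphHarm`), together with uniform convergence,
which is where `k > d / 4` enters (`hasSum_harmProj`).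

*Moments.* Since `∑_q |B^l_q|²` is constant and equals `N(d,l) / area(S^d) = O(l^(d-1))`, the kernel is
bounded by a multiple of `T^(β+d)`, and its square has an integral of order `T^(2β+d)`
(`exists_deconvKernel_bounds`). Thus `E F²` is bounded below by a multiple of `T^(2β+d)`, because the
noise has conditional variance bounded below (`le_integral_sq_mul_sq`), and `E |F|^(2+δ)` is of order
`T^((β+d) δ) T^(2β+d)`.

With `n ≍ T^(4k+2β+d)` the normalized bias `n E F / √(n E F²)` is of order `T^(2k) |E F| = o(1)`, and
Lyapunov's ratio is of order `(T^d / n)^(δ/2) = o(1)` (`isLindebergArray_of_rates`). The level of the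
confidence region follows because the chi-square law has no atoms
(`tendsto_measureReal_le_chiSqOneUpper`).
-/

namespace HyperDeconv

/-! ### The surface measure: isometry invariance and polar coordinates -/

/-- The ambient Euclidean space `ℝ^(d+1)` of `S^d`. -/
abbrev Euc (d : ℕ) : Type := EuclideanSpace ℝ (Fin (d + 1))

theorem norm_sph {d : ℕ} (x : Sph d) : ‖(x : Euc d)‖ = 1 := mem_sphere_zero_iff_norm.1 x.2

theorem sph_ne_zero {d : ℕ} (x : Sph d) : (x : Euc d) ≠ 0 := by
  rw [← norm_ne_zero_iff, norm_sph]; exact one_ne_zero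

instance isFiniteMeasure_surf (d : ℕ) : IsFiniteMeasure (surf d) := by
  unfold surf; infer_instance

instance isOpenPosMeasure_surf (d : ℕ) : (surf d).IsOpenPosMeasure := by
  unfold surf; infer_instance

theorem integrable_surf_of_continuous {d : ℕ} {F : Type*} [NormedAddCommGroup F]
    {f : Sph d → F} (hf : Continuous f) : Integrable f (surf d) :=
  hf.integrable_of_hasCompactSupport (HasCompactSupport.of_compactSpace f)

/-- The restriction to `S^d` of a linear isometry of `ℝ^(d+1)`. -/
noncomputable def sphMap {d : ℕ} (L : Euc d ≃ₗᵢ[ℝ] Euc d) (x : Sph d) : Sph d :=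
  ⟨L x, by rw [mem_sphere_zero_iff_norm, L.norm_map, norm_sph]⟩

theorem continuous_sphMap {d : ℕ} (L : Euc d ≃ₗᵢ[ℝ] Euc d) : Continuous (sphMap L) :=
  (L.continuous.comp continuous_subtype_val).subtype_mk _

open scoped Pointwise in
theorem measurePreserving_sphMap {d : ℕ} (L : Euc d ≃ₗᵢ[ℝ] Euc d) :
    MeasurePreserving (sphMap L) (surf d) (surf d) := by
  refine ⟨(continuous_sphMap L).measurable, ?_⟩
  ext s hs
  rw [Measure.map_apply (continuous_sphMap L).measurable hs, surf,
    Measure.toSphere_apply' _ hs, Measure.toSphere_apply' _ ((continuous_sphMap L).measurable hs)]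
  congr 1
  have h : Set.Ioo (0 : ℝ) 1 • ((↑) '' (sphMap L ⁻¹' s) : Set (Euc d)) =
      L ⁻¹' (Set.Ioo (0 : ℝ) 1 • ((↑) '' s : Set (Euc d))) := by
    ext y
    simp only [Set.mem_smul, Set.mem_image, Set.mem_preimage]
    constructor
    · rintro ⟨r, hr, _, ⟨x, hx, rfl⟩, rfl⟩
      exact ⟨r, hr, _, ⟨_, hx, rfl⟩, by simp [sphMap]⟩
    · rintro ⟨r, hr, _, ⟨x, hx, rfl⟩, hy⟩
      refine ⟨r, hr, _, ⟨sphMap L.symm x, ?_, rfl⟩, ?_⟩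
      · convert hx
        exact Subtype.ext (by simp [sphMap])
      · apply L.injective
        simpa [sphMap] using hy
  rw [h]
  exact (L.measurePreserving).measure_preimage_equiv (f := L.toMeasurableEquiv) _

/-- Integration in polar coordinates of a function that factors into a radial part and a spherical
part. -/
theorem integral_eq_radial_mul_sphere {d : ℕ} (F : Euc d → ℂ) (ρ : ℝ → ℂ) (h : Sph d → ℂ)
    (hF : ∀ r : ℝ, 0 < r → ∀ ω : Sph d, F (r • (ω : Euc d)) = ρ r * h ω) :
    ∫ y, F y = (∫ r in Set.Ioi (0 : ℝ), ((r ^ d : ℝ) : ℂ) * ρ r) * ∫ ω, h ω ∂surf d := by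
  have hdim : Module.finrank ℝ (Euc d) - 1 = d := by simp
  have hmp := (volume : Measure (Euc d)).measurePreserving_homeomorphUnitSphereProd
  rw [hdim] at hmp
  have h1 : ∫ y, F y = ∫ y : ({0}ᶜ : Set (Euc d)), F y ∂(volume.comap Subtype.val) := by
    rw [integral_subtype_comap (measurableSet_singleton _).compl,
      restrict_compl_singleton]
  have h2 : ∫ y : ({0}ᶜ : Set (Euc d)), F y ∂(volume.comap Subtype.val) =
      ∫ p, h p.1 * ρ p.2 ∂((surf d).prod (Measure.volumeIoiPow d)) := by
    rw [surf, ← hmp.integral_comp (Homeomorph.measurableEmbedding _)]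
    refine integral_congr_ae (Eventually.of_forall fun y => ?_)
    have hy : (y : Euc d) ≠ 0 := y.2
    have := hF ‖(y : Euc d)‖ (norm_pos_iff.2 hy) (homeomorphUnitSphereProd _ y).1
    simp only [homeomorphUnitSphereProd_apply_fst_coe, smul_inv_smul₀ (norm_ne_zero_iff.2 hy)]
      at this
    simp only [homeomorphUnitSphereProd_apply_snd_coe]
    rw [mul_comm]; exact this
  have h3 : ∫ r, ρ (r : Set.Ioi (0 : ℝ)) ∂(Measure.volumeIoiPow d) =
      ∫ r in Set.Ioi (0 : ℝ), ((r ^ d : ℝ) : ℂ) * ρ r := by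
    rw [Measure.volumeIoiPow]
    rw [integral_withDensity_eq_integral_toReal_smul]
    · rw [← integral_subtype_comap (f := fun r : ℝ => ((r ^ d : ℝ) : ℂ) * ρ r) measurableSet_Ioi]
      refine integral_congr_ae (Eventually.of_forall fun r => ?_)
      have hr : (0 : ℝ) ≤ r.1 ^ d := pow_nonneg (le_of_lt r.2) _
      simp only [ENNReal.toReal_ofReal hr, Complex.real_smul]
    · fun_prop
    · exact Eventually.of_forall fun _ => ENNReal.ofReal_lt_top
  rw [h1, h2, integral_prod_mul (f := h) (g := fun r : Set.Ioi (0 : ℝ) => ρ r), h3, mul_comm]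

/-! ### Polynomials and spherical harmonics -/

section Polynomials

open MvPolynomial

variable {d : ℕ}

/-- The complex valued function on `ℝ^(d+1)` defined by a polynomial. -/
noncomputable def polyFun (p : MvPolynomial (Fin (d + 1)) ℂ) (y : Euc d) : ℂ :=
  aeval (fun i => ((y i : ℝ) : ℂ)) p

theorem restrictSph_apply (p : MvPolynomial (Fin (d + 1)) ℂ) (x : Sph d) :
    restrictSph d p x = polyFun p x := rfl

theorem contDiff_polyFun (p : MvPolynomial (Fin (d + 1)) ℂ) {n : WithTop ℕ∞} :
    ContDiff ℝ n (polyFun p) := by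
  induction p using MvPolynomial.induction_on with
  | C a =>
    have : polyFun (C a : MvPolynomial (Fin (d + 1)) ℂ) = fun _ => a := by ext; simp [polyFun]
    rw [this]
    exact contDiff_const
  | add p q hp hq =>
    have : polyFun (p + q) = fun y => polyFun p y + polyFun q y := by ext y; simp [polyFun]
    rw [this]; exact hp.add hq
  | mul_X p i hp =>
    have : polyFun (p * X i) = fun y => polyFun p y * ((y i : ℝ) : ℂ) := by ext y; simp [polyFun]
    rw [this]
    refine hp.mul (Complex.ofRealCLM.contDiff.comp ?_)
    exact (EuclideanSpace.proj (𝕜 := ℝ) i).contDiff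

theorem fderiv_polyFun (p : MvPolynomial (Fin (d + 1)) ℂ) (y : Euc d) (i : Fin (d + 1)) :
    fderiv ℝ (polyFun p) y (EuclideanSpace.single i 1) = polyFun (pderiv i p) y := by
  induction p using MvPolynomial.induction_on with
  | C a =>
    have : polyFun (C a : MvPolynomial (Fin (d + 1)) ℂ) = fun _ => a := by ext y; simp [polyFun]
    rw [this]; simp [polyFun]
  | add p q hp hq =>
    have : polyFun (p + q) = fun y => polyFun p y + polyFun q y := by ext y; simp [polyFun]
    rw [this, fderiv_fun_add ((contDiff_polyFun p (n := 1)).differentiable one_ne_zero _)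
      ((contDiff_polyFun q (n := 1)).differentiable one_ne_zero _), add_apply,
      hp, hq]
    simp [polyFun]
  | mul_X p j hp =>
    have h : polyFun (p * X j) = fun y => polyFun p y * ((y j : ℝ) : ℂ) := by ext y; simp [polyFun]
    have hj : HasFDerivAt (fun y : Euc d => ((y j : ℝ) : ℂ))
        (Complex.ofRealCLM.comp (EuclideanSpace.proj (𝕜 := ℝ) j)) y :=
      (Complex.ofRealCLM.comp (EuclideanSpace.proj (𝕜 := ℝ) j)).hasFDerivAt
    have hp' := ((contDiff_polyFun p (n := 1)).differentiable one_ne_zero y).hasFDerivAt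
    rw [h, (hp'.fun_mul hj).fderiv]
    by_cases hij : i = j
    · subst hij
      simp [polyFun, hp, mul_comm]
    · simp [polyFun, hp, mul_comm, Ne.symm hij, pderiv_X]

theorem polyFun_smul_real {l : ℕ} {p : MvPolynomial (Fin (d + 1)) ℂ} (hp : p.IsHomogeneous l)
    (r : ℝ) (y : Euc d) : polyFun p (r • y) = (r : ℂ) ^ l * polyFun p y := by
  simp only [polyFun, aeval_def, eval₂_eq', Finset.mul_sum]
  refine Finset.sum_congr rfl fun e he => ?_
  have hl : ∑ i, e i = l := by
    have := hp (mem_support_iff.1 he)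
    rw [← this, Finsupp.weight_apply, Finsupp.sum_fintype _ _ (by simp)]
    simp
  simp only [PiLp.smul_apply, smul_eq_mul, Complex.ofReal_mul, mul_pow, Finset.prod_mul_distrib,
    Finset.prod_pow_eq_pow_sum, hl]
  ring

theorem laplacian_eq_sum_fderiv {F : Type*} [NormedAddCommGroup F] [NormedSpace ℝ F] (f : Euc d → F)
    (y : Euc d) (hf : ContDiffAt ℝ 2 f y) :
    Laplacian.laplacian f y = ∑ i, fderiv ℝ (fun z => fderiv ℝ f z (EuclideanSpace.single i 1)) y
      (EuclideanSpace.single i 1) := by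
  rw [InnerProductSpace.laplacian_eq_iteratedFDeriv_orthonormalBasis f (EuclideanSpace.basisFun (Fin (d+1)) ℝ)]
  refine Finset.sum_congr rfl fun i _ => ?_
  rw [iteratedFDeriv_two_apply]
  have hd : DifferentiableAt ℝ (fderiv ℝ f) y :=
    (hf.fderiv_right (m := 1) (by norm_num)).differentiableAt one_ne_zero
  rw [fderiv_clm_apply hd (differentiableAt_const _)]
  simp

theorem laplacian_polyFun (p : MvPolynomial (Fin (d + 1)) ℂ) (y : Euc d) :
    Laplacian.laplacian (polyFun p) y = polyFun (polyLaplacian d p) y := by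
  rw [laplacian_eq_sum_fderiv _ _ (contDiff_polyFun p).contDiffAt]
  simp only [fderiv_polyFun]
  simp [polyLaplacian, polyFun]

/-- The polynomial `∑ᵢ Xᵢ²`. -/
noncomputable def sqNormPoly (d : ℕ) : MvPolynomial (Fin (d + 1)) ℂ := ∑ i, X i ^ 2

theorem sqNormPoly_isHomogeneous : (sqNormPoly d).IsHomogeneous 2 :=
  IsHomogeneous.sum _ _ _ fun i _ => isHomogeneous_X_pow i 2

theorem polyFun_sqNormPoly (x : Sph d) : polyFun (sqNormPoly d) (x : Euc d) = 1 := by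
  have h := EuclideanSpace.real_norm_sq_eq (x : Euc d)
  rw [norm_sph, one_pow] at h
  simp only [polyFun, sqNormPoly, map_sum, map_pow, aeval_X]
  exact_mod_cast h.symm

theorem sqNormPoly_ne_zero : sqNormPoly d ≠ 0 := by
  intro h
  have h1 := polyFun_sqNormPoly (d := d) ⟨EuclideanSpace.single 0 1, by simp⟩
  rw [h] at h1
  simp [polyFun] at h1

theorem polyLaplacian_apply (p : MvPolynomial (Fin (d + 1)) ℂ) :
    polyLaplacian d p = ∑ i, pderiv i (pderiv i p) := by
  simp [polyLaplacian]

theorem IsHomogeneous.polyLaplacian {m : ℕ} {p : MvPolynomial (Fin (d + 1)) ℂ}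
    (hp : p.IsHomogeneous m) : (polyLaplacian d p).IsHomogeneous (m - 2) := by
  rw [polyLaplacian_apply]
  exact IsHomogeneous.sum _ _ _ fun i _ => by simpa [Nat.sub_sub] using hp.pderiv.pderiv

theorem polyLaplacian_eq_zero_of_lt_two {m : ℕ} (hm : m < 2) {p : MvPolynomial (Fin (d + 1)) ℂ}
    (hp : p.IsHomogeneous m) : HyperDeconv.polyLaplacian d p = 0 := by
  rw [polyLaplacian_apply]
  refine Finset.sum_eq_zero fun i _ => ?_
  have h : (pderiv i p).IsHomogeneous 0 := by
    have := hp.pderiv (i := i)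
    rwa [show m - 1 = 0 by omega] at this
  rw [← totalDegree_zero_iff_isHomogeneous, totalDegree_eq_zero_iff_eq_C] at h
  rw [h, pderiv_C]

theorem polyLaplacian_sqNormPoly_mul {m : ℕ} {q : MvPolynomial (Fin (d + 1)) ℂ}
    (hq : q.IsHomogeneous m) : HyperDeconv.polyLaplacian d (sqNormPoly d * q) =
      (4 * m + 2 * (d + 1)) • q + sqNormPoly d * HyperDeconv.polyLaplacian d q := by
  have h1 : ∀ i, pderiv i (sqNormPoly d) = 2 * X i := by
    intro i
    rw [sqNormPoly, map_sum, Finset.sum_eq_single i]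
    · simp [sq]; ring
    · intro j _ hj; simp [sq, pderiv_X, hj]
    · simp
  have h2 : ∀ i, pderiv i (pderiv i (sqNormPoly d * q)) =
      2 * q + 4 * (X i * pderiv i q) + sqNormPoly d * pderiv i (pderiv i q) := by
    intro i
    have h3 : pderiv i (2 : MvPolynomial (Fin (d + 1)) ℂ) = 0 := by
      exact_mod_cast (pderiv i).map_natCast 2
    simp only [Derivation.leibniz, smul_eq_mul, map_add, h1, h3, pderiv_X_self]
    ring
  rw [polyLaplacian_apply, polyLaplacian_apply]
  simp only [h2, Finset.sum_add_distrib, ← Finset.mul_sum, hq.sum_X_mul_pderiv]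
  simp
  ring

/-- The Laplacian of `|X|^(2(j+1)) q` for a homogeneous `q`; what matters about the constant is that it
is positive. -/
theorem polyLaplacian_sqNormPoly_pow_mul {m : ℕ} {q : MvPolynomial (Fin (d + 1)) ℂ}
    (hq : q.IsHomogeneous m) (j : ℕ) : ∃ c : ℕ, 0 < c ∧
      HyperDeconv.polyLaplacian d (sqNormPoly d ^ (j + 1) * q) =
      c • (sqNormPoly d ^ j * q) + sqNormPoly d ^ (j + 1) * HyperDeconv.polyLaplacian d q := by
  induction j with
  | zero =>
    exact ⟨4 * m + 2 * (d + 1), by positivity, by simpa using polyLaplacian_sqNormPoly_mul hq⟩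
  | succ j ih =>
    obtain ⟨c, hc, h⟩ := ih
    have hh : (sqNormPoly d ^ (j + 1) * q).IsHomogeneous (2 * (j + 1) + m) :=
      (sqNormPoly_isHomogeneous.pow _).mul hq
    refine ⟨4 * (2 * (j + 1) + m) + 2 * (d + 1) + c, by positivity, ?_⟩
    rw [pow_succ' _ (j + 1), mul_assoc, polyLaplacian_sqNormPoly_mul hh, h]
    simp only [nsmul_eq_mul]
    push_cast
    ring

/-- Multiplication by a positive power of `∑ᵢ Xᵢ²` followed by the Laplacian is injective on
homogeneous polynomials. Up to a positive factor, a `q` in the kernel equals `-|X|² Δq`, so that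
`Δq`, of smaller degree, is again in the kernel of such a map. -/
theorem eq_zero_of_polyLaplacian_sqNormPoly_pow_mul (m : ℕ) :
    ∀ (j : ℕ) (q : MvPolynomial (Fin (d + 1)) ℂ), q.IsHomogeneous m →
      HyperDeconv.polyLaplacian d (sqNormPoly d ^ (j + 1) * q) = 0 → q = 0 := by
  induction m using Nat.strong_induction_on with
  | _ m ih =>
    intro j q hq h
    obtain ⟨c, hc, hc'⟩ := polyLaplacian_sqNormPoly_pow_mul hq j
    rw [h] at hc'
    have hpow : sqNormPoly d ^ j ≠ 0 := pow_ne_zero _ sqNormPoly_ne_zero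
    have h0 : HyperDeconv.polyLaplacian d q = 0 := by
      by_cases hm : m < 2
      · exact polyLaplacian_eq_zero_of_lt_two hm hq
      · refine ih (m - 2) (by omega) (j + 1) _ (IsHomogeneous.polyLaplacian hq) ?_
        have h1 : sqNormPoly d ^ (j + 1 + 1) * HyperDeconv.polyLaplacian d q =
            -(c • (sqNormPoly d ^ (j + 1) * q)) := by
          simp only [nsmul_eq_mul] at hc' ⊢
          linear_combination (-sqNormPoly d) * hc'
        rw [h1, map_neg, map_nsmul, h]
        simp
    rw [h0, mul_zero, add_zero, nsmul_eq_mul] at hc'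
    have hc0 : (c : MvPolynomial (Fin (d + 1)) ℂ) ≠ 0 := Nat.cast_ne_zero.2 hc.ne'
    simpa [hc0, hpow] using hc'.symm

/-- The Fischer decomposition: modulo multiples of `∑ᵢ Xᵢ²`, every homogeneous polynomial is harmonic.
The map `q ↦ Δ(|X|² q)` is an injective, hence surjective, endomorphism of a finite dimensional space
of homogeneous polynomials, so that `Δ(|X|² q) = Δp` can be solved for `q`. -/
theorem exists_harmonic_add_sqNormPoly_mul {m : ℕ} {p : MvPolynomial (Fin (d + 1)) ℂ}
    (hp : p.IsHomogeneous (m + 2)) : ∃ h q : MvPolynomial (Fin (d + 1)) ℂ,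
      h.IsHomogeneous (m + 2) ∧ HyperDeconv.polyLaplacian d h = 0 ∧ q.IsHomogeneous m ∧
      p = h + sqNormPoly d * q := by
  have hfin : FiniteDimensional ℂ (homogeneousSubmodule (Fin (d + 1)) ℂ m) :=
    Module.Finite.iff_fg.2 (homogeneousSubmodule_fg _ _ m)
  let T : homogeneousSubmodule (Fin (d + 1)) ℂ m →ₗ[ℂ] homogeneousSubmodule (Fin (d + 1)) ℂ m :=
    ((HyperDeconv.polyLaplacian d ∘ₗ LinearMap.mulLeft ℂ (sqNormPoly d)) ∘ₗ
      (homogeneousSubmodule (Fin (d + 1)) ℂ m).subtype).codRestrict _ fun q => by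
        have h := IsHomogeneous.polyLaplacian (sqNormPoly_isHomogeneous.mul q.2)
        simpa using h
  have hT : Function.Injective T := by
    rw [← LinearMap.ker_eq_bot, LinearMap.ker_eq_bot']
    intro q hq
    refine Subtype.ext (eq_zero_of_polyLaplacian_sqNormPoly_pow_mul m 0 q.1 q.2 ?_)
    have := congrArg Subtype.val hq
    simpa [T] using this
  obtain ⟨q, hq⟩ := LinearMap.injective_iff_surjective.1 hT
    ⟨HyperDeconv.polyLaplacian d p, by simpa using IsHomogeneous.polyLaplacian hp⟩
  have hq' : HyperDeconv.polyLaplacian d (sqNormPoly d * q.1) = HyperDeconv.polyLaplacian d p := by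
    simpa [T] using congrArg Subtype.val hq
  refine ⟨p - sqNormPoly d * q.1, q.1, ?_, ?_, q.2, by ring⟩
  · exact hp.sub (by simpa [add_comm] using sqNormPoly_isHomogeneous.mul q.2)
  · rw [map_sub, hq', sub_self]

theorem restrictSph_mem_iSup_of_isHomogeneous (m : ℕ) :
    ∀ p : MvPolynomial (Fin (d + 1)) ℂ, p.IsHomogeneous m →
      restrictSph d p ∈ ⨆ l, sphHarm d l := by
  induction m using Nat.strong_induction_on with
  | _ m ih =>
    intro p hp
    by_cases hm : m < 2
    · exact Submodule.mem_iSup_of_mem m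
        (Submodule.mem_map_of_mem ⟨hp, polyLaplacian_eq_zero_of_lt_two hm hp⟩)
    · obtain ⟨m, rfl⟩ : ∃ k, m = k + 2 := ⟨m - 2, by omega⟩
      obtain ⟨h, q, hh, hh0, hq, rfl⟩ := exists_harmonic_add_sqNormPoly_mul hp
      rw [map_add]
      refine Submodule.add_mem _ (Submodule.mem_iSup_of_mem (m + 2)
        (Submodule.mem_map_of_mem ⟨hh, hh0⟩)) ?_
      have : restrictSph d (sqNormPoly d * q) = restrictSph d q := by
        ext x
        rw [restrictSph_apply, restrictSph_apply, polyFun, map_mul]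
        change polyFun (sqNormPoly d) (x : Euc d) * _ = _
        rw [polyFun_sqNormPoly, one_mul]; rfl
      rw [this]
      exact ih m (by omega) q hq

/-- The restriction of a polynomial to the sphere is a sum of spherical harmonics: by the Fischer
decomposition, since `∑ᵢ Xᵢ²` restricts to `1`. -/
theorem restrictSph_mem_iSup (p : MvPolynomial (Fin (d + 1)) ℂ) :
    restrictSph d p ∈ ⨆ l, sphHarm d l := by
  rw [← sum_homogeneousComponent p, map_sum]
  exact Submodule.sum_mem _ fun i _ =>
    restrictSph_mem_iSup_of_isHomogeneous i _ (homogeneousComponent_isHomogeneous i p)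

theorem continuous_of_mem_sphHarm {l : ℕ} {f : Sph d → ℂ} (hf : f ∈ sphHarm d l) :
    Continuous f := by
  obtain ⟨p, -, rfl⟩ := hf
  exact (contDiff_polyFun p (n := 0)).continuous.comp continuous_subtype_val

theorem aeval_coords_apply (p : MvPolynomial (Fin (d + 1)) ℂ) (x : Sph d) :
    (aeval (R := ℂ) fun i : Fin (d + 1) =>
      (⟨fun x : Sph d => ((x.1 i : ℝ) : ℂ), by fun_prop⟩ : C(Sph d, ℂ))).toRingHom p x =
    restrictSph d p x :=
  comp_aeval_apply _ (ContinuousMap.evalAlgHom ℂ ℂ x) p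

/-- The restrictions of the complex polynomials to `S^d`, a star subalgebra of `C(S^d, ℂ)`. -/
noncomputable def polyStarSubalgebra (d : ℕ) : StarSubalgebra ℂ C(Sph d, ℂ) where
  toSubalgebra := (aeval (R := ℂ) fun i : Fin (d + 1) =>
    (⟨fun x : Sph d => ((x.1 i : ℝ) : ℂ), by fun_prop⟩ : C(Sph d, ℂ))).range
  star_mem' := by
    rintro _ ⟨p, rfl⟩
    change star _ ∈ (aeval _).range
    induction p using MvPolynomial.induction_on with
    | C a => exact ⟨C (conj a), by ext x; simp⟩
    | add p q hp hq =>
      have := add_mem hp hq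
      simpa using this
    | mul_X p i hp =>
      have := mul_mem hp (AlgHom.mem_range_self (aeval (R := ℂ) fun i : Fin (d + 1) =>
        (⟨fun x : Sph d => ((x.1 i : ℝ) : ℂ), by fun_prop⟩ : C(Sph d, ℂ))) (X i))
      convert this using 1
      ext x
      simp

theorem polyStarSubalgebra_separatesPoints : (polyStarSubalgebra d).SeparatesPoints := by
  intro x y hxy
  obtain ⟨i, hi⟩ : ∃ i, x.1 i ≠ y.1 i := by
    by_contra! h
    exact hxy (Subtype.ext (by ext i; exact h i))
  refine ⟨_, ⟨_, ⟨X i, rfl⟩, rfl⟩, ?_⟩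
  simpa using hi

/-- Completeness of the spherical harmonics: a continuous function orthogonal to all of them is
orthogonal to a dense subset of `C(S^d, ℂ)`, hence to itself. -/
theorem eq_zero_of_forall_integral_sphHarm {f : Sph d → ℂ} (hf : Continuous f)
    (h : ∀ l, ∀ g ∈ sphHarm d l, ∫ x, f x * conj (g x) ∂surf d = 0) : f = 0 := by
  let F : C(Sph d, ℂ) := ⟨f, hf⟩
  let E := ContinuousMap.toLp (E := ℂ) 2 (surf d) ℂ
  have hcl : IsClosed {g : C(Sph d, ℂ) | inner ℂ (E g) (E F) = 0} :=
    isClosed_eq ((E.continuous.inner continuous_const)) continuous_const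
  have hsub : (polyStarSubalgebra d : Set C(Sph d, ℂ)) ⊆ {g | inner ℂ (E g) (E F) = 0} := by
    rintro _ ⟨p, rfl⟩
    rw [Set.mem_ofPred_eq, ContinuousMap.inner_toLp]
    have key : ∀ g : Sph d → ℂ, g ∈ (⨆ l, sphHarm d l) →
        Continuous g ∧ ∫ x, f x * conj (g x) ∂surf d = 0 := by
      intro g hg
      induction hg using Submodule.iSup_induction' with
      | mem l g hg => exact ⟨continuous_of_mem_sphHarm hg, h l g hg⟩
      | zero => exact ⟨continuous_const, by simp⟩
      | add g₁ g₂ _ _ h₁ h₂ =>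
        refine ⟨h₁.1.add h₂.1, ?_⟩
        simp only [Pi.add_apply, map_add, mul_add]
        rw [integral_add, h₁.2, h₂.2, add_zero]
        · exact integrable_surf_of_continuous (hf.mul (Complex.continuous_conj.comp h₁.1))
        · exact integrable_surf_of_continuous (hf.mul (Complex.continuous_conj.comp h₂.1))
    have h2 := (key _ (restrictSph_mem_iSup p)).2
    refine Eq.trans (integral_congr_ae (Eventually.of_forall fun x => ?_)) h2
    change f x * conj _ = f x * conj _
    rw [aeval_coords_apply]
  -- the Stone-Weierstrass theorem
  have htop : closure (polyStarSubalgebra d : Set C(Sph d, ℂ)) = Set.univ := by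
    rw [← StarSubalgebra.topologicalClosure_coe,
      ContinuousMap.starSubalgebra_topologicalClosure_eq_top_of_separatesPoints _
        polyStarSubalgebra_separatesPoints]
    rfl
  have hF : inner ℂ (E F) (E F) = 0 := (htop ▸ hcl.closure_subset_iff.2 hsub) (Set.mem_univ F)
  have hF0 : E F = 0 := inner_self_eq_zero.1 hF
  have := ContinuousMap.toLp_injective (surf d) (hF0.trans (map_zero E).symm)
  exact congrArg (fun g : C(Sph d, ℂ) => (g : Sph d → ℂ)) this

end Polynomials

/-! ### Green's identity on the sphere for homogeneous functions -/

section Green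

variable {d : ℕ}

/-- Integration by parts on the half line, for the derivative of `s η(s)` at `s = r²`. -/
theorem integral_Ioi_deriv_weight {η : ℝ → ℝ} (hη : ContDiff ℝ 1 η) (hc : HasCompactSupport η)
    (M : ℕ) :
    ∫ r in Set.Ioi (0 : ℝ), r ^ M * (2 * (η (r ^ 2) + r ^ 2 * deriv η (r ^ 2))) =
      -((M : ℝ) - 1) * ∫ r in Set.Ioi (0 : ℝ), r ^ M * η (r ^ 2) := by
  have hcomp : HasCompactSupport fun r : ℝ => η (r ^ 2) := by
    obtain ⟨R, hR⟩ := hc.isCompact.isBounded.subset_closedBall 0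
    refine HasCompactSupport.intro (isCompact_closedBall (0 : ℝ) (1 + |R|)) fun r hr => ?_
    refine image_eq_zero_of_notMem_tsupport fun h => hr ?_
    have h1 := hR h
    simp only [Metric.mem_closedBall, dist_zero_right, Real.norm_eq_abs] at h1 ⊢
    rw [abs_of_nonneg (sq_nonneg r)] at h1
    nlinarith [le_abs_self R, sq_abs r, abs_nonneg r, abs_nonneg R]
  have hcomp' : HasCompactSupport fun r : ℝ => deriv η (r ^ 2) := by
    obtain ⟨R, hR⟩ := hc.deriv.isCompact.isBounded.subset_closedBall 0
    refine HasCompactSupport.intro (isCompact_closedBall (0 : ℝ) (1 + |R|)) fun r hr => ?_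
    refine image_eq_zero_of_notMem_tsupport fun h => hr ?_
    have h1 := hR h
    simp only [Metric.mem_closedBall, dist_zero_right, Real.norm_eq_abs] at h1 ⊢
    rw [abs_of_nonneg (sq_nonneg r)] at h1
    nlinarith [le_abs_self R, sq_abs r, abs_nonneg r, abs_nonneg R]
  have hcd : Continuous (deriv η) := hη.continuous_deriv le_rfl
  have hf : ContDiff ℝ 1 fun r : ℝ => r ^ (M + 1) * η (r ^ 2) := by fun_prop
  have h0 := HasCompactSupport.integral_Ioi_deriv_eq hf (hcomp.mul_left (f := fun r => r ^ (M + 1))) 0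
  have hder : ∀ r : ℝ, deriv (fun r : ℝ => r ^ (M + 1) * η (r ^ 2)) r =
      (M + 1) * (r ^ M * η (r ^ 2)) + 2 * (r ^ M * (r ^ 2 * deriv η (r ^ 2))) := by
    intro r
    have h1 : HasDerivAt η (deriv η (r ^ 2)) (r ^ 2) :=
      (hη.differentiable one_ne_zero _).hasDerivAt
    have hsq : HasDerivAt (fun r : ℝ => r ^ 2) (2 * r) r := by simpa using hasDerivAt_pow 2 r
    have h1' : HasDerivAt (fun r : ℝ => η (r ^ 2)) (deriv η (r ^ 2) * (2 * r)) r :=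
      HasDerivAt.comp (h₂ := η) r h1 hsq
    refine ((hasDerivAt_pow (M + 1) r).fun_mul h1').deriv.trans ?_
    push_cast
    ring
  have i1 : Integrable (fun r : ℝ => r ^ M * η (r ^ 2)) :=
    ((by fun_prop : Continuous fun r : ℝ => r ^ M).mul
      (hη.continuous.comp (by fun_prop))).integrable_of_hasCompactSupport hcomp.mul_left
  have i2 : Integrable (fun r : ℝ => r ^ M * (r ^ 2 * deriv η (r ^ 2))) :=
    ((by fun_prop : Continuous fun r : ℝ => r ^ M).mul ((by fun_prop : Continuous fun r : ℝ => r ^ 2).mul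
      (hcd.comp (by fun_prop)))).integrable_of_hasCompactSupport hcomp'.mul_left.mul_left
  simp only [hder] at h0
  rw [integral_add (i1.integrableOn.const_mul _) (i2.integrableOn.const_mul _),
    integral_const_mul, integral_const_mul] at h0
  have h3 : ∫ r in Set.Ioi (0 : ℝ), r ^ M * (2 * (η (r ^ 2) + r ^ 2 * deriv η (r ^ 2))) =
      2 * (∫ r in Set.Ioi (0 : ℝ), r ^ M * η (r ^ 2)) +
      2 * ∫ r in Set.Ioi (0 : ℝ), r ^ M * (r ^ 2 * deriv η (r ^ 2)) := by
    rw [← integral_const_mul, ← integral_const_mul, ← integral_add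
      (i1.integrableOn.const_mul _) (i2.integrableOn.const_mul _)]
    refine integral_congr_ae (Eventually.of_forall fun r => ?_)
    simp only
    ring
  rw [h3]
  simp at h0
  linarith

/-- A cutoff vanishing near the origin removes a possible singularity there. -/
theorem continuous_mul_of_zero_notMem_tsupport {χ u : Euc d → ℂ} (hχ : Continuous χ)
    (h0 : (0 : Euc d) ∉ tsupport χ) (hu : ∀ y, y ≠ 0 → ContinuousAt u y) :
    Continuous fun y => χ y * u y := by
  rw [continuous_iff_continuousAt]
  intro y
  by_cases hy : y ∈ tsupport χ
  · exact hχ.continuousAt.mul (hu y fun h => h0 (h ▸ hy))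
  · have : (fun y => χ y * u y) =ᶠ[𝓝 y] fun _ => 0 := by
      filter_upwards [(isClosed_tsupport χ).isOpen_compl.mem_nhds hy] with z hz
      rw [image_eq_zero_of_notMem_tsupport hz, zero_mul]
    exact continuousAt_const.congr this.symm

/-- Integration by parts against a compactly supported weight that vanishes near the origin, where the
other factor may be singular. -/
theorem integral_mul_fderiv_of_punctured {χ w : Euc d → ℂ} (hχ : ContDiff ℝ 1 χ)
    (hc : HasCompactSupport χ) (h0 : (0 : Euc d) ∉ tsupport χ)
    (hw : ∀ y, y ≠ 0 → ContDiffAt ℝ 1 w y) (v : Euc d) :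
    ∫ y, χ y * fderiv ℝ w y v = -∫ y, fderiv ℝ χ y v * w y := by
  have hcd : Continuous fun y => fderiv ℝ χ y v :=
    (hχ.continuous_fderiv one_ne_zero).clm_apply continuous_const
  have hsub : tsupport (fun y => fderiv ℝ χ y v) ⊆ tsupport χ :=
    tsupport_fderiv_apply_subset ℝ v
  have hcc : HasCompactSupport (fun y => fderiv ℝ χ y v) := hc.fderiv_apply (𝕜 := ℝ) v
  refine integral_mul_fderiv_eq_neg_fderiv_mul_of_integrable ?_ ?_ ?_ ?_ ?_
  · exact (continuous_mul_of_zero_notMem_tsupport hcd (fun h => h0 (hsub h))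
      fun y hy => (hw y hy).continuousAt).integrable_of_hasCompactSupport hcc.mul_right
  · refine (continuous_mul_of_zero_notMem_tsupport hχ.continuous h0
      fun y hy => ?_).integrable_of_hasCompactSupport hc.mul_right
    exact ((hw y hy).fderiv_right (m := 0) (by norm_num)).continuousAt.clm_apply continuousAt_const
  · exact (continuous_mul_of_zero_notMem_tsupport hχ.continuous h0
      fun y hy => (hw y hy).continuousAt).integrable_of_hasCompactSupport hc.mul_right
  · exact fun y _ => hχ.differentiable one_ne_zero y
  · exact fun y hy => (hw y fun h => h0 (h ▸ hy)).differentiableAt one_ne_zero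

/-- Positive homogeneity of degree `a` away from the origin. -/
def HomogeneousOff (a : ℕ) (G : Euc d → ℂ) : Prop :=
  ∀ r : ℝ, 0 < r → ∀ y, y ≠ 0 → G (r • y) = (r : ℂ) ^ a * G y

/-- Differentiation of a scaling identity. The two constants allow it to be applied to `G` and then to
the derivatives of `G`, whose degree `a - 1` is not a natural number if `a = 0`. -/
theorem fderiv_homogeneous {G : Euc d → ℂ} (hG : ∀ y, y ≠ 0 → DifferentiableAt ℝ G y) {c₁ c₂ : ℂ}
    {r : ℝ} (hr : 0 < r) (h : ∀ y, y ≠ 0 → c₁ * G (r • y) = c₂ * G y) (v : Euc d) (y : Euc d)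
    (hy : y ≠ 0) : c₁ * r * fderiv ℝ G (r • y) v = c₂ * fderiv ℝ G y v := by
  have hry : r • y ≠ 0 := smul_ne_zero hr.ne' hy
  have h1 : HasFDerivAt (fun z => c₁ * G (r • z))
      (c₁ • ((fderiv ℝ G (r • y)).comp (r • ContinuousLinearMap.id ℝ (Euc d)))) y := by
    refine HasFDerivAt.const_mul ?_ c₁
    refine HasFDerivAt.comp y (hG _ hry).hasFDerivAt ?_
    exact (r • ContinuousLinearMap.id ℝ (Euc d)).hasFDerivAt
  have h2 : HasFDerivAt (fun z => c₂ * G z) (c₂ • fderiv ℝ G y) y :=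
    (hG y hy).hasFDerivAt.const_mul c₂
  have h3 : (fun z => c₁ * G (r • z)) =ᶠ[𝓝 y] fun z => c₂ * G z := by
    filter_upwards [isOpen_ne.mem_nhds hy] with z hz using h z hz
  have h4 := congrArg (fun L : Euc d →L[ℝ] ℂ => L v) ((h1.congr_of_eventuallyEq h3.symm).unique h2)
  simp at h4
  rw [← h4]; ring

theorem contDiffAt_fderiv_apply {G : Euc d → ℂ} {y : Euc d} (hG : ContDiffAt ℝ 2 G y)
    (v : Euc d) : ContDiffAt ℝ 1 (fun z => fderiv ℝ G z v) y :=
  (hG.fderiv_right (m := 1) (by norm_num)).clm_apply contDiffAt_const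

/-- The Laplacian lowers the degree of homogeneity by two. -/
theorem laplacian_homogeneous {G : Euc d → ℂ} {a : ℕ} (hG : ∀ y, y ≠ 0 → ContDiffAt ℝ 2 G y)
    (ha : HomogeneousOff a G) {r : ℝ} (hr : 0 < r) {y : Euc d} (hy : y ≠ 0) :
    (r : ℂ) ^ 2 * Laplacian.laplacian G (r • y) = (r : ℂ) ^ a * Laplacian.laplacian G y := by
  rw [laplacian_eq_sum_fderiv _ _ (hG y hy),
    laplacian_eq_sum_fderiv _ _ (hG _ (smul_ne_zero hr.ne' hy)), Finset.mul_sum, Finset.mul_sum]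
  refine Finset.sum_congr rfl fun i _ => ?_
  have h1 := fun z hz => fderiv_homogeneous (c₁ := 1) (c₂ := (r : ℂ) ^ a)
    (fun y hy => (hG y hy).differentiableAt two_ne_zero) hr
    (fun y hy => by rw [one_mul]; exact ha r hr y hy) (EuclideanSpace.single i 1) z hz
  have h2 := fderiv_homogeneous
    (fun y hy => (contDiffAt_fderiv_apply (hG y hy) (EuclideanSpace.single i 1)).differentiableAt
      one_ne_zero) hr h1 (EuclideanSpace.single i 1) y hy
  rw [← h2]; ring

/-- Euler's identity. -/
theorem fderiv_self_homogeneous {G : Euc d → ℂ} {a : ℕ}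
    (ha : HomogeneousOff a G) {y : Euc d} (hy : y ≠ 0) (hG : DifferentiableAt ℝ G y) :
    fderiv ℝ G y y = a * G y := by
  have h1 : HasDerivAt (fun r : ℝ => G (r • y)) (fderiv ℝ G y y) 1 := by
    have h := (hasDerivAt_id (1 : ℝ)).smul_const y
    have hG' : HasFDerivAt G (fderiv ℝ G y) ((1 : ℝ) • y) := by
      rw [one_smul]; exact hG.hasFDerivAt
    simpa [Function.comp_def] using hG'.comp_hasDerivAt (1 : ℝ) h
  have h2 : HasDerivAt (fun r : ℝ => (r : ℂ) ^ a * G y) (a * G y) 1 := by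
    have h := ((Complex.ofRealCLM.hasDerivAt (x := (1 : ℝ))).pow a).mul_const (G y)
    simpa using h
  refine (h1.congr_of_eventuallyEq ?_).unique h2
  filter_upwards [lt_mem_nhds (zero_lt_one' ℝ)] with r hr using (ha r hr y hy).symm

/-- A smooth bump supported in `[1/2, 3/2]`, used as a radial weight in the variable `‖y‖²`. -/
noncomputable def radialBump : ContDiffBump (1 : ℝ) := ⟨1 / 4, 1 / 2, by norm_num, by norm_num⟩

/-- The radial weight `‖y‖² η(‖y‖²)` with `η` the bump `radialBump`. -/
noncomputable def radialWeight (d : ℕ) (y : Euc d) : ℂ :=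
  ((‖y‖ ^ 2 * radialBump (‖y‖ ^ 2) : ℝ) : ℂ)

theorem contDiff_radialWeight : ContDiff ℝ 1 (radialWeight d) := by
  refine Complex.ofRealCLM.contDiff.comp ?_
  exact (contDiff_norm_sq ℝ).mul ((radialBump.contDiff (n := 1)).comp (contDiff_norm_sq ℝ))

theorem tsupport_radialWeight_subset :
    tsupport (radialWeight d) ⊆ {y | ‖y‖ ^ 2 ∈ Set.Icc (1 / 2 : ℝ) (3 / 2)} := by
  refine closure_minimal (fun y hy => ?_)
    (isClosed_Icc.preimage (by fun_prop : Continuous fun y : Euc d => ‖y‖ ^ 2))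
  have h1 : radialBump (‖y‖ ^ 2) ≠ 0 := fun h => hy (by simp [radialWeight, h])
  have h2 := radialBump.support_eq ▸ (Function.mem_support.2 h1)
  simp only [radialBump, Metric.mem_ball, Real.dist_eq, abs_lt] at h2
  constructor <;> linarith

theorem hasCompactSupport_radialWeight : HasCompactSupport (radialWeight d) := by
  refine HasCompactSupport.of_support_subset_isCompact (isCompact_closedBall (0 : Euc d) 2)
    fun y hy => ?_
  have h := (tsupport_radialWeight_subset (subset_tsupport _ hy)).2
  rw [mem_closedBall_zero_iff]
  nlinarith [norm_nonneg y]

theorem zero_notMem_tsupport_radialWeight : (0 : Euc d) ∉ tsupport (radialWeight d) := by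
  intro h
  have := (tsupport_radialWeight_subset h).1
  norm_num at this

theorem fderiv_radialWeight (y v : Euc d) : fderiv ℝ (radialWeight d) y v =
    ((2 * (radialBump (‖y‖ ^ 2) + ‖y‖ ^ 2 * deriv radialBump (‖y‖ ^ 2)) : ℝ) : ℂ) *
      ((inner ℝ y v : ℝ) : ℂ) := by
  have h1 : HasFDerivAt (fun y : Euc d => ‖y‖ ^ 2) (2 • innerSL ℝ y) y :=
    (hasStrictFDerivAt_norm_sq y).hasFDerivAt
  have h2 : HasDerivAt (fun s : ℝ => s * radialBump s)
      (radialBump (‖y‖ ^ 2) + ‖y‖ ^ 2 * deriv radialBump (‖y‖ ^ 2)) (‖y‖ ^ 2) := by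
    have := (hasDerivAt_id' (‖y‖ ^ 2)).fun_mul
      ((radialBump.contDiff (n := 1)).differentiable one_ne_zero (‖y‖ ^ 2)).hasDerivAt
    simpa using this
  have h3 := Complex.ofRealCLM.hasFDerivAt.comp y (h2.comp_hasFDerivAt y h1)
  have h4 : fderiv ℝ (radialWeight d) y = _ := h3.fderiv
  rw [h4]
  simp
  ring

theorem integral_radialBump_pos (M : ℕ) :
    0 < ∫ r in Set.Ioi (0 : ℝ), r ^ M * radialBump (r ^ 2) := by
  have hcont : Continuous fun r : ℝ => r ^ M * radialBump (r ^ 2) := by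
    have := radialBump.continuous
    fun_prop
  rw [setIntegral_pos_iff_support_of_nonneg_ae]
  · have ho : IsOpen (Function.support (fun r : ℝ => r ^ M * radialBump (r ^ 2)) ∩ Set.Ioi 0) :=
      (hcont.isOpen_support).inter isOpen_Ioi
    refine ho.measure_pos _ ⟨1, ?_, Set.mem_Ioi.2 one_pos⟩
    have : radialBump (1 : ℝ) = 1 := radialBump.one_of_mem_closedBall (by simp [radialBump])
    simp [this]
  · filter_upwards [ae_restrict_mem measurableSet_Ioi] with r hr
    exact mul_nonneg (pow_nonneg (le_of_lt hr) _) radialBump.nonneg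
  · refine (hcont.integrable_of_hasCompactSupport ?_).integrableOn
    refine HasCompactSupport.intro (isCompact_closedBall (0 : ℝ) 2) fun r hr => ?_
    have h1 : r ^ 2 ∉ Function.support radialBump := by
      rw [radialBump.support_eq]
      simp only [radialBump, Metric.mem_ball, Real.dist_eq, abs_lt, Metric.mem_closedBall,
        sub_zero, not_le] at hr ⊢
      intro h
      nlinarith [sq_abs r]
    rw [Function.notMem_support.1 h1, mul_zero]

/-- Green's identity on the sphere for two homogeneous functions: the Euclidean divergence of
`χ (P ∇G - G ∇P)`, with a radial weight `χ`, integrates to zero, and all the terms factor in polar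
coordinates. -/
theorem integral_sphere_green {G P : Euc d → ℂ} {a l : ℕ}
    (hG : ∀ y, y ≠ 0 → ContDiffAt ℝ 2 G y) (hP : ∀ y, y ≠ 0 → ContDiffAt ℝ 2 P y)
    (ha : HomogeneousOff a G) (hl : HomogeneousOff l P) :
    ∫ x : Sph d, (P x * Laplacian.laplacian G (x : Euc d) -
        G x * Laplacian.laplacian P (x : Euc d)) ∂surf d =
      ((a : ℂ) - l) * (a + l + d - 1) * ∫ x : Sph d, P x * G x ∂surf d := by
  set e : Fin (d + 1) → Euc d := fun i => EuclideanSpace.single i 1 with he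
  set w : Fin (d + 1) → Euc d → ℂ := fun i y =>
    P y * fderiv ℝ G y (e i) - G y * fderiv ℝ P y (e i) with hw
  have hwC : ∀ i y, y ≠ 0 → ContDiffAt ℝ 1 (w i) y := fun i y hy =>
    (((hP y hy).of_le one_le_two).mul (contDiffAt_fderiv_apply (hG y hy) _)).sub
      (((hG y hy).of_le one_le_two).mul (contDiffAt_fderiv_apply (hP y hy) _))
  have hdw : ∀ y, y ≠ 0 → ∑ i, fderiv ℝ (w i) y (e i) =
      P y * Laplacian.laplacian G y - G y * Laplacian.laplacian P y := by
    intro y hy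
    rw [laplacian_eq_sum_fderiv _ _ (hG y hy), laplacian_eq_sum_fderiv _ _ (hP y hy),
      Finset.mul_sum, Finset.mul_sum, ← Finset.sum_sub_distrib]
    refine Finset.sum_congr rfl fun i _ => ?_
    have dP := ((hP y hy).differentiableAt two_ne_zero).hasFDerivAt
    have dG := ((hG y hy).differentiableAt two_ne_zero).hasFDerivAt
    have ddP := ((contDiffAt_fderiv_apply (hP y hy) (e i)).differentiableAt one_ne_zero).hasFDerivAt
    have ddG := ((contDiffAt_fderiv_apply (hG y hy) (e i)).differentiableAt one_ne_zero).hasFDerivAt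
    have := ((dP.mul ddG).sub (dG.mul ddP)).fderiv
    change fderiv ℝ (w i) y = _ at this
    rw [this]
    simp
    ring
  have hpart := fun i => integral_mul_fderiv_of_punctured contDiff_radialWeight
    hasCompactSupport_radialWeight zero_notMem_tsupport_radialWeight (hwC i) (e i)
  have hint1 : ∀ i, Integrable fun y => radialWeight d y * fderiv ℝ (w i) y (e i) := fun i =>
    (continuous_mul_of_zero_notMem_tsupport contDiff_radialWeight.continuous
      zero_notMem_tsupport_radialWeight fun y hy =>
      ((hwC i y hy).fderiv_right (m := 0) (by norm_num)).continuousAt.clm_apply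
        continuousAt_const).integrable_of_hasCompactSupport hasCompactSupport_radialWeight.mul_right
  have hint2 : ∀ i, Integrable fun y => fderiv ℝ (radialWeight d) y (e i) * w i y := fun i =>
    (continuous_mul_of_zero_notMem_tsupport
      ((contDiff_radialWeight.continuous_fderiv one_ne_zero).clm_apply continuous_const)
      (fun h => zero_notMem_tsupport_radialWeight (tsupport_fderiv_apply_subset ℝ (e i) h))
      fun y hy => (hwC i y hy).continuousAt).integrable_of_hasCompactSupport
        (hasCompactSupport_radialWeight.fderiv_apply (𝕜 := ℝ) (e i)).mul_right
  have hsum : ∫ y, ∑ i, radialWeight d y * fderiv ℝ (w i) y (e i) =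
      -∫ y, ∑ i, fderiv ℝ (radialWeight d) y (e i) * w i y := by
    rw [integral_finsetSum _ fun i _ => hint1 i, integral_finsetSum _ fun i _ => hint2 i,
      ← Finset.sum_neg_distrib]
    exact Finset.sum_congr rfl fun i _ => hpart i
  -- both sides of the integrated product rule factor in polar coordinates, with the same power of `r`
  have hL := integral_eq_radial_mul_sphere
    (fun y => ∑ i, radialWeight d y * fderiv ℝ (w i) y (e i))
    (fun r => ((r ^ (a + l) * radialBump (r ^ 2) : ℝ) : ℂ))
    (fun x => P x * Laplacian.laplacian G (x : Euc d) - G x * Laplacian.laplacian P (x : Euc d))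
    (by
      intro r hr x
      have hx := sph_ne_zero x
      have hn : ‖r • (x : Euc d)‖ = r := by rw [norm_smul, norm_sph, mul_one, Real.norm_of_nonneg hr.le]
      rw [← Finset.mul_sum, hdw _ (smul_ne_zero hr.ne' hx), radialWeight, hn,
        ha r hr x hx, hl r hr x hx]
      have h1 := laplacian_homogeneous hG ha hr hx
      have h2 := laplacian_homogeneous hP hl hr hx
      push_cast
      linear_combination ((radialBump (r ^ 2) : ℝ) : ℂ) * (r : ℂ) ^ l * P x * h1 -
        ((radialBump (r ^ 2) : ℝ) : ℂ) * (r : ℂ) ^ a * G x * h2)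
  have hR := integral_eq_radial_mul_sphere
    (fun y => ∑ i, fderiv ℝ (radialWeight d) y (e i) * w i y)
    (fun r => ((r ^ (a + l) *
      (2 * (radialBump (r ^ 2) + r ^ 2 * deriv radialBump (r ^ 2))) : ℝ) : ℂ))
    (fun x => ((a : ℂ) - l) * (P x * G x))
    (by
      intro r hr x
      have hx := sph_ne_zero x
      have hn : ‖r • (x : Euc d)‖ = r := by rw [norm_smul, norm_sph, mul_one, Real.norm_of_nonneg hr.le]
      set y := r • (x : Euc d) with hy
      have hy0 : y ≠ 0 := smul_ne_zero hr.ne' hx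
      have hexp : y = ∑ i, (y i) • e i := by
        have := (EuclideanSpace.basisFun (Fin (d + 1)) ℝ).sum_repr y
        simpa [he] using this.symm
      have hEG : ∑ i, ((y i : ℝ) : ℂ) * fderiv ℝ G y (e i) = a * G y := by
        rw [← fderiv_self_homogeneous ha hy0 ((hG y hy0).differentiableAt two_ne_zero)]
        conv_rhs => rw [show fderiv ℝ G y y = fderiv ℝ G y (∑ i, (y i) • e i) by rw [← hexp]]
        simp
      have hEP : ∑ i, ((y i : ℝ) : ℂ) * fderiv ℝ P y (e i) = l * P y := by
        rw [← fderiv_self_homogeneous hl hy0 ((hP y hy0).differentiableAt two_ne_zero)]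
        conv_rhs => rw [show fderiv ℝ P y y = fderiv ℝ P y (∑ i, (y i) • e i) by rw [← hexp]]
        simp
      have hin : ∀ i, inner ℝ y (e i) = y i := by
        intro i; simp [he, EuclideanSpace.inner_single_right]
      simp only [fderiv_radialWeight, hin, hn]
      have h3 : ∑ i, ((y i : ℝ) : ℂ) * w i y = ((a : ℂ) - l) * (P y * G y) := by
        have : ∑ i, ((y i : ℝ) : ℂ) * w i y =
            P y * (∑ i, ((y i : ℝ) : ℂ) * fderiv ℝ G y (e i)) -
            G y * (∑ i, ((y i : ℝ) : ℂ) * fderiv ℝ P y (e i)) := by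
          rw [Finset.mul_sum, Finset.mul_sum, ← Finset.sum_sub_distrib]
          refine Finset.sum_congr rfl fun i _ => ?_
          simp only [hw]; ring
        rw [this, hEG, hEP]; ring
      simp only [mul_assoc]
      rw [← Finset.mul_sum, h3, hy, ha r hr x hx, hl r hr x hx]
      push_cast
      ring)
  rw [hL, hR] at hsum
  -- the radial factors agree up to the constant produced by the integration by parts in `r`
  have hA : ∫ r in Set.Ioi (0 : ℝ), ((r ^ d : ℝ) : ℂ) *
      ((r ^ (a + l) * radialBump (r ^ 2) : ℝ) : ℂ) =
      ((∫ r in Set.Ioi (0 : ℝ), r ^ (d + (a + l)) * radialBump (r ^ 2) : ℝ) : ℂ) := by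
    rw [← integral_complex_ofReal]
    refine integral_congr_ae (Eventually.of_forall fun r => ?_)
    simp only
    push_cast
    ring
  have hD : ∫ r in Set.Ioi (0 : ℝ), ((r ^ d : ℝ) : ℂ) * ((r ^ (a + l) *
      (2 * (radialBump (r ^ 2) + r ^ 2 * deriv radialBump (r ^ 2))) : ℝ) : ℂ) =
      ((-(((d + (a + l) : ℕ) : ℝ) - 1) *
        ∫ r in Set.Ioi (0 : ℝ), r ^ (d + (a + l)) * radialBump (r ^ 2) : ℝ) : ℂ) := by
    rw [← integral_Ioi_deriv_weight (radialBump.contDiff (n := 1)) radialBump.hasCompactSupport,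
      ← integral_complex_ofReal]
    refine integral_congr_ae (Eventually.of_forall fun r => ?_)
    simp only
    push_cast
    ring
  rw [hA, hD, integral_const_mul] at hsum
  have hpos : ((∫ r in Set.Ioi (0 : ℝ), r ^ (d + (a + l)) * radialBump (r ^ 2) : ℝ) : ℂ) ≠ 0 :=
    Complex.ofReal_ne_zero.2 (integral_radialBump_pos _).ne'
  refine mul_left_cancel₀ hpos (hsum.trans ?_)
  push_cast
  ring

end Green

/-! ### Solid harmonics and the Laplace-Beltrami operator -/

section Solid

variable {d : ℕ}

/-- Twice differentiable harmonic functions on `ℝ^(d+1)`, homogeneous of degree `l`. -/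
structure IsSolidHarmonic (l : ℕ) (P : Euc d → ℂ) : Prop where
  contDiff : ContDiff ℝ 2 P
  laplacian_eq_zero : ∀ y, Laplacian.laplacian P y = 0
  homogeneous : HomogeneousOff l P

theorem exists_isSolidHarmonic {l : ℕ} {f : Sph d → ℂ} (hf : f ∈ sphHarm d l) :
    ∃ P : Euc d → ℂ, IsSolidHarmonic l P ∧ ∀ x : Sph d, f x = P x := by
  obtain ⟨p, ⟨hp, hp0⟩, rfl⟩ := hf
  refine ⟨polyFun p, ⟨contDiff_polyFun p, fun y => ?_, fun r _ y _ => polyFun_smul_real hp r y⟩,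
    fun x => rfl⟩
  rw [laplacian_polyFun, show polyLaplacian d p = 0 from hp0]
  simp [polyFun]

theorem IsSolidHarmonic.conj {l : ℕ} {P : Euc d → ℂ} (hP : IsSolidHarmonic l P) :
    IsSolidHarmonic l fun y => conj (P y) := by
  refine ⟨(Complex.conjCLE : ℂ →L[ℝ] ℂ).contDiff.comp hP.contDiff, fun y => ?_, fun r hr y hy => ?_⟩
  · have := (hP.contDiff.contDiffAt (x := y)).laplacian_CLM_comp_left
      (l := (Complex.conjCLE : ℂ →L[ℝ] ℂ))
    refine this.trans ?_
    simp [hP.laplacian_eq_zero]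
  · simp [hP.homogeneous r hr y hy]

theorem IsSolidHarmonic.comp_isometry {l : ℕ} {P : Euc d → ℂ} (hP : IsSolidHarmonic l P)
    (L : Euc d ≃ₗᵢ[ℝ] Euc d) : IsSolidHarmonic l (P ∘ L) := by
  refine ⟨hP.contDiff.comp L.contDiff, fun y => ?_, fun r hr y hy => ?_⟩
  · let b := EuclideanSpace.basisFun (Fin (d + 1)) ℝ
    have h := hP.laplacian_eq_zero (L y)
    rw [InnerProductSpace.laplacian_eq_iteratedFDeriv_orthonormalBasis P (b.map L)] at h
    rw [InnerProductSpace.laplacian_eq_iteratedFDeriv_orthonormalBasis _ b, ← h]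
    refine Finset.sum_congr rfl fun i _ => ?_
    have h2 := (L.toContinuousLinearEquiv : Euc d →L[ℝ] Euc d).iteratedFDeriv_comp_right
      hP.contDiff y (i := 2) le_rfl
    change iteratedFDeriv ℝ 2 (P ∘ L) y = _ at h2
    rw [h2, ContinuousMultilinearMap.compContinuousLinearMap_apply]
    congr 1
    ext j
    fin_cases j <;> rfl
  · simp only [Function.comp_apply, map_smul]
    exact hP.homogeneous r hr _ (by simpa using hy)

/-- Solid harmonics of different degrees are orthogonal on the sphere; the factor `l + l' + d - 1` in
Green's identity is nonzero because `d ≥ 1`. -/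
theorem IsSolidHarmonic.integral_mul_eq_zero (hd : 1 ≤ d) {l l' : ℕ} (hl : l ≠ l')
    {P Q : Euc d → ℂ} (hP : IsSolidHarmonic l P) (hQ : IsSolidHarmonic l' Q) :
    ∫ x : Sph d, P x * Q x ∂surf d = 0 := by
  have h := integral_sphere_green (fun y _ => hQ.contDiff.contDiffAt (x := y))
    (fun y _ => hP.contDiff.contDiffAt (x := y)) hQ.homogeneous hP.homogeneous
  simp only [hP.laplacian_eq_zero, hQ.laplacian_eq_zero, mul_zero, sub_zero, integral_zero] at h
  have h1 : ((l' : ℂ) - l) ≠ 0 := sub_ne_zero.2 (Nat.cast_injective.ne hl.symm)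
  have h2 : ((l' : ℂ) + l + d - 1) ≠ 0 := by
    have : ((l' : ℂ) + l + d - 1) = ((l' + l + d - 1 : ℕ) : ℂ) := by
      rw [Nat.cast_sub (by omega)]; push_cast; ring
    rw [this]
    exact Nat.cast_ne_zero.2 (by omega)
  simpa [h1, h2] using h.symm

theorem integral_sphHarm_mul_conj_eq_zero (hd : 1 ≤ d) {l l' : ℕ} (hl : l ≠ l') {f g : Sph d → ℂ}
    (hf : f ∈ sphHarm d l) (hg : g ∈ sphHarm d l') : ∫ x, f x * conj (g x) ∂surf d = 0 := by
  obtain ⟨P, hP, hfP⟩ := exists_isSolidHarmonic hf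
  obtain ⟨Q, hQ, hgQ⟩ := exists_isSolidHarmonic hg
  simp only [hfP, hgQ]
  exact hP.integral_mul_eq_zero hd hl hQ.conj

/-- Smoothness of order `s` of the extension that is constant along rays, away from the origin. -/
def RadialSmooth (s : ℕ) (f : Sph d → ℝ) : Prop :=
  ∀ y, y ≠ 0 → ContDiffAt ℝ s (radialExt f) y

theorem radialExt_sph (f : Sph d → ℝ) (x : Sph d) : radialExt f (x : Euc d) = f x := by
  rw [radialExt, dif_neg (sph_ne_zero x)]
  congr 1
  exact Subtype.ext (by simp)

theorem radialExt_smul (f : Sph d → ℝ) {r : ℝ} (hr : 0 < r) (y : Euc d) :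
    radialExt f (r • y) = radialExt f y := by
  by_cases hy : y = 0
  · simp [hy]
  rw [radialExt, dif_neg (smul_ne_zero hr.ne' hy), radialExt, dif_neg hy]
  congr 1
  refine Subtype.ext ?_
  simp only [norm_smul, Real.norm_of_nonneg hr.le, smul_smul]
  congr 1
  field_simp

/-- Smoothness in the manifold sense passes to the extension along rays, because `y ↦ y / ‖y‖` is a
smooth map from the punctured space to the sphere. -/
theorem SmoothSph.radialSmooth {s : ℕ} {f : Sph d → ℝ} (hf : SmoothSph s f) :
    RadialSmooth s f := by
  intro y hy
  let U : TopologicalSpace.Opens (Euc d) := ⟨{0}ᶜ, isOpen_compl_singleton⟩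
  have h1 : ContMDiff 𝓘(ℝ, Euc d) 𝓘(ℝ, Euc d) s
      (fun z : U => ‖(z : Euc d)‖⁻¹ • (z : Euc d)) := by
    intro z
    have hz : (z : Euc d) ≠ 0 := z.2
    have h2 : ContDiffAt ℝ s (fun z : Euc d => ‖z‖⁻¹ • z) (z : Euc d) :=
      ((contDiffAt_norm ℝ hz).inv (norm_ne_zero_iff.2 hz)).smul contDiffAt_id
    exact h2.contMDiffAt.comp z (contMDiff_subtype_val z)
  have h3 : ContMDiff 𝓘(ℝ, Euc d) (𝓡 d) s (fun z : U =>
      (⟨‖(z : Euc d)‖⁻¹ • (z : Euc d), by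
        have hz : (z : Euc d) ≠ 0 := z.2
        rw [mem_sphere_zero_iff_norm, norm_smul, norm_inv, norm_norm,
          inv_mul_cancel₀ (norm_ne_zero_iff.2 hz)]⟩ : Sph d)) :=
    h1.codRestrict_sphere _
  have h4 := hf.comp h3
  have h5 : ContMDiffAt 𝓘(ℝ, Euc d) 𝓘(ℝ, ℝ) s (fun z : U => radialExt f (z : Euc d)) ⟨y, hy⟩ := by
    refine (h4 ⟨y, hy⟩).congr_of_eventuallyEq (Eventually.of_forall fun z => ?_)
    have hz : (z : Euc d) ≠ 0 := z.2
    simp only [radialExt, dif_neg hz]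
    rfl
  exact (contMDiffAt_subtype_iff.1 h5).contDiffAt

theorem homogeneousOff_radialExt (f : Sph d → ℝ) :
    HomogeneousOff 0 fun y => ((radialExt f y : ℝ) : ℂ) := by
  intro r hr y _
  simp only [radialExt_smul f hr, pow_zero, one_mul]

theorem RadialSmooth.contDiffAt_ofReal {s : ℕ} {f : Sph d → ℝ} (hf : RadialSmooth s f) {y : Euc d}
    (hy : y ≠ 0) : ContDiffAt ℝ s (fun y => ((radialExt f y : ℝ) : ℂ)) y :=
  Complex.ofRealCLM.contDiff.contDiffAt.comp y (hf y hy)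

theorem laplacian_ofReal_radialExt {f : Sph d → ℝ} (hf : RadialSmooth 2 f) {y : Euc d}
    (hy : y ≠ 0) : Laplacian.laplacian (fun y => ((radialExt f y : ℝ) : ℂ)) y =
      ((Laplacian.laplacian (radialExt f) y : ℝ) : ℂ) :=
  (hf y hy).laplacian_CLM_comp_left (l := Complex.ofRealCLM)

theorem RadialSmooth.mono {s t : ℕ} (hst : t ≤ s) {f : Sph d → ℝ} (hf : RadialSmooth s f) :
    RadialSmooth t f := fun y hy => (hf y hy).of_le (by exact_mod_cast hst)

theorem RadialSmooth.continuous {s : ℕ} {f : Sph d → ℝ} (hf : RadialSmooth s f) :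
    Continuous f := by
  have h : f = fun x : Sph d => radialExt f (x : Euc d) := funext fun x => (radialExt_sph f x).symm
  rw [h, continuous_iff_continuousAt]
  intro x
  exact ContinuousAt.comp (f := Subtype.val) (hf x (sph_ne_zero x)).continuousAt
    continuous_subtype_val.continuousAt

theorem RadialSmooth.mul {s : ℕ} {f g : Sph d → ℝ} (hf : RadialSmooth s f)
    (hg : RadialSmooth s g) : RadialSmooth s fun x => f x * g x := by
  intro y hy
  have : radialExt (fun x => f x * g x) = fun y => radialExt f y * radialExt g y := by
    ext y
    by_cases hy : y = 0 <;> simp [radialExt, hy]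
  rw [this]
  exact (hf y hy).mul (hg y hy)

/-- The Euclidean Laplacian of an extension along rays is homogeneous of degree `-2`, so that the factor
`‖y‖²` turns it into the extension of the Laplace-Beltrami operator. -/
theorem radialExt_laplaceBeltrami {f : Sph d → ℝ} (hf : RadialSmooth 2 f) {y : Euc d}
    (hy : y ≠ 0) : radialExt (laplaceBeltrami f) y =
      ‖y‖ ^ 2 * Laplacian.laplacian (radialExt f) y := by
  have hny : 0 < ‖y‖ := norm_pos_iff.2 hy
  have h := laplacian_homogeneous (a := 0) (fun y hy => hf.contDiffAt_ofReal hy)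
    (homogeneousOff_radialExt f) (inv_pos.2 hny) hy
  rw [laplacian_ofReal_radialExt hf hy, laplacian_ofReal_radialExt hf
    (smul_ne_zero (inv_pos.2 hny).ne' hy), pow_zero, one_mul] at h
  rw [radialExt, dif_neg hy, laplaceBeltrami]
  have h' : (‖y‖⁻¹) ^ 2 * Laplacian.laplacian (radialExt f) (‖y‖⁻¹ • y) =
      Laplacian.laplacian (radialExt f) y := by exact_mod_cast h
  rw [← h']
  field_simp

theorem RadialSmooth.laplaceBeltrami {s : ℕ} {f : Sph d → ℝ} (hf : RadialSmooth (s + 2) f) :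
    RadialSmooth s (laplaceBeltrami f) := by
  intro y hy
  have h2 : RadialSmooth 2 f := hf.mono (by omega)
  have he : radialExt (HyperDeconv.laplaceBeltrami f) =ᶠ[𝓝 y] fun y => ‖y‖ ^ 2 *
      ∑ i, fderiv ℝ (fun z => fderiv ℝ (radialExt f) z (EuclideanSpace.single i 1)) y
      (EuclideanSpace.single i 1) := by
    filter_upwards [isOpen_ne.mem_nhds hy] with z hz
    rw [radialExt_laplaceBeltrami h2 hz, laplacian_eq_sum_fderiv _ _ (h2 z hz)]
  refine ContDiffAt.congr_of_eventuallyEq ?_ he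
  refine (contDiff_norm_sq ℝ).contDiffAt.mul (ContDiffAt.sum fun i _ => ?_)
  have h3 : ContDiffAt ℝ (s + 1 : ℕ) (fun z => fderiv ℝ (radialExt f) z
      (EuclideanSpace.single i 1)) y :=
    ((hf y hy).fderiv_right (m := (s + 1 : ℕ)) (by norm_cast)).clm_apply contDiffAt_const
  exact (h3.fderiv_right (m := s) (by norm_cast)).clm_apply contDiffAt_const

theorem RadialSmooth.iterate_laplaceBeltrami {k s : ℕ} {f : Sph d → ℝ}
    (hf : RadialSmooth (2 * k + s) f) : RadialSmooth s (HyperDeconv.laplaceBeltrami^[k] f) := by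
  induction k generalizing f with
  | zero => simpa using hf
  | succ k ih =>
    rw [Function.iterate_succ_apply]
    exact ih (RadialSmooth.laplaceBeltrami (hf.mono (by omega)))

/-- The Laplace-Beltrami operator is symmetric, and spherical harmonics are its eigenfunctions:
this is `integral_sphere_green` for an extension that is constant along rays and a solid
harmonic. -/
theorem integral_laplaceBeltrami_mul_conj {f : Sph d → ℝ} (hf : RadialSmooth 2 f) {l : ℕ}
    {b : Sph d → ℂ} (hb : b ∈ sphHarm d l) :
    ∫ x, (laplaceBeltrami f x : ℂ) * conj (b x) ∂surf d =
      -((l : ℂ) * (l + d - 1)) * ∫ x, (f x : ℂ) * conj (b x) ∂surf d := by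
  obtain ⟨P, hP, hbP⟩ := exists_isSolidHarmonic hb
  have h := integral_sphere_green (fun y hy => hf.contDiffAt_ofReal hy)
    (fun y _ => hP.conj.contDiff.contDiffAt (x := y)) (homogeneousOff_radialExt f)
    hP.conj.homogeneous
  simp only [hP.conj.laplacian_eq_zero, mul_zero, sub_zero, radialExt_sph,
    laplacian_ofReal_radialExt hf (sph_ne_zero _)] at h
  simp only [hbP, mul_comm _ (conj _), laplaceBeltrami]
  rw [h]
  push_cast
  ring

theorem integral_iterate_laplaceBeltrami_mul_conj {k : ℕ} {f : Sph d → ℝ}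
    (hf : RadialSmooth (2 * k) f) {l : ℕ} {b : Sph d → ℂ} (hb : b ∈ sphHarm d l) :
    ∫ x, (laplaceBeltrami^[k] f x : ℂ) * conj (b x) ∂surf d =
      (-((l : ℂ) * (l + d - 1))) ^ k * ∫ x, (f x : ℂ) * conj (b x) ∂surf d := by
  induction k with
  | zero => simp
  | succ k ih =>
    rw [Function.iterate_succ_apply', integral_laplaceBeltrami_mul_conj
      (RadialSmooth.iterate_laplaceBeltrami (by simpa [mul_add] using hf)) hb,
      ih (hf.mono (by omega)), pow_succ']
    ring

end Solid

/-! ### Orthonormal bases of spherical harmonics -/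

section Basis

variable {d : ℕ} {B : ∀ l, Fin (harmDim d l) → Sph d → ℂ}

theorem IsHarmonicBasis.continuous (hB : IsHarmonicBasis B) (l : ℕ) (q : Fin (harmDim d l)) :
    Continuous (B l q) := continuous_of_mem_sphHarm (hB.mem l q)

/-- The elements of a harmonic basis, of all orders, as elements of `L²(S^d)`. -/
noncomputable def IsHarmonicBasis.toLp (hB : IsHarmonicBasis B) (a : Σ l, Fin (harmDim d l)) :
    Lp ℂ 2 (surf d) :=
  ContinuousMap.toLp (E := ℂ) 2 (surf d) ℂ ⟨B a.1 a.2, hB.continuous a.1 a.2⟩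

theorem IsHarmonicBasis.orthonormal_toLp (hB : IsHarmonicBasis B) (hd : 1 ≤ d) :
    Orthonormal ℂ hB.toLp := by
  classical
  rw [orthonormal_iff_ite]
  rintro ⟨l, q⟩ ⟨l', r⟩
  rw [IsHarmonicBasis.toLp, IsHarmonicBasis.toLp, ContinuousMap.inner_toLp]
  change ∫ x, B l' r x * conj (B l q x) ∂surf d = _
  by_cases hl : l = l'
  · subst hl
    rw [hB.orthonormal]
    by_cases hq : q = r
    · simp [hq]
    · rw [if_neg (fun h => hq h.symm), if_neg (fun h => hq (by simpa using h))]
  · rw [integral_sphHarm_mul_conj_eq_zero hd (Ne.symm hl) (hB.mem l' r) (hB.mem l q),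
      if_neg (fun h => hl (congrArg Sigma.fst h))]

/-- Bessel's inequality, degree by degree. -/
theorem IsHarmonicBasis.summable_sq_fourierCoeff (hB : IsHarmonicBasis B) (hd : 1 ≤ d)
    {g : Sph d → ℝ} (hg : Continuous g) :
    Summable fun l => ∑ q, ‖fourierCoeff B g l q‖ ^ 2 := by
  let G : C(Sph d, ℂ) := ⟨fun x => (g x : ℂ), by fun_prop⟩
  have h := (hB.orthonormal_toLp hd).inner_products_summable
    (ContinuousMap.toLp (E := ℂ) 2 (surf d) ℂ G)
  have h2 := h.sigma
  refine h2.congr fun l => ?_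
  rw [tsum_fintype]
  refine Finset.sum_congr rfl fun q _ => ?_
  rw [IsHarmonicBasis.toLp, ContinuousMap.inner_toLp]
  rfl

theorem IsHarmonicBasis.integral_mul_conj_eq_zero_of_basis (hB : IsHarmonicBasis B)
    {f : Sph d → ℂ} (hf : Continuous f) {l : ℕ}
    (h : ∀ q, ∫ x, f x * conj (B l q x) ∂surf d = 0) {g : Sph d → ℂ} (hg : g ∈ sphHarm d l) :
    ∫ x, f x * conj (g x) ∂surf d = 0 := by
  rw [← hB.span l] at hg
  obtain ⟨c, rfl⟩ := (Submodule.mem_span_range_iff_exists_fun ℂ).1 hg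
  simp only [Finset.sum_apply, Pi.smul_apply, smul_eq_mul, map_sum, map_mul, Finset.mul_sum]
  rw [integral_finsetSum]
  · refine Finset.sum_eq_zero fun q _ => ?_
    have : ∀ x, f x * (conj (c q) * conj (B l q x)) = conj (c q) * (f x * conj (B l q x)) :=
      fun x => by ring
    simp only [this, integral_const_mul, h q, mul_zero]
  · intro q _
    have := hB.continuous l q
    exact integrable_surf_of_continuous (hf.mul (continuous_const.mul
      (Complex.continuous_conj.comp this)))

/-- A continuous function is determined by its Fourier coefficients. -/
theorem IsHarmonicBasis.eq_zero_of_forall_integral (hB : IsHarmonicBasis B)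
    {f : Sph d → ℂ} (hf : Continuous f)
    (h : ∀ l q, ∫ x, f x * conj (B l q x) ∂surf d = 0) : f = 0 :=
  eq_zero_of_forall_integral_sphHarm hf fun l _ hg =>
    hB.integral_mul_conj_eq_zero_of_basis hf (h l) hg

/-- The integral `∫ B^l_q(L x) conj(B^l_r(x)) dν(x)` for a linear isometry `L`. -/
noncomputable def isoCoeff (B : ∀ l, Fin (harmDim d l) → Sph d → ℂ) (L : Euc d ≃ₗᵢ[ℝ] Euc d)
    (l : ℕ) (q r : Fin (harmDim d l)) : ℂ :=
  ∫ x, B l q (sphMap L x) * conj (B l r x) ∂surf d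

/-- Spherical harmonics of order `l` composed with an isometry are again spherical harmonics of
order `l`: the difference of the two sides has no Fourier coefficients. -/
theorem IsHarmonicBasis.comp_sphMap (hB : IsHarmonicBasis B) (hd : 1 ≤ d)
    (L : Euc d ≃ₗᵢ[ℝ] Euc d) (l : ℕ) (q : Fin (harmDim d l)) (x : Sph d) :
    B l q (sphMap L x) = ∑ r, isoCoeff B L l q r * B l r x := by
  have hc : Continuous fun x => ∑ r, isoCoeff B L l q r * B l r x :=
    continuous_finsetSum _ fun r _ => continuous_const.mul (hB.continuous l r)
  have hc' : Continuous fun x => B l q (sphMap L x) :=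
    (hB.continuous l q).comp (continuous_sphMap L)
  have h0 : (fun x => B l q (sphMap L x) - ∑ r, isoCoeff B L l q r * B l r x) = 0 := by
    refine hB.eq_zero_of_forall_integral (hc'.sub hc) fun l' s => ?_
    have hs : Continuous fun x => conj (B l' s x) :=
      Complex.continuous_conj.comp (hB.continuous l' s)
    simp only [sub_mul, Finset.sum_mul, mul_assoc]
    rw [integral_sub (integrable_surf_of_continuous (hc'.fun_mul hs))
      (integrable_surf_of_continuous (continuous_finsetSum _ fun r _ =>
        continuous_const.fun_mul ((hB.continuous l r).fun_mul hs))),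
      integral_finsetSum _ fun r _ => (integrable_surf_of_continuous
        (continuous_const.fun_mul ((hB.continuous l r).fun_mul hs)))]
    simp only [integral_const_mul]
    by_cases hl : l = l'
    · subst hl
      simp only [hB.orthonormal, mul_ite, mul_one, mul_zero, Finset.sum_ite_eq',
        Finset.mem_univ, if_true]
      exact sub_self _
    · simp only [integral_sphHarm_mul_conj_eq_zero hd hl (hB.mem l _) (hB.mem l' s), mul_zero,
        Finset.sum_const_zero, sub_zero]
      obtain ⟨P, hP, hPB⟩ := exists_isSolidHarmonic (hB.mem l q)
      obtain ⟨Q, hQ, hQB⟩ := exists_isSolidHarmonic (hB.mem l' s)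
      have := (hP.comp_isometry L).integral_mul_eq_zero hd hl hQ.conj
      simp only [hPB, hQB]
      exact this
  exact sub_eq_zero.1 (congrFun h0 x)

/-- The matrix `isoCoeff B L l` is unitary, since `L` preserves the surface measure. -/
theorem IsHarmonicBasis.sum_isoCoeff_mul_conj (hB : IsHarmonicBasis B) (hd : 1 ≤ d)
    (L : Euc d ≃ₗᵢ[ℝ] Euc d) (l : ℕ) (q r : Fin (harmDim d l)) :
    ∑ s, isoCoeff B L l q s * conj (isoCoeff B L l r s) = if q = r then 1 else 0 := by
  have h1 : ∫ x, B l q (sphMap L x) * conj (B l r (sphMap L x)) ∂surf d =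
      if q = r then 1 else 0 := by
    rw [← hB.orthonormal l q r]
    have hc : Continuous fun x => B l q x * conj (B l r x) :=
      (hB.continuous l q).mul (Complex.continuous_conj.comp (hB.continuous l r))
    conv_rhs => rw [← (measurePreserving_sphMap L).map_eq]
    rw [integral_map (continuous_sphMap L).aemeasurable hc.aestronglyMeasurable]
  rw [← h1]
  have h2 : ∀ x, B l q (sphMap L x) * conj (B l r (sphMap L x)) =
      ∑ s, conj (isoCoeff B L l r s) * (B l q (sphMap L x) * conj (B l s x)) := by
    intro x
    conv_lhs => rw [hB.comp_sphMap hd L l r x]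
    simp only [map_sum, map_mul, Finset.mul_sum]
    exact Finset.sum_congr rfl fun s _ => by ring
  simp only [h2]
  rw [integral_finsetSum]
  · refine Finset.sum_congr rfl fun s _ => ?_
    rw [integral_const_mul, mul_comm]
    rfl
  · intro s _
    exact integrable_surf_of_continuous (continuous_const.mul
      (((hB.continuous l q).comp (continuous_sphMap L)).mul
        (Complex.continuous_conj.comp (hB.continuous l s))))

/-- A unitary change of basis does not affect the sum of squares. -/
theorem IsHarmonicBasis.sum_sq_comp_sphMap (hB : IsHarmonicBasis B) (hd : 1 ≤ d)
    (L : Euc d ≃ₗᵢ[ℝ] Euc d) (l : ℕ) (x : Sph d) :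
    ∑ q, ‖B l q (sphMap L x)‖ ^ 2 = ∑ q, ‖B l q x‖ ^ 2 := by
  let D : Matrix (Fin (harmDim d l)) (Fin (harmDim d l)) ℂ := Matrix.of (isoCoeff B L l)
  have h1 : D * D.conjTranspose = 1 := by
    ext q r
    simp only [Matrix.mul_apply, Matrix.conjTranspose_apply, Matrix.one_apply]
    exact hB.sum_isoCoeff_mul_conj hd L l q r
  have h2 : D.conjTranspose * D = 1 := mul_eq_one_comm.1 h1
  have h3 : (fun q => B l q (sphMap L x)) = D.mulVec fun r => B l r x := by
    ext q
    exact hB.comp_sphMap hd L l q x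
  have key : star (D.mulVec fun r => B l r x) ⬝ᵥ (D.mulVec fun r => B l r x) =
      star (fun r => B l r x) ⬝ᵥ fun r => B l r x := by
    rw [Matrix.star_mulVec, Matrix.dotProduct_mulVec, Matrix.vecMul_vecMul, h2, Matrix.vecMul_one]
  rw [← h3] at key
  simp only [dotProduct, Pi.star_apply, RCLike.star_def, RCLike.conj_mul] at key
  exact_mod_cast key

/-- The isometry group acts transitively on the sphere. -/
theorem exists_sphMap_eq (x y : Sph d) : ∃ L : Euc d ≃ₗᵢ[ℝ] Euc d, sphMap L x = y := by
  refine ⟨(Submodule.span ℝ {(x : Euc d) - y})ᗮ.reflection, Subtype.ext ?_⟩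
  exact Submodule.reflection_sub ((norm_sph x).trans (norm_sph y).symm)

/-- The total mass of the surface measure. -/
noncomputable def area (d : ℕ) : ℝ := (surf d).real Set.univ

theorem area_pos (d : ℕ) : 0 < area d := by
  have : Nonempty (Sph d) := ⟨⟨EuclideanSpace.single 0 1, by simp⟩⟩
  exact measureReal_univ_pos

/-- The function `∑_q |B^l_q|²` is constant on the sphere: it is invariant under isometries, which act
transitively, and the constant is found by integration. -/
theorem IsHarmonicBasis.sum_sq_eq (hB : IsHarmonicBasis B) (hd : 1 ≤ d) (l : ℕ) (x : Sph d) :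
    ∑ q, ‖B l q x‖ ^ 2 = harmDim d l / area d := by
  have hconst : ∀ y, ∑ q, ‖B l q y‖ ^ 2 = ∑ q, ‖B l q x‖ ^ 2 := by
    intro y
    obtain ⟨L, rfl⟩ := exists_sphMap_eq x y
    exact hB.sum_sq_comp_sphMap hd L l x
  have h1 : ∫ y, ∑ q, ‖B l q y‖ ^ 2 ∂surf d = harmDim d l := by
    rw [integral_finsetSum _ fun q _ => integrable_surf_of_continuous
      ((hB.continuous l q).norm.fun_pow 2)]
    have : ∀ q, ∫ y, ‖B l q y‖ ^ 2 ∂surf d = 1 := by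
      intro q
      have h := hB.orthonormal l q q
      simp only [RCLike.mul_conj, if_true] at h
      rw [← Complex.ofReal_inj, ← integral_complex_ofReal]
      simpa using h
    simp [this]
  simp only [hconst, integral_const, smul_eq_mul] at h1
  rw [← h1]
  exact (mul_div_cancel_left₀ _ (area_pos d).ne').symm

theorem harmDim_le (hd : 1 ≤ d) {l : ℕ} (hl : 1 ≤ l) : harmDim d l ≤ 2 * (l + d) ^ (d - 1) := by
  rw [harmDim, if_neg (by omega)]
  refine Nat.div_le_of_le_mul ?_
  have h1 : (l + d - 1)! = (l + d - 1) * (l + d - 2)! := by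
    rw [show l + d - 1 = (l + d - 2) + 1 by omega, Nat.factorial_succ]
  have h2 : (l + d - 1)! = l ! * (l + 1).ascFactorial (d - 1) := by
    rw [Nat.factorial_mul_ascFactorial, show l + (d - 1) = l + d - 1 by omega]
  have h3 : (l + 1).ascFactorial (d - 1) ≤ (l + d) ^ (d - 1) := by
    refine (Nat.ascFactorial_le_pow_add l (d - 1)).trans ?_
    exact Nat.pow_le_pow_left (by omega) _
  calc (2 * l + d - 1) * (l + d - 2)! ≤ (2 * (l + d - 1)) * (l + d - 2)! :=
        Nat.mul_le_mul_right _ (by omega)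
    _ = 2 * (l ! * (l + 1).ascFactorial (d - 1)) := by rw [mul_assoc, ← h1, h2]
    _ ≤ 2 * (l ! * (l + d) ^ (d - 1)) := by gcongr
    _ ≤ 2 * (l ! * (l + d) ^ (d - 1)) * (d - 1)! := Nat.le_mul_of_pos_right _ (Nat.factorial_pos _)
    _ = l ! * (d - 1)! * (2 * (l + d) ^ (d - 1)) := by ring

theorem exists_harmDim_le (hd : 1 ≤ d) : ∃ C : ℝ, 0 < C ∧ ∀ l : ℕ, 1 ≤ l →
    (harmDim d l : ℝ) / area d ≤ C * (l : ℝ) ^ (d - 1) := by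
  refine ⟨2 * (1 + d : ℝ) ^ (d - 1) / area d, by have := area_pos d; positivity, fun l hl => ?_⟩
  have hl' : (1 : ℝ) ≤ l := by exact_mod_cast hl
  have h1 : (harmDim d l : ℝ) ≤ 2 * ((l : ℝ) + d) ^ (d - 1) := by exact_mod_cast harmDim_le hd hl
  have h2 : ((l : ℝ) + d) ^ (d - 1) ≤ ((1 + d : ℝ) * l) ^ (d - 1) := by
    refine pow_le_pow_left₀ (by positivity) ?_ _
    nlinarith [(Nat.cast_nonneg d : (0 : ℝ) ≤ d)]
  rw [div_mul_eq_mul_div]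
  refine div_le_div_of_nonneg_right ?_ (area_pos d).le
  rw [mul_pow] at h2
  nlinarith

/-! ### Pointwise convergence of Fourier-Laplace series -/

/-- The component of order `l` of the Fourier-Laplace series of `g`. -/
noncomputable def harmProj (B : ∀ l, Fin (harmDim d l) → Sph d → ℂ) (g : Sph d → ℝ) (l : ℕ)
    (x : Sph d) : ℂ := ∑ q, fourierCoeff B g l q * B l q x

theorem sq_norm_sum_mul_le {ι : Type*} (s : Finset ι) (f g : ι → ℂ) :
    ‖∑ i ∈ s, f i * g i‖ ^ 2 ≤ (∑ i ∈ s, ‖f i‖ ^ 2) * ∑ i ∈ s, ‖g i‖ ^ 2 := by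
  have h1 : ‖∑ i ∈ s, f i * g i‖ ≤ ∑ i ∈ s, ‖f i‖ * ‖g i‖ :=
    (norm_sum_le _ _).trans_eq (by simp)
  exact (pow_le_pow_left₀ (norm_nonneg _) h1 2).trans (Finset.sum_mul_sq_le_sq_mul_sq _ _ _)

theorem continuous_harmProj (hB : IsHarmonicBasis B) (g : Sph d → ℝ) (l : ℕ) :
    Continuous (harmProj B g l) :=
  continuous_finsetSum _ fun q _ => continuous_const.mul (hB.continuous l q)

theorem fourierCoeff_iterate (hB : IsHarmonicBasis B) {k : ℕ} {g : Sph d → ℝ}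
    (hg : RadialSmooth (2 * k) g) (l : ℕ) (q : Fin (harmDim d l)) :
    fourierCoeff B (laplaceBeltrami^[k] g) l q =
      (-((l : ℂ) * (l + d - 1))) ^ k * fourierCoeff B g l q :=
  integral_iterate_laplaceBeltrami_mul_conj hg (hB.mem l q)

theorem harmProj_iterate (hB : IsHarmonicBasis B) {k : ℕ} {g : Sph d → ℝ}
    (hg : RadialSmooth (2 * k) g) (l : ℕ) (x : Sph d) :
    harmProj B (laplaceBeltrami^[k] g) l x =
      (-((l : ℂ) * (l + d - 1))) ^ k * harmProj B g l x := by
  simp only [harmProj, fourierCoeff_iterate hB hg, Finset.mul_sum, mul_assoc]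

/-- The eigenvalue `l(l+d-1)` dominates `l²`. -/
theorem pow_mul_norm_harmProj_le (hd : 1 ≤ d) (hB : IsHarmonicBasis B) {k : ℕ} {g : Sph d → ℝ}
    (hg : RadialSmooth (2 * k) g) (l : ℕ) (x : Sph d) :
    (l : ℝ) ^ (2 * k) * ‖harmProj B g l x‖ ≤ ‖harmProj B (laplaceBeltrami^[k] g) l x‖ := by
  rw [harmProj_iterate hB hg, norm_mul, norm_pow, norm_neg, pow_mul]
  refine mul_le_mul_of_nonneg_right (pow_le_pow_left₀ (by positivity) ?_ k) (norm_nonneg _)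
  have hd' : (1 : ℝ) ≤ d := by exact_mod_cast hd
  have h1 : ((l : ℂ) * (l + d - 1)) = ((l * (l + d - 1) : ℝ) : ℂ) := by push_cast; ring
  have h2 : (0 : ℝ) ≤ l := Nat.cast_nonneg l
  rw [h1, Complex.norm_real, Real.norm_of_nonneg (by nlinarith)]
  nlinarith

/-- The Fourier-Laplace series of a `C^(2k)` function is dominated, uniformly on the sphere, by a
convergent series as soon as `4k > d`. By the Cauchy-Schwarz inequality the component of order `l` is
at most the square root of `aₗ · C l^(d-1-4k)`, where `aₗ` is the Bessel term of `Δ^k g`. -/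
theorem exists_summable_bound_harmProj (hd : 1 ≤ d) (hB : IsHarmonicBasis B) {k : ℕ}
    (hk : (d : ℝ) / 4 < k) {g : Sph d → ℝ} (hg : RadialSmooth (2 * k) g) :
    ∃ u : ℕ → ℝ, Summable u ∧ ∀ l x, ‖harmProj B g l x‖ ≤ u l := by
  obtain ⟨C, hC, hN⟩ := exists_harmDim_le hd
  have hG : Continuous (laplaceBeltrami^[k] g) :=
    (RadialSmooth.iterate_laplaceBeltrami (s := 0) (by simpa using hg)).continuous
  have hs1 := hB.summable_sq_fourierCoeff hd hG
  set a : ℕ → ℝ := fun l => ∑ q, ‖fourierCoeff B (laplaceBeltrami^[k] g) l q‖ ^ 2 with ha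
  have hs2 : Summable fun l : ℕ => ((l : ℝ) ^ (4 * k - d + 1 : ℝ))⁻¹ := by
    refine (Real.summable_nat_rpow_inv).2 ?_
    linarith
  have hs : Summable fun l : ℕ => a l + C * ((l : ℝ) ^ (4 * k - d + 1 : ℝ))⁻¹ :=
    hs1.add (hs2.mul_left C)
  have hc0 : ∃ M, ∀ x, ‖harmProj B g 0 x‖ ≤ M := by
    obtain ⟨M, hM⟩ := (isCompact_univ.image (continuous_harmProj hB g 0).norm).bddAbove
    exact ⟨M, fun x => hM ⟨x, trivial, rfl⟩⟩
  -- the component of order `0` is bounded separately, as the eigenvalue vanishes there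
  obtain ⟨M, hM⟩ := hc0
  refine ⟨fun l => if l = 0 then M else a l + C * ((l : ℝ) ^ (4 * k - d + 1 : ℝ))⁻¹, ?_, ?_⟩
  · rw [← summable_nat_add_iff 1]
    simpa using (summable_nat_add_iff 1).2 hs
  · intro l x
    by_cases hl : l = 0
    · subst hl; simpa using hM x
    simp only [hl, if_false]
    have hl1 : 1 ≤ l := Nat.one_le_iff_ne_zero.2 hl
    have hl0 : (0 : ℝ) < l := by exact_mod_cast hl1
    have h1 := pow_mul_norm_harmProj_le hd hB hg l x
    have h2 : ‖harmProj B (laplaceBeltrami^[k] g) l x‖ ^ 2 ≤ a l * (C * (l : ℝ) ^ (d - 1)) := by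
      refine (sq_norm_sum_mul_le _ _ _).trans ?_
      rw [hB.sum_sq_eq hd]
      exact mul_le_mul_of_nonneg_left (hN l hl1) (by positivity)
    have ha0 : 0 ≤ a l := by positivity
    set t := (l : ℝ) ^ (2 * k) with ht
    have ht0 : 0 < t := by positivity
    have h3 : ((l : ℝ) ^ (4 * k - d + 1 : ℝ))⁻¹ = (l : ℝ) ^ (d - 1) / t ^ 2 := by
      rw [← Real.rpow_natCast, ht, ← pow_mul, ← Real.rpow_natCast, ← Real.rpow_sub hl0,
        ← Real.rpow_neg hl0.le, Nat.cast_sub hd]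
      congr 1; push_cast; ring
    rw [h3]
    set b := (l : ℝ) ^ (d - 1) with hb
    have hb0 : 0 < b := by positivity
    set v := ‖harmProj B g l x‖
    have hv : 0 ≤ v := norm_nonneg _
    have h4 : (t * v) ^ 2 ≤ a l * (C * b) := (pow_le_pow_left₀ (by positivity) h1 2).trans h2
    have h5 : v ^ 2 ≤ a l * (C * (b / t ^ 2)) := by
      rw [show a l * (C * (b / t ^ 2)) = a l * (C * b) / t ^ 2 by ring, le_div_iff₀ (by positivity)]
      nlinarith
    have h6 : 0 ≤ C * (b / t ^ 2) := by positivity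
    -- the inequality between the arithmetic and the geometric mean
    refine le_of_sq_le_sq ?_ (by positivity)
    nlinarith [mul_nonneg ha0 h6]

/-- The Fourier-Laplace series converges to the function: the sum is continuous by uniform convergence and
has the same Fourier coefficients. -/
theorem hasSum_harmProj (hd : 1 ≤ d) (hB : IsHarmonicBasis B) {k : ℕ}
    (hk : (d : ℝ) / 4 < k) {g : Sph d → ℝ} (hg : RadialSmooth (2 * k) g) (x : Sph d) :
    HasSum (fun l => harmProj B g l x) (g x : ℂ) := by
  obtain ⟨u, hu, hle⟩ := exists_summable_bound_harmProj hd hB hk hg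
  have hsum : ∀ x, Summable fun l => harmProj B g l x := fun x =>
    Summable.of_norm_bounded hu fun l => hle l x
  have hcont : Continuous fun x => ∑' l, harmProj B g l x :=
    continuous_tsum (continuous_harmProj hB g) hu hle
  have hgc : Continuous fun x => (g x : ℂ) := Complex.continuous_ofReal.comp hg.continuous
  have h0 : (fun x => (g x : ℂ) - ∑' l, harmProj B g l x) = 0 := by
    refine hB.eq_zero_of_forall_integral (hgc.sub hcont) fun l' s => ?_
    have hs : Continuous fun x => conj (B l' s x) :=
      Complex.continuous_conj.comp (hB.continuous l' s)
    obtain ⟨M, hM⟩ : ∃ M, ∀ x, ‖conj (B l' s x)‖ ≤ M := by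
      obtain ⟨M, hM⟩ := (isCompact_univ.image hs.norm).bddAbove
      exact ⟨M, fun x => hM ⟨x, trivial, rfl⟩⟩
    simp only [sub_mul]
    rw [integral_sub (integrable_surf_of_continuous (hgc.fun_mul hs))
      (integrable_surf_of_continuous (hcont.fun_mul hs))]
    have h1 : ∀ l, ∫ x, harmProj B g l x * conj (B l' s x) ∂surf d =
        if l = l' then fourierCoeff B g l' s else 0 := by
      intro l
      simp only [harmProj, Finset.sum_mul, mul_assoc]
      rw [integral_finsetSum _ fun r _ => integrable_surf_of_continuous
        (continuous_const.fun_mul ((hB.continuous l r).fun_mul hs))]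
      simp only [integral_const_mul]
      by_cases hl : l = l'
      · subst hl
        simp [hB.orthonormal]
      · simp [hl, integral_sphHarm_mul_conj_eq_zero hd hl (hB.mem l _) (hB.mem l' s)]
    have h2 : ∫ x, (∑' l, harmProj B g l x) * conj (B l' s x) ∂surf d =
        fourierCoeff B g l' s := by
      have h3 := hasSum_integral_of_summable_integral_norm (μ := surf d)
        (F := fun l x => harmProj B g l x * conj (B l' s x))
        (fun l => integrable_surf_of_continuous ((continuous_harmProj hB g l).mul hs)) (by
          refine Summable.of_nonneg_of_le (fun l => integral_nonneg fun x => norm_nonneg _)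
            (fun l => ?_) ((hu.mul_right M).mul_right (area d))
          have : ∀ x, ‖harmProj B g l x * conj (B l' s x)‖ ≤ u l * M := fun x => by
            rw [norm_mul]
            exact mul_le_mul (hle l x) (hM x) (norm_nonneg _) ((norm_nonneg _).trans (hle l x))
          refine (integral_mono (integrable_surf_of_continuous
            ((continuous_harmProj hB g l).mul hs)).norm (integrable_const _) this).trans_eq ?_
          simp [area, mul_comm])
      simp only [tsum_mul_right, h1] at h3
      exact (h3.unique (hasSum_ite_eq l' _))
    rw [h2]
    exact sub_self _
  have h := sub_eq_zero.1 (congrFun h0 x)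
  rw [h]
  exact (hsum x).hasSum

/-- The tail of a series whose terms, multiplied by `l^m`, are summable in norm is `o(L^(-m))`. -/
theorem tendsto_pow_mul_norm_partialSum_sub {a : ℕ → ℂ} {A : ℂ} (ha : HasSum a A) {b : ℕ → ℝ}
    (hb : Summable b) {m : ℕ} (hab : ∀ l : ℕ, (l : ℝ) ^ m * ‖a l‖ ≤ b l) :
    Tendsto (fun L : ℕ => ((L : ℝ) + 1) ^ m * ‖∑ l ∈ Finset.range (L + 1), a l - A‖)
      atTop (𝓝 0) := by
  have htail : Tendsto (fun L : ℕ => ∑' l, b (l + (L + 1))) atTop (𝓝 0) :=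
    (tendsto_sum_nat_add b).comp (tendsto_add_atTop_nat 1)
  refine squeeze_zero (fun L => by positivity) (fun L => ?_) htail
  have hs' : Summable fun l => b (l + (L + 1)) := (summable_nat_add_iff (L + 1)).2 hb
  have h1 : ∑ l ∈ Finset.range (L + 1), a l - A = -∑' l, a (l + (L + 1)) := by
    rw [← ha.tsum_eq, ← ha.summable.sum_add_tsum_nat_add (L + 1)]
    ring
  have hle : ∀ l, ((L : ℝ) + 1) ^ m * ‖a (l + (L + 1))‖ ≤ b (l + (L + 1)) := by
    intro l
    refine le_trans ?_ (hab (l + (L + 1)))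
    refine mul_le_mul_of_nonneg_right (pow_le_pow_left₀ (by positivity) ?_ _) (norm_nonneg _)
    rw [Nat.cast_add, Nat.cast_add, Nat.cast_one]
    linarith [(Nat.cast_nonneg l : (0 : ℝ) ≤ l)]
  have hs2 : Summable fun l => ‖a (l + (L + 1))‖ := by
    refine Summable.of_nonneg_of_le (fun l => norm_nonneg _) (fun l => ?_) hs'
    refine le_trans ?_ (hle l)
    refine le_mul_of_one_le_left (norm_nonneg _) (one_le_pow₀ ?_)
    linarith [(Nat.cast_nonneg L : (0 : ℝ) ≤ L)]
  rw [h1, norm_neg]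
  calc ((L : ℝ) + 1) ^ m * ‖∑' l, a (l + (L + 1))‖
      ≤ ((L : ℝ) + 1) ^ m * ∑' l, ‖a (l + (L + 1))‖ := by
        gcongr
        exact norm_tsum_le_tsum_norm hs2
    _ = ∑' l, ((L : ℝ) + 1) ^ m * ‖a (l + (L + 1))‖ := tsum_mul_left.symm
    _ ≤ _ := (hs2.mul_left _).tsum_le_tsum hle hs'

/-- The truncation error of the Fourier-Laplace series of `g` at degree `L` is `o(L^(-2k))` at each
point where the series of the `k`-th power of the Laplace-Beltrami operator applied to `g` converges
absolutely. -/
theorem tendsto_pow_mul_truncation_error (hd : 1 ≤ d) (hB : IsHarmonicBasis B) {k : ℕ}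
    (hk : (d : ℝ) / 4 < k) {g : Sph d → ℝ} (hg : RadialSmooth (2 * k) g)
    (habs : FourierLaplaceAbsConv B (laplaceBeltrami^[k] g)) (x : Sph d) :
    Tendsto (fun L : ℕ => ((L : ℝ) + 1) ^ (2 * k) *
      ‖∑ l ∈ Finset.range (L + 1), harmProj B g l x - g x‖) atTop (𝓝 0) :=
  tendsto_pow_mul_norm_partialSum_sub (hasSum_harmProj hd hB hk hg x) (habs x)
    fun l => pow_mul_norm_harmProj_le hd hB hg l x

end Basis

/-! ### The deconvolution kernel -/

section Kernel

variable {d : ℕ} {B : ∀ l, Fin (harmDim d l) → Sph d → ℂ}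

instance secondCountableTopology_SO (d : ℕ) : SecondCountableTopology (SO d) :=
  have : SecondCountableTopology (Matrix (Fin (d + 1)) (Fin (d + 1)) ℝ) :=
    inferInstanceAs (SecondCountableTopology (Fin (d + 1) → Fin (d + 1) → ℝ))
  inferInstanceAs (SecondCountableTopology
    (Matrix.specialOrthogonalGroup (Fin (d + 1)) ℝ :
      Set (Matrix (Fin (d + 1)) (Fin (d + 1)) ℝ)))

/-- A rotation as a linear isometry. -/
noncomputable def rotIso (u : SO d) : Euc d ≃ₗᵢ[ℝ] Euc d :=
  LinearIsometry.toLinearIsometryEquiv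
    { toLinearMap := Matrix.toEuclideanLin (u : Matrix (Fin (d + 1)) (Fin (d + 1)) ℝ)
      norm_map' := fun y => by
        have h : inner ℝ (Matrix.toEuclideanLin (u : Matrix (Fin (d + 1)) (Fin (d + 1)) ℝ) y)
            (Matrix.toEuclideanLin (u : Matrix (Fin (d + 1)) (Fin (d + 1)) ℝ) y) =
            inner ℝ y y := by
          simp only [EuclideanSpace.inner_eq_star_dotProduct, Matrix.toLpLin_apply, star_trivial]
          rw [Matrix.dotProduct_mulVec, ← Matrix.mulVec_transpose, Matrix.mulVec_mulVec,
            SO_transpose_mul, Matrix.one_mulVec]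
        rw [norm_eq_sqrt_real_inner, norm_eq_sqrt_real_inner, h] } rfl

theorem sphMap_rotIso (u : SO d) (x : Sph d) : sphMap (rotIso u) x = rot u x := rfl

theorem continuous_rot : Continuous fun p : SO d × Sph d => rot p.1 p.2 := by
  refine Continuous.subtype_mk ?_ _
  refine (PiLp.continuous_toLp 2 _).comp ?_
  refine Continuous.matrix_mulVec (continuous_subtype_val.comp continuous_fst) ?_
  exact (PiLp.continuous_ofLp 2 _).comp (continuous_subtype_val.comp continuous_snd)

/-- Composition with a rotation acts on the conjugate harmonics of order `l` through the matrix
`D^l(u)`. -/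
theorem IsHarmonicBasis.conj_rot (hB : IsHarmonicBasis B) (hd : 1 ≤ d) (u : SO d) (l : ℕ)
    (q : Fin (harmDim d l)) (x : Sph d) :
    conj (B l q (rot u x)) = ∑ r, rotCoeff B l q r u * conj (B l r x) := by
  rw [← sphMap_rotIso, hB.comp_sphMap hd, map_sum]
  refine Finset.sum_congr rfl fun r _ => ?_
  rw [map_mul, isoCoeff, ← integral_conj, rotCoeff]
  simp only [map_mul, Complex.conj_conj, sphMap_rotIso]

theorem continuous_rotCoeff (hB : IsHarmonicBasis B) (l : ℕ) (q r : Fin (harmDim d l)) :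
    Continuous (rotCoeff B l q r) := by
  have hc : Continuous (Function.uncurry fun (u : SO d) (x : Sph d) =>
      conj (B l q (rot u x)) * B l r x) :=
    (Complex.continuous_conj.comp ((hB.continuous l q).comp continuous_rot)).mul
      ((hB.continuous l r).comp continuous_snd)
  have := continuous_parametric_integral_of_continuous (μ := surf d) hc
    (isCompact_univ (X := Sph d))
  simp only [Measure.restrict_univ] at this
  exact this

theorem rotFourier_eq_integral_map {PU : Measure (SO d)} {fU : SO d → ℝ} (hm : Measurable fU)
    (h0 : ∀ u, 0 ≤ fU u) (hPU : PU = (haarSO d).withDensity fun u => ENNReal.ofReal (fU u))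
    (l : ℕ) (q r : Fin (harmDim d l)) :
    rotFourier B fU l q r = ∫ u, rotCoeff B l q r u ∂PU := by
  rw [hPU, integral_withDensity_eq_integral_toReal_smul (by fun_prop)
    (Eventually.of_forall fun _ => ENNReal.ofReal_lt_top)]
  simp only [rotFourier, Matrix.of_apply, ENNReal.toReal_ofReal (h0 _), Complex.real_smul]

theorem continuous_deconvKernel (hB : IsHarmonicBasis B) (fU : SO d → ℝ) (t : ℝ) (x : Sph d) :
    Continuous (deconvKernel B fU t x) := by
  refine continuous_finsetSum _ fun l _ => continuous_finsetSum _ fun q _ =>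
    (continuous_finsetSum _ fun r _ => continuous_const.mul
      (Complex.continuous_conj.comp (hB.continuous l r))).mul continuous_const

/-- The mean of the deconvolution kernel against the law of the rotated variable is the truncated
Fourier-Laplace series. -/
theorem integral_deconvKernel_rot (hd : 1 ≤ d) (hB : IsHarmonicBasis B) {PU : Measure (SO d)}
    [IsFiniteMeasure PU] {fU : SO d → ℝ} (hm : Measurable fU) (h0 : ∀ u, 0 ≤ fU u)
    (hPU : PU = (haarSO d).withDensity fun u => ENNReal.ofReal (fU u))
    (hinv : ∀ l, IsUnit (rotFourier B fU l)) (t : ℝ) (x : Sph d) {g : Sph d → ℝ}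
    (hg : Continuous g) :
    ∫ u, ∫ y, deconvKernel B fU t x (rot u y) * (g y : ℂ) ∂surf d ∂PU =
      ∑ l ∈ Finset.range (⌊t⌋₊ + 1), harmProj B g l x := by
  have hgc : Continuous fun y => (g y : ℂ) := Complex.continuous_ofReal.comp hg
  have hinner : ∀ l (u : SO d) (r : Fin (harmDim d l)),
      ∫ y, conj (B l r (rot u y)) * (g y : ℂ) ∂surf d =
      ∑ s, rotCoeff B l r s u * fourierCoeff B g l s := by
    intro l u r
    simp only [hB.conj_rot hd, Finset.sum_mul, mul_assoc]
    have hs : ∀ s, Continuous fun y => conj (B l s y) := fun s =>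
      Complex.continuous_conj.comp (hB.continuous l s)
    rw [integral_finsetSum _ fun s _ => integrable_surf_of_continuous (continuous_const.fun_mul
      ((hs s).fun_mul hgc))]
    refine Finset.sum_congr rfl fun s _ => ?_
    rw [integral_const_mul, fourierCoeff]
    simp only [mul_comm]
  have hcr : ∀ l (u : SO d) (r : Fin (harmDim d l)),
      Continuous fun y => conj (B l r (rot u y)) := fun l u r =>
    Complex.continuous_conj.comp ((hB.continuous l r).comp
      (continuous_rot.comp (continuous_const.prodMk continuous_id)))
  have hu : ∀ u : SO d, ∫ y, deconvKernel B fU t x (rot u y) * (g y : ℂ) ∂surf d =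
      ∑ l ∈ Finset.range (⌊t⌋₊ + 1), ∑ q, ∑ r, ∑ s, (rotFourier B fU l)⁻¹ q r *
        fourierCoeff B g l s * B l q x * rotCoeff B l r s u := by
    intro u
    have h1 : ∀ y, deconvKernel B fU t x (rot u y) * (g y : ℂ) =
        ∑ l ∈ Finset.range (⌊t⌋₊ + 1), ∑ q, ∑ r, ((rotFourier B fU l)⁻¹ q r * B l q x) *
          (conj (B l r (rot u y)) * (g y : ℂ)) := by
      intro y
      simp only [deconvKernel, Finset.sum_mul]
      refine Finset.sum_congr rfl fun l _ => Finset.sum_congr rfl fun q _ =>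
        Finset.sum_congr rfl fun r _ => by ring
    have hI : ∀ l (r : Fin (harmDim d l)) (c : ℂ),
        Integrable (fun y => c * (conj (B l r (rot u y)) * (g y : ℂ))) (surf d) := fun l r c =>
      integrable_surf_of_continuous (continuous_const.fun_mul ((hcr l u r).fun_mul hgc))
    simp only [h1]
    rw [integral_finsetSum _ fun l _ => integrable_finsetSum _ fun q _ =>
      integrable_finsetSum _ fun r _ => hI l r _]
    refine Finset.sum_congr rfl fun l _ => ?_
    rw [integral_finsetSum _ fun q _ => integrable_finsetSum _ fun r _ => hI l r _]
    refine Finset.sum_congr rfl fun q _ => ?_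
    rw [integral_finsetSum _ fun r _ => hI l r _]
    refine Finset.sum_congr rfl fun r _ => ?_
    rw [integral_const_mul, hinner, Finset.mul_sum]
    exact Finset.sum_congr rfl fun s _ => by ring
  have hI : ∀ l (r s : Fin (harmDim d l)) (c : ℂ),
      Integrable (fun u => c * rotCoeff B l r s u) PU := fun l r s c =>
    (continuous_const.fun_mul (continuous_rotCoeff hB l r s)).integrable_of_hasCompactSupport
      (HasCompactSupport.of_compactSpace _)
  simp only [hu]
  rw [integral_finsetSum _ fun l _ => integrable_finsetSum _ fun q _ =>
      integrable_finsetSum _ fun r _ => integrable_finsetSum _ fun s _ => hI l r s _]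
  refine Finset.sum_congr rfl fun l _ => ?_
  rw [integral_finsetSum _ fun q _ => integrable_finsetSum _ fun r _ =>
    integrable_finsetSum _ fun s _ => hI l r s _, harmProj]
  refine Finset.sum_congr rfl fun q _ => ?_
  rw [integral_finsetSum _ fun r _ => integrable_finsetSum _ fun s _ => hI l r s _]
  -- the rotational Fourier transform created by the integration over `u` cancels against its inverse
  have hAB : (rotFourier B fU l)⁻¹ * rotFourier B fU l = 1 :=
    Matrix.nonsing_inv_mul _ ((Matrix.isUnit_iff_isUnit_det _).1 (hinv l))
  have h2 : ∀ r, ∫ u, ∑ s, (rotFourier B fU l)⁻¹ q r * fourierCoeff B g l s * B l q x *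
      rotCoeff B l r s u ∂PU = ∑ s, (rotFourier B fU l)⁻¹ q r * rotFourier B fU l r s *
        (fourierCoeff B g l s * B l q x) := by
    intro r
    rw [integral_finsetSum _ fun s _ => hI l r s _]
    refine Finset.sum_congr rfl fun s _ => ?_
    rw [integral_const_mul, ← rotFourier_eq_integral_map hm h0 hPU]
    ring
  simp only [h2]
  rw [Finset.sum_comm]
  simp only [← Finset.sum_mul, ← Matrix.mul_apply, hAB, Matrix.one_apply]
  simp

/-- The operator norm of the inverse of the rotational Fourier transform of order `l`. -/
noncomputable def invNorm (B : ∀ l, Fin (harmDim d l) → Sph d → ℂ) (fU : SO d → ℝ) (l : ℕ) : ℝ :=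
  ‖Matrix.toEuclideanCLM (𝕜 := ℂ) (rotFourier B fU l)⁻¹‖

theorem sum_sq_mulVec_le {n : ℕ} (A : Matrix (Fin n) (Fin n) ℂ) (v : Fin n → ℂ) :
    ∑ q, ‖∑ r, A q r * v r‖ ^ 2 ≤ ‖Matrix.toEuclideanCLM (𝕜 := ℂ) A‖ ^ 2 * ∑ r, ‖v r‖ ^ 2 := by
  have h := (Matrix.toEuclideanCLM (𝕜 := ℂ) A).le_opNorm (WithLp.toLp 2 v)
  have h2 := pow_le_pow_left₀ (norm_nonneg _) h 2
  rw [mul_pow, EuclideanSpace.norm_sq_eq, EuclideanSpace.norm_sq_eq] at h2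
  simpa [Matrix.toEuclideanCLM_toLp, Matrix.mulVec, dotProduct] using h2

/-- The Cauchy-Schwarz inequality in each degree, with `∑_q |B^l_q|² = N(d,l) / area(S^d)`. -/
theorem norm_deconvKernel_le (hd : 1 ≤ d) (hB : IsHarmonicBasis B) (fU : SO d → ℝ) (t : ℝ)
    (x z : Sph d) : ‖deconvKernel B fU t x z‖ ≤
      ∑ l ∈ Finset.range (⌊t⌋₊ + 1), invNorm B fU l * (harmDim d l / area d) := by
  refine (norm_sum_le _ _).trans (Finset.sum_le_sum fun l _ => ?_)
  have hN : 0 ≤ (harmDim d l : ℝ) / area d := div_nonneg (Nat.cast_nonneg _) (area_pos d).le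
  refine le_of_sq_le_sq ?_ (mul_nonneg (norm_nonneg _) hN)
  refine (sq_norm_sum_mul_le _ _ _).trans ?_
  have h1 := sum_sq_mulVec_le (rotFourier B fU l)⁻¹ fun r => conj (B l r z)
  simp only [RCLike.norm_conj, hB.sum_sq_eq hd] at h1 ⊢
  calc _ ≤ _ := mul_le_mul_of_nonneg_right h1 hN
    _ = _ := by rw [invNorm]; ring

/-- Parseval's identity for the deconvolution kernel, a finite sum of harmonics in its second
variable. -/
theorem integral_sq_norm_deconvKernel_le (hd : 1 ≤ d) (hB : IsHarmonicBasis B) (fU : SO d → ℝ)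
    (t : ℝ) (x : Sph d) : ∫ z, ‖deconvKernel B fU t x z‖ ^ 2 ∂surf d ≤
      ∑ l ∈ Finset.range (⌊t⌋₊ + 1), invNorm B fU l ^ 2 * (harmDim d l / area d) := by
  let s : Finset (Σ l, Fin (harmDim d l)) := (Finset.range (⌊t⌋₊ + 1)).sigma fun _ => Finset.univ
  -- coefficients of the conjugate of the kernel; they involve the adjoint of the inverse matrix
  let c : (Σ l, Fin (harmDim d l)) → ℂ := fun a =>
    ∑ q, conj ((rotFourier B fU a.1)⁻¹ q a.2) * conj (B a.1 q x)
  let K : C(Sph d, ℂ) := ⟨fun z => conj (deconvKernel B fU t x z),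
    Complex.continuous_conj.comp (continuous_deconvKernel hB fU t x)⟩
  have hK : ContinuousMap.toLp (E := ℂ) 2 (surf d) ℂ K = ∑ a ∈ s, c a • hB.toLp a := by
    have : K = ∑ a ∈ s, c a • (⟨B a.1 a.2, hB.continuous a.1 a.2⟩ : C(Sph d, ℂ)) := by
      ext z
      simp only [K, c, s, ContinuousMap.coe_mk, deconvKernel, map_sum, map_mul, Complex.conj_conj,
        ContinuousMap.coe_sum, Finset.sum_apply, ContinuousMap.coe_smul, Pi.smul_apply,
        smul_eq_mul, Finset.sum_sigma, Finset.sum_mul]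
      refine Finset.sum_congr rfl fun l _ => ?_
      rw [Finset.sum_comm]
      exact Finset.sum_congr rfl fun q _ => Finset.sum_congr rfl fun r _ => by ring
    rw [this, map_sum]
    simp only [map_smul]
    rfl
  have h1 : ((∫ z, ‖deconvKernel B fU t x z‖ ^ 2 ∂surf d : ℝ) : ℂ) = ∑ a ∈ s, (‖c a‖ ^ 2 : ℝ) := by
    have h2 := (hB.orthonormal_toLp hd).inner_sum c c s
    rw [← hK, ContinuousMap.inner_toLp] at h2
    rw [← integral_complex_ofReal]
    simp only [RCLike.conj_mul, RCLike.mul_conj, K, ContinuousMap.coe_mk, RCLike.norm_conj] at h2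
    push_cast
    exact h2
  have h3 : ∫ z, ‖deconvKernel B fU t x z‖ ^ 2 ∂surf d = ∑ a ∈ s, ‖c a‖ ^ 2 := by
    exact_mod_cast h1
  rw [h3, Finset.sum_sigma]
  refine Finset.sum_le_sum fun l _ => ?_
  have h4 := sum_sq_mulVec_le ((rotFourier B fU l)⁻¹).conjTranspose fun r => conj (B l r x)
  have h5 : ‖Matrix.toEuclideanCLM (𝕜 := ℂ) ((rotFourier B fU l)⁻¹).conjTranspose‖ =
      invNorm B fU l := by
    rw [← Matrix.star_eq_conjTranspose, map_star, ContinuousLinearMap.star_eq_adjoint,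
      LinearIsometryEquiv.norm_map, invNorm]
  rw [h5] at h4
  simp only [RCLike.norm_conj, hB.sum_sq_eq hd, Matrix.conjTranspose_apply] at h4
  exact h4

/-- A sum up to `t` of terms of order `l^p` is of order `t^(p+1)`. -/
theorem sum_range_floor_le {s : ℕ → ℝ} {C p : ℝ} (hC : 0 ≤ C) (hp : 0 ≤ p) (h0 : 0 ≤ s 0)
    (hs : ∀ l : ℕ, 1 ≤ l → s l ≤ C * (l : ℝ) ^ p) {t : ℝ} (ht : 1 ≤ t) :
    ∑ l ∈ Finset.range (⌊t⌋₊ + 1), s l ≤ (s 0 + C) * t ^ (p + 1) := by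
  have ht0 : 0 < t := by linarith
  rw [Finset.sum_range_succ']
  have h1 : ∀ l ∈ Finset.range ⌊t⌋₊, s (l + 1) ≤ C * t ^ p := by
    intro l hl
    refine (hs (l + 1) (by omega)).trans (mul_le_mul_of_nonneg_left ?_ hC)
    refine Real.rpow_le_rpow (by positivity) ?_ hp
    exact (Nat.cast_le.2 (Finset.mem_range.1 hl)).trans (Nat.floor_le ht0.le)
  have h2 := Finset.sum_le_card_nsmul _ _ _ h1
  rw [Finset.card_range, nsmul_eq_mul] at h2
  have h3 : (⌊t⌋₊ : ℝ) * (C * t ^ p) ≤ t * (C * t ^ p) :=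
    mul_le_mul_of_nonneg_right (Nat.floor_le ht0.le) (by positivity)
  have h4 : t ^ (p + 1) = t * t ^ p := by rw [Real.rpow_add_one ht0.ne', mul_comm]
  have h5 : 1 ≤ t ^ (p + 1) := Real.one_le_rpow ht (by linarith)
  have h6 : s 0 ≤ s 0 * t ^ (p + 1) := le_mul_of_one_le_right h0 h5
  calc _ ≤ t * (C * t ^ p) + s 0 * t ^ (p + 1) := by linarith
    _ = _ := by rw [h4]; ring

/-- Sup-norm and `L²` growth of the deconvolution kernel in the truncation level. -/
theorem exists_deconvKernel_bounds (hd : 1 ≤ d) (hB : IsHarmonicBasis B) (fU : SO d → ℝ) {β : ℝ}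
    (hβ : 0 ≤ β) (hS1 : ∃ c₁ : ℝ, 0 < c₁ ∧ ∀ l : ℕ, 1 ≤ l →
      ‖Matrix.toEuclideanCLM (𝕜 := ℂ) (rotFourier B fU l)⁻¹‖ ≤ c₁ * (l : ℝ) ^ β) :
    ∃ C : ℝ, 0 < C ∧ ∀ t : ℝ, 1 ≤ t → ∀ x : Sph d,
      (∀ z, ‖deconvKernel B fU t x z‖ ≤ C * t ^ (β + d)) ∧
      ∫ z, ‖deconvKernel B fU t x z‖ ^ 2 ∂surf d ≤ C * t ^ (2 * β + d) := by
  obtain ⟨c, hc, hS⟩ := hS1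
  obtain ⟨N, hN, hNl⟩ := exists_harmDim_le hd
  have hN0 : ∀ l, 0 ≤ (harmDim d l : ℝ) / area d := fun l =>
    div_nonneg (Nat.cast_nonneg _) (area_pos d).le
  have hi0 : ∀ l, 0 ≤ invNorm B fU l := fun l => norm_nonneg _
  have hd1 : (0 : ℝ) ≤ (d : ℝ) - 1 := by
    have : (1 : ℝ) ≤ d := by exact_mod_cast hd
    linarith
  have hpow : ∀ l : ℕ, 1 ≤ l → (l : ℝ) ^ (d - 1) = (l : ℝ) ^ ((d : ℝ) - 1) := by
    intro l _
    rw [← Real.rpow_natCast, Nat.cast_sub hd, Nat.cast_one]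
  set s₁ : ℕ → ℝ := fun l => invNorm B fU l * (harmDim d l / area d) with hs₁
  set s₂ : ℕ → ℝ := fun l => invNorm B fU l ^ 2 * (harmDim d l / area d) with hs₂
  have b₁ : ∀ l : ℕ, 1 ≤ l → s₁ l ≤ (c * N) * (l : ℝ) ^ (β + (d - 1)) := by
    intro l hl
    have hl0 : (0 : ℝ) < l := by exact_mod_cast hl
    have h := mul_le_mul (hS l hl) (hNl l hl) (hN0 l) (by positivity)
    rw [hpow l hl] at h
    refine h.trans_eq ?_
    rw [Real.rpow_add hl0]; ring
  have b₂ : ∀ l : ℕ, 1 ≤ l → s₂ l ≤ (c ^ 2 * N) * (l : ℝ) ^ (2 * β + (d - 1)) := by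
    intro l hl
    have hl0 : (0 : ℝ) < l := by exact_mod_cast hl
    have h := mul_le_mul (pow_le_pow_left₀ (hi0 l) (hS l hl) 2) (hNl l hl) (hN0 l) (by positivity)
    rw [hpow l hl] at h
    refine h.trans_eq ?_
    rw [Real.rpow_add hl0, two_mul, Real.rpow_add hl0]; ring
  have n₁ : 0 ≤ s₁ 0 := mul_nonneg (hi0 0) (hN0 0)
  have n₂ : 0 ≤ s₂ 0 := mul_nonneg (sq_nonneg _) (hN0 0)
  refine ⟨(s₁ 0 + c * N) + (s₂ 0 + c ^ 2 * N), by positivity, fun t ht x => ⟨fun z => ?_, ?_⟩⟩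
  · have hp : 0 ≤ t ^ (β + d) := Real.rpow_nonneg (by linarith) _
    refine (norm_deconvKernel_le hd hB fU t x z).trans ?_
    refine (sum_range_floor_le (by positivity) (by linarith) n₁ b₁ ht).trans ?_
    rw [show β + ((d : ℝ) - 1) + 1 = β + d by ring]
    have : 0 ≤ (s₂ 0 + c ^ 2 * N) * t ^ (β + d) := by positivity
    linarith
  · have hp : 0 ≤ t ^ (2 * β + d) := Real.rpow_nonneg (by linarith) _
    refine (integral_sq_norm_deconvKernel_le hd hB fU t x).trans ?_
    refine (sum_range_floor_le (by positivity) (by linarith) n₂ b₂ ht).trans ?_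
    rw [show 2 * β + ((d : ℝ) - 1) + 1 = 2 * β + d by ring]
    have : 0 ≤ (s₁ 0 + c * N) * t ^ (2 * β + d) := by positivity
    linarith

end Kernel

/-! ### Moments in the rotated regression model -/

theorem exists_norm_le_of_continuous {α F : Type*} [TopologicalSpace α] [CompactSpace α]
    [SeminormedAddCommGroup F] {f : α → F} (hf : Continuous f) : ∃ M, ∀ x, ‖f x‖ ≤ M := by
  obtain ⟨M, hM⟩ := (isCompact_univ.image hf.norm).bddAbove
  exact ⟨M, fun x => hM ⟨x, trivial, rfl⟩⟩

theorem integral_comp_eq_density {d : ℕ} {Ω : Type*} [MeasurableSpace Ω] {P : Measure Ω}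
    {X : Ω → Sph d} (hX : Measurable X) {fX : Sph d → ℝ} (hfc : Continuous fX)
    (hf0 : ∀ x, 0 ≤ fX x)
    (hfX : P.map X = (surf d).withDensity fun x => ENNReal.ofReal (fX x))
    {a : Sph d → ℝ} (ha : Continuous a) :
    ∫ ω, a (X ω) ∂P = ∫ x, a x * fX x ∂surf d := by
  rw [← integral_map hX.aemeasurable ha.aestronglyMeasurable, hfX,
    integral_withDensity_eq_integral_toReal_smul (by have := hfc.measurable; fun_prop)
    (Eventually.of_forall fun _ => ENNReal.ofReal_lt_top)]
  simp only [ENNReal.toReal_ofReal (hf0 _), smul_eq_mul, mul_comm]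

section Model

variable {d : ℕ} {Ω : Type*} [MeasurableSpace Ω] {P : Measure Ω} [IsProbabilityMeasure P]
  {X : Ω → Sph d} {U : Ω → SO d} {ε : Ω → ℝ}

theorem integral_comp_mul_condExp (hX : Measurable X) {a : Sph d → ℝ} (ha : Continuous a)
    {W : Ω → ℝ} (hW : Integrable W P) :
    ∫ ω, a (X ω) * W ω ∂P =
      ∫ ω, a (X ω) * (P[W | MeasurableSpace.comap X inferInstance]) ω ∂P := by
  obtain ⟨M, hM⟩ := exists_norm_le_of_continuous ha
  have hint : Integrable (fun ω => a (X ω) * W ω) P :=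
    hW.bdd_mul (c := M) (ha.measurable.comp hX).aestronglyMeasurable
      (Eventually.of_forall fun ω => hM _)
  have hsm : StronglyMeasurable[MeasurableSpace.comap X inferInstance] fun ω => a (X ω) :=
    (ha.measurable.comp (comap_measurable X)).stronglyMeasurable
  have h := condExp_mul_of_stronglyMeasurable_left (μ := P) hsm hint hW
  rw [← integral_condExp hX.comap_le]
  exact integral_congr_ae h

/-- When `U` is independent of `(X, ε)`, a function of `(X, ε)` may be replaced by its conditional
expectation given `X`, and `U` integrated out separately. -/
theorem integral_mul_of_indep (hX : Measurable X) (hU : Measurable U) (hε : Measurable ε)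
    (hindep : IndepFun U (fun ω => (X ω, ε ω)) P) {h : SO d × Sph d → ℝ} (hh : Continuous h)
    {w : Sph d × ℝ → ℝ} (hw : Measurable w) (hW : Integrable (fun ω => w (X ω, ε ω)) P) :
    Integrable (fun ω => h (U ω, X ω) * w (X ω, ε ω)) P ∧
    ∫ ω, h (U ω, X ω) * w (X ω, ε ω) ∂P = ∫ u, ∫ ω, h (u, X ω) *
      (P[fun ω => w (X ω, ε ω) | MeasurableSpace.comap X inferInstance]) ω ∂P ∂(P.map U) := by
  obtain ⟨M, hM⟩ := exists_norm_le_of_continuous hh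
  have hξ : Measurable fun ω => (X ω, ε ω) := hX.prodMk hε
  have hint : Integrable (fun ω => h (U ω, X ω) * w (X ω, ε ω)) P :=
    hW.bdd_mul (c := M) (hh.measurable.comp (hU.prodMk hX)).aestronglyMeasurable
      (Eventually.of_forall fun ω => hM _)
  refine ⟨hint, ?_⟩
  have := Measure.isProbabilityMeasure_map (μ := P) hU.aemeasurable
  have := Measure.isProbabilityMeasure_map (μ := P) hξ.aemeasurable
  have hlaw := (indepFun_iff_map_prod_eq_prod_map_map hU.aemeasurable hξ.aemeasurable).1 hindep
  have hFm : Measurable fun p : SO d × (Sph d × ℝ) => h (p.1, p.2.1) * w p.2 :=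
    (hh.measurable.comp (measurable_fst.prodMk (measurable_fst.comp measurable_snd))).mul
      (hw.comp measurable_snd)
  have hpair : Measurable fun ω => (U ω, (X ω, ε ω)) := hU.prodMk hξ
  have hFint : Integrable (fun p : SO d × (Sph d × ℝ) => h (p.1, p.2.1) * w p.2)
      ((P.map U).prod (P.map fun ω => (X ω, ε ω))) := by
    rw [← hlaw]
    exact (integrable_map_measure hFm.aestronglyMeasurable hpair.aemeasurable).2 hint
  have h1 : ∫ ω, h (U ω, X ω) * w (X ω, ε ω) ∂P =
      ∫ p, h (p.1, p.2.1) * w p.2 ∂((P.map U).prod (P.map fun ω => (X ω, ε ω))) := by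
    rw [← hlaw, integral_map hpair.aemeasurable hFm.aestronglyMeasurable]
  rw [h1, integral_prod _ hFint]
  refine integral_congr_ae (Eventually.of_forall fun u => ?_)
  have hc : Continuous fun x => h (u, x) := hh.comp (continuous_const.prodMk continuous_id)
  simp only
  have hc' : Measurable fun p : Sph d × ℝ => h (u, p.1) := hc.measurable.comp measurable_fst
  rw [integral_map hξ.aemeasurable (hc'.fun_mul hw).aestronglyMeasurable]
  exact integral_comp_mul_condExp hX hc hW

theorem integral_of_indep (hX : Measurable X) (hU : Measurable U) (hε : Measurable ε)
    (hindep : IndepFun U (fun ω => (X ω, ε ω)) P) {h : SO d × Sph d → ℝ} (hh : Continuous h) :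
    ∫ ω, h (U ω, X ω) ∂P = ∫ u, ∫ ω, h (u, X ω) ∂P ∂(P.map U) := by
  have h1 := (integral_mul_of_indep hX hU hε hindep hh (w := fun _ => 1) measurable_const
    (integrable_const _)).2
  rw [condExp_const hX.comap_le] at h1
  simpa using h1

theorem integral_mul_le_of_condExp_le (hX : Measurable X) (hU : Measurable U) (hε : Measurable ε)
    (hindep : IndepFun U (fun ω => (X ω, ε ω)) P) {h : SO d × Sph d → ℝ} (hh : Continuous h)
    (h0 : ∀ p, 0 ≤ h p) {w : Sph d × ℝ → ℝ} (hw : Measurable w)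
    (hW : Integrable (fun ω => w (X ω, ε ω)) P) {C : ℝ}
    (hC : ∀ᵐ ω ∂P, (P[fun ω => w (X ω, ε ω) | MeasurableSpace.comap X inferInstance]) ω ≤ C) :
    ∫ ω, h (U ω, X ω) * w (X ω, ε ω) ∂P ≤ C * ∫ ω, h (U ω, X ω) ∂P := by
  rw [(integral_mul_of_indep hX hU hε hindep hh hw hW).2, integral_of_indep hX hU hε hindep hh,
    ← integral_const_mul]
  have := Measure.isProbabilityMeasure_map (μ := P) hU.aemeasurable
  obtain ⟨M, hM⟩ := exists_norm_le_of_continuous hh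
  have hm : Measurable fun p : SO d × Ω => h (p.1, X p.2) :=
    hh.measurable.comp (measurable_fst.prodMk (hX.comp measurable_snd))
  have hV : Integrable (P[fun ω => w (X ω, ε ω) | MeasurableSpace.comap X inferInstance]) P :=
    integrable_condExp
  have i1 : Integrable (fun p : SO d × Ω => h (p.1, X p.2) *
      (P[fun ω => w (X ω, ε ω) | MeasurableSpace.comap X inferInstance]) p.2)
      ((P.map U).prod P) :=
    (hV.comp_snd (P.map U)).bdd_mul (c := M) hm.aestronglyMeasurable
      (Eventually.of_forall fun p => hM _)
  have i2 : Integrable (fun p : SO d × Ω => h (p.1, X p.2)) ((P.map U).prod P) :=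
    Integrable.of_bound hm.aestronglyMeasurable M (Eventually.of_forall fun p => hM _)
  refine integral_mono i1.integral_prod_left (i2.integral_prod_left.const_mul C) fun u => ?_
  have hc : Continuous fun x => h (u, x) := hh.comp (continuous_const.prodMk continuous_id)
  simp only
  rw [← integral_const_mul]
  refine integral_mono_ae (hV.bdd_mul (c := M) (hc.measurable.comp hX).aestronglyMeasurable
      (Eventually.of_forall fun p => hM _)) ((Integrable.of_bound
      (hc.measurable.comp hX).aestronglyMeasurable M (Eventually.of_forall fun p =>
        hM _)).const_mul C) ?_
  filter_upwards [hC] with ω hω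
  rw [mul_comm C]
  exact mul_le_mul_of_nonneg_left hω (h0 _)

theorem le_integral_mul_of_le_condExp (hX : Measurable X) (hU : Measurable U) (hε : Measurable ε)
    (hindep : IndepFun U (fun ω => (X ω, ε ω)) P) {h : SO d × Sph d → ℝ} (hh : Continuous h)
    (h0 : ∀ p, 0 ≤ h p) {w : Sph d × ℝ → ℝ} (hw : Measurable w)
    (hW : Integrable (fun ω => w (X ω, ε ω)) P) {c : ℝ}
    (hc : ∀ᵐ ω ∂P, c ≤ (P[fun ω => w (X ω, ε ω) | MeasurableSpace.comap X inferInstance]) ω) :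
    c * ∫ ω, h (U ω, X ω) ∂P ≤ ∫ ω, h (U ω, X ω) * w (X ω, ε ω) ∂P := by
  have h1 := integral_mul_le_of_condExp_le hX hU hε hindep hh h0 (w := fun p => -w p) hw.neg hW.neg
    (C := -c) (by
      have := condExp_neg (μ := P) (fun ω => w (X ω, ε ω)) (MeasurableSpace.comap X inferInstance)
      filter_upwards [hc, this] with ω h1 h2
      have h3 : (P[fun ω => -w (X ω, ε ω) | MeasurableSpace.comap X inferInstance]) ω =
        -(P[fun ω => w (X ω, ε ω) | MeasurableSpace.comap X inferInstance]) ω := h2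
      rw [h3]
      exact neg_le_neg h1)
  simp only [mul_neg, integral_neg, neg_mul] at h1
  linarith

/-- The noise is orthogonal to every function of the rotation and the covariate. -/
theorem integral_mul_noise_eq_zero (hX : Measurable X) (hU : Measurable U) (hε : Measurable ε)
    (hindep : IndepFun U (fun ω => (X ω, ε ω)) P) (hε_int : Integrable ε P)
    (hε_mean : P[ε | MeasurableSpace.comap X inferInstance] =ᵐ[P] 0)
    {h : SO d × Sph d → ℝ} (hh : Continuous h) :
    Integrable (fun ω => h (U ω, X ω) * ε ω) P ∧ ∫ ω, h (U ω, X ω) * ε ω ∂P = 0 := by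
  have h1 := integral_mul_of_indep hX hU hε hindep hh (w := fun p => p.2) measurable_snd hε_int
  refine ⟨h1.1, h1.2.trans ?_⟩
  refine integral_eq_zero_of_ae (Eventually.of_forall fun u => ?_)
  refine integral_eq_zero_of_ae ?_
  filter_upwards [hε_mean] with ω hω
  have : (P[fun ω => ε ω | MeasurableSpace.comap X inferInstance]) ω = 0 := hω
  simp [this]

/-- The mean of an estimating function with kernel `κ`: the noise drops out, and `U` and `X` are
integrated separately. -/
theorem integral_comp_rot_mul_response (hX : Measurable X) (hU : Measurable U) (hε : Measurable ε)
    (hindep : IndepFun U (fun ω => (X ω, ε ω)) P) (hε_int : Integrable ε P)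
    (hε_mean : P[ε | MeasurableSpace.comap X inferInstance] =ᵐ[P] 0)
    {fX : Sph d → ℝ} (hfc : Continuous fX) (hf0 : ∀ x, 0 ≤ fX x)
    (hfX : P.map X = (surf d).withDensity fun x => ENNReal.ofReal (fX x))
    {m : Sph d → ℝ} (hm : Continuous m) {κ : Sph d → ℝ} (hκ : Continuous κ) (θ : ℝ) :
    ∫ ω, κ (rot (U ω) (X ω)) * (m (X ω) + ε ω - θ) ∂P =
      ∫ u, ∫ x, κ (rot u x) * ((m x - θ) * fX x) ∂surf d ∂(P.map U) := by
  have hκr : Continuous fun p : SO d × Sph d => κ (rot p.1 p.2) := hκ.comp continuous_rot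
  have hh : Continuous fun p : SO d × Sph d => κ (rot p.1 p.2) * (m p.2 - θ) :=
    hκr.mul ((hm.comp continuous_snd).sub continuous_const)
  have h1 := integral_of_indep hX hU hε hindep hh
  have h2 := integral_mul_noise_eq_zero hX hU hε hindep hε_int hε_mean hκr
  have hi : Integrable (fun ω => κ (rot (U ω) (X ω)) * (m (X ω) - θ)) P := by
    obtain ⟨M, hM⟩ := exists_norm_le_of_continuous hh
    exact Integrable.of_bound (hh.measurable.comp (hU.prodMk hX)).aestronglyMeasurable M
      (Eventually.of_forall fun ω => hM (U ω, X ω))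
  have h3 : ∀ ω, κ (rot (U ω) (X ω)) * (m (X ω) + ε ω - θ) =
      κ (rot (U ω) (X ω)) * (m (X ω) - θ) + κ (rot (U ω) (X ω)) * ε ω := fun ω => by ring
  simp only [h3]
  rw [integral_add hi h2.1, h2.2, add_zero, h1]
  refine integral_congr_ae (Eventually.of_forall fun u => ?_)
  have hc : Continuous fun x => κ (rot u x) * (m x - θ) :=
    hh.comp (continuous_const.prodMk continuous_id)
  simp only
  rw [integral_comp_eq_density hX hfc hf0 hfX hc]
  simp only [mul_assoc]

/-- The rotated variable has a density bounded by the supremum of the density of `X`. -/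
theorem integral_sq_comp_rot_le (hX : Measurable X) (hU : Measurable U) (hε : Measurable ε)
    (hindep : IndepFun U (fun ω => (X ω, ε ω)) P)
    {fX : Sph d → ℝ} (hfc : Continuous fX) (hf0 : ∀ x, 0 ≤ fX x)
    (hfX : P.map X = (surf d).withDensity fun x => ENNReal.ofReal (fX x)) {M : ℝ}
    (hM : ∀ x, fX x ≤ M) {κ : Sph d → ℝ} (hκ : Continuous κ) :
    ∫ ω, κ (rot (U ω) (X ω)) ^ 2 ∂P ≤ M * ∫ z, κ z ^ 2 ∂surf d := by
  have hh : Continuous fun p : SO d × Sph d => κ (rot p.1 p.2) ^ 2 :=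
    (hκ.comp continuous_rot).pow 2
  rw [integral_of_indep hX hU hε hindep hh]
  have := Measure.isProbabilityMeasure_map (μ := P) hU.aemeasurable
  have hM0 : 0 ≤ M := by
    obtain ⟨ω⟩ : Nonempty Ω := nonempty_of_isProbabilityMeasure P
    exact (hf0 (X ω)).trans (hM _)
  have hle : ∀ u, ∫ ω, κ (rot u (X ω)) ^ 2 ∂P ≤ M * ∫ z, κ z ^ 2 ∂surf d := by
    intro u
    have hr : Continuous (rot u) := continuous_rot.comp (continuous_const.prodMk continuous_id)
    have hc : Continuous fun x => κ (rot u x) ^ 2 := (hκ.comp hr).pow 2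
    rw [integral_comp_eq_density hX hfc hf0 hfX hc]
    have h1 : ∫ z, κ z ^ 2 ∂surf d = ∫ x, κ (rot u x) ^ 2 ∂surf d := by
      conv_lhs => rw [← (measurePreserving_sphMap (rotIso u)).map_eq]
      rw [integral_map (continuous_sphMap _).aemeasurable (hκ.fun_pow 2).aestronglyMeasurable]
      rfl
    rw [h1, ← integral_const_mul]
    refine integral_mono (integrable_surf_of_continuous (hc.mul hfc))
      (integrable_surf_of_continuous (continuous_const.mul hc)) fun x => ?_
    simp only
    rw [mul_comm M]
    exact mul_le_mul_of_nonneg_left (hM x) (sq_nonneg _)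
  have hb := norm_integral_le_of_norm_le_const (μ := P.map U)
    (f := fun u => ∫ ω, κ (rot u (X ω)) ^ 2 ∂P) (C := M * ∫ z, κ z ^ 2 ∂surf d)
    (Eventually.of_forall fun u => by
      rw [Real.norm_of_nonneg (integral_nonneg fun ω => sq_nonneg _)]
      exact hle u)
  simp only [probReal_univ, mul_one] at hb
  exact (le_abs_self _).trans hb

theorem abs_sub_rpow_le {p : ℝ} (hp : 1 ≤ p) (a b : ℝ) :
    |a - b| ^ p ≤ 2 ^ p * (|a| ^ p + |b| ^ p) := by
  have hp0 : 0 ≤ p := by linarith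
  have h1 : |a - b| ≤ 2 * max |a| |b| := by
    have := abs_sub a b
    linarith [le_max_left |a| |b|, le_max_right |a| |b|]
  refine (Real.rpow_le_rpow (abs_nonneg _) h1 hp0).trans ?_
  rw [Real.mul_rpow zero_le_two (le_max_of_le_left (abs_nonneg a))]
  refine mul_le_mul_of_nonneg_left ?_ (by positivity)
  rcases max_choice |a| |b| with h | h <;> rw [h]
  · exact le_add_of_nonneg_right (by positivity)
  · exact le_add_of_nonneg_left (by positivity)

/-- On a probability space, integrability of a higher power implies that of the square. -/
theorem sq_le_one_add_rpow {δ : ℝ} (hδ : 0 < δ) (y : ℝ) : y ^ 2 ≤ 1 + |y| ^ (2 + δ) := by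
  have h0 : 0 ≤ |y| ^ (2 + δ) := by positivity
  rcases le_total |y| 1 with h | h
  · nlinarith [abs_nonneg y, sq_abs y]
  · have h1 : |y| ^ (2 : ℝ) ≤ |y| ^ (2 + δ) := Real.rpow_le_rpow_of_exponent_le h (by linarith)
    rw [Real.rpow_two, sq_abs] at h1
    linarith

/-- Upper bound for weighted moments of order `2 + δ` of the centred response. -/
theorem exists_integral_sq_mul_rpow_le (hX : Measurable X) (hU : Measurable U) (hε : Measurable ε)
    (hindep : IndepFun U (fun ω => (X ω, ε ω)) P) {m : Sph d → ℝ} (hm : Continuous m) {δ : ℝ}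
    (hδ : 0 < δ) (hmom : Integrable (fun ω => |m (X ω) + ε ω| ^ (2 + δ)) P) {C : ℝ}
    (hC : ∀ᵐ ω ∂P, (P[fun ω => |m (X ω) + ε ω| ^ (2 + δ) |
        MeasurableSpace.comap X inferInstance]) ω ≤ C) (θ : ℝ) :
    ∃ C' : ℝ, 0 < C' ∧ ∀ κ : Sph d → ℝ, Continuous κ →
      Integrable (fun ω => κ (rot (U ω) (X ω)) ^ 2 * |m (X ω) + ε ω - θ| ^ (2 + δ)) P ∧
      ∫ ω, κ (rot (U ω) (X ω)) ^ 2 * |m (X ω) + ε ω - θ| ^ (2 + δ) ∂P ≤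
        C' * ∫ ω, κ (rot (U ω) (X ω)) ^ 2 ∂P := by
  refine ⟨2 ^ (2 + δ) * (|C| + |θ| ^ (2 + δ)) + 1, by positivity, fun κ hκ => ?_⟩
  have hh : Continuous fun p : SO d × Sph d => κ (rot p.1 p.2) ^ 2 :=
    (hκ.comp continuous_rot).pow 2
  have hwm : Measurable fun p : Sph d × ℝ => |m p.1 + p.2| ^ (2 + δ) := by
    have := hm.measurable
    fun_prop
  have hwm' : Measurable fun p : Sph d × ℝ => |m p.1 + p.2 - θ| ^ (2 + δ) := by
    have := hm.measurable
    fun_prop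
  have i1 := (integral_mul_of_indep hX hU hε hindep hh hwm hmom).1
  have h1 := integral_mul_le_of_condExp_le hX hU hε hindep hh (fun p => sq_nonneg _) hwm hmom hC
  have i2 : Integrable (fun ω => κ (rot (U ω) (X ω)) ^ 2) P := by
    obtain ⟨M, hM⟩ := exists_norm_le_of_continuous hh
    exact Integrable.of_bound (hh.measurable.comp (hU.prodMk hX)).aestronglyMeasurable M
      (Eventually.of_forall fun ω => hM (U ω, X ω))
  have hbd : ∀ ω, κ (rot (U ω) (X ω)) ^ 2 * |m (X ω) + ε ω - θ| ^ (2 + δ) ≤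
      2 ^ (2 + δ) * (κ (rot (U ω) (X ω)) ^ 2 * |m (X ω) + ε ω| ^ (2 + δ)) +
      2 ^ (2 + δ) * |θ| ^ (2 + δ) * κ (rot (U ω) (X ω)) ^ 2 := by
    intro ω
    have := mul_le_mul_of_nonneg_left (abs_sub_rpow_le (p := 2 + δ) (by linarith)
      (m (X ω) + ε ω) θ) (sq_nonneg (κ (rot (U ω) (X ω))))
    linarith
  have i3 : Integrable (fun ω =>
      2 ^ (2 + δ) * (κ (rot (U ω) (X ω)) ^ 2 * |m (X ω) + ε ω| ^ (2 + δ)) +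
      2 ^ (2 + δ) * |θ| ^ (2 + δ) * κ (rot (U ω) (X ω)) ^ 2) P :=
    (i1.const_mul _).add (i2.const_mul _)
  have i4 : Integrable (fun ω => κ (rot (U ω) (X ω)) ^ 2 * |m (X ω) + ε ω - θ| ^ (2 + δ)) P := by
    refine i3.mono' ?_ (Eventually.of_forall fun ω => ?_)
    · exact ((hh.measurable.comp (hU.prodMk hX)).mul
        (hwm'.comp (hX.prodMk hε))).aestronglyMeasurable
    · rw [Real.norm_of_nonneg (by positivity)]
      exact hbd ω
  refine ⟨i4, (integral_mono i4 i3 hbd).trans ?_⟩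
  rw [integral_add (i1.const_mul _) (i2.const_mul _), integral_const_mul, integral_const_mul]
  have hk0 : 0 ≤ ∫ ω, κ (rot (U ω) (X ω)) ^ 2 ∂P := integral_nonneg fun ω => sq_nonneg _
  have h2 : ∫ ω, κ (rot (U ω) (X ω)) ^ 2 * |m (X ω) + ε ω| ^ (2 + δ) ∂P ≤
      |C| * ∫ ω, κ (rot (U ω) (X ω)) ^ 2 ∂P :=
    h1.trans (mul_le_mul_of_nonneg_right (le_abs_self C) hk0)
  have h3 := mul_le_mul_of_nonneg_left h2 (by positivity : (0 : ℝ) ≤ 2 ^ (2 + δ))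
  nlinarith

/-- Lower bound for weighted second moments of the centred response. -/
theorem le_integral_sq_mul_sq (hX : Measurable X) (hU : Measurable U) (hε : Measurable ε)
    (hindep : IndepFun U (fun ω => (X ω, ε ω)) P) (hε_int : Integrable ε P)
    (hε_mean : P[ε | MeasurableSpace.comap X inferInstance] =ᵐ[P] 0)
    {m : Sph d → ℝ} (hm : Continuous m) {δ : ℝ}
    (hδ : 0 < δ) (hmom : Integrable (fun ω => |m (X ω) + ε ω| ^ (2 + δ)) P) {c : ℝ}
    (hc : ∀ᵐ ω ∂P, c ≤ (P[fun ω => ε ω ^ 2 | MeasurableSpace.comap X inferInstance]) ω) (θ : ℝ)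
    {κ : Sph d → ℝ} (hκ : Continuous κ) :
    Integrable (fun ω => (κ (rot (U ω) (X ω)) * (m (X ω) + ε ω - θ)) ^ 2) P ∧
    c * ∫ ω, κ (rot (U ω) (X ω)) ^ 2 ∂P ≤
      ∫ ω, (κ (rot (U ω) (X ω)) * (m (X ω) + ε ω - θ)) ^ 2 ∂P := by
  obtain ⟨M, hM⟩ := exists_norm_le_of_continuous hm
  have hε2 : Integrable (fun ω => ε ω ^ 2) P := by
    refine (((integrable_const 1).add hmom).const_mul 2 |>.add
      (integrable_const (2 * M ^ 2))).mono' (hε.pow_const 2).aestronglyMeasurable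
      (Eventually.of_forall fun ω => ?_)
    rw [Real.norm_of_nonneg (sq_nonneg _)]
    have h1 := sq_le_one_add_rpow hδ (m (X ω) + ε ω)
    have h2 : m (X ω) ^ 2 ≤ M ^ 2 := by
      have := hM (X ω)
      rw [← sq_abs, ← Real.norm_eq_abs]
      exact pow_le_pow_left₀ (norm_nonneg _) this 2
    simp only [Pi.add_apply]
    nlinarith [sq_nonneg (2 * m (X ω) + ε ω)]
  have hκr : Continuous fun p : SO d × Sph d => κ (rot p.1 p.2) := hκ.comp continuous_rot
  have hh : Continuous fun p : SO d × Sph d => κ (rot p.1 p.2) ^ 2 := hκr.pow 2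
  have hms : Continuous fun p : SO d × Sph d => m p.2 - θ :=
    (hm.comp continuous_snd).sub continuous_const
  have hh1 : Continuous fun p : SO d × Sph d => κ (rot p.1 p.2) ^ 2 * (m p.2 - θ) ^ 2 :=
    hh.mul (hms.pow 2)
  have hh2 : Continuous fun p : SO d × Sph d => κ (rot p.1 p.2) ^ 2 * (2 * (m p.2 - θ)) :=
    hh.mul (continuous_const.mul hms)
  have i1 : Integrable (fun ω => κ (rot (U ω) (X ω)) ^ 2 * (m (X ω) - θ) ^ 2) P := by
    obtain ⟨M, hM⟩ := exists_norm_le_of_continuous hh1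
    exact Integrable.of_bound (hh1.measurable.comp (hU.prodMk hX)).aestronglyMeasurable M
      (Eventually.of_forall fun ω => hM (U ω, X ω))
  have e2 := integral_mul_noise_eq_zero hX hU hε hindep hε_int hε_mean hh2
  have i3 := (integral_mul_of_indep hX hU hε hindep hh (w := fun p => p.2 ^ 2)
    (measurable_snd.pow_const 2) hε2).1
  have e3 := le_integral_mul_of_le_condExp hX hU hε hindep hh (fun p => sq_nonneg _)
    (w := fun p => p.2 ^ 2) (measurable_snd.pow_const 2) hε2 hc
  simp only at e2 i3 e3
  -- expand `(m(X) - θ + ε)²`; the cross term has mean zero, and the first one is dropped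
  have hexp : ∀ ω, (κ (rot (U ω) (X ω)) * (m (X ω) + ε ω - θ)) ^ 2 =
      κ (rot (U ω) (X ω)) ^ 2 * (m (X ω) - θ) ^ 2 +
      κ (rot (U ω) (X ω)) ^ 2 * (2 * (m (X ω) - θ)) * ε ω +
      κ (rot (U ω) (X ω)) ^ 2 * ε ω ^ 2 := fun ω => by ring
  simp only [hexp]
  refine ⟨(i1.add e2.1).add i3, ?_⟩
  have e1 : 0 ≤ ∫ ω, κ (rot (U ω) (X ω)) ^ 2 * (m (X ω) - θ) ^ 2 ∂P :=
    integral_nonneg fun ω => by positivity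
  rw [integral_add (i1.fun_add e2.1) i3, integral_add i1 e2.1, e2.2]
  linarith

end Model

/-! ### Empirical likelihood of a nearly normalized sample -/

section EmpiricalLikelihood

variable {n : ℕ}

/-- Weak duality for the empirical likelihood: any dual variable `t` with `1 + t aᵢ ≥ 0` bounds the
product of feasible weights. -/
theorem prod_mul_prod_one_add_le_one {a w : Fin n → ℝ} (hw : ∀ i, 0 < w i) (hw1 : ∑ i, w i = 1)
    (hwa : ∑ i, w i * a i = 0) {t : ℝ} (ht : ∀ i, 0 ≤ 1 + t * a i) :
    (∏ i, ((n : ℝ) * w i)) * ∏ i, (1 + t * a i) ≤ 1 := by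
  rw [← Finset.prod_mul_distrib]
  calc ∏ i, ((n : ℝ) * w i * (1 + t * a i))
      ≤ ∏ i, Real.exp ((n : ℝ) * w i * (1 + t * a i) - 1) := by
        refine Finset.prod_le_prod
          (fun i _ => mul_nonneg (mul_nonneg n.cast_nonneg (hw i).le) (ht i)) fun i _ => ?_
        have := Real.add_one_le_exp ((n : ℝ) * w i * (1 + t * a i) - 1)
        linarith
    _ = 1 := by
        rw [← Real.exp_sum, Finset.sum_sub_distrib]
        have : ∑ i, (n : ℝ) * w i * (1 + t * a i) =
            n * ∑ i, w i + n * t * ∑ i, w i * a i := by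
          rw [Finset.mul_sum, Finset.mul_sum, ← Finset.sum_add_distrib]
          exact Finset.sum_congr rfl fun i _ => by ring
        rw [this, hw1, hwa]
        simp

/-- By the inequality of arithmetic and geometric means, here the case `t = 0` of weak duality. -/
theorem bddAbove_empLik_set (a : Fin n → ℝ) :
    BddAbove {p : ℝ | ∃ w : Fin n → ℝ, (∀ i, 0 < w i) ∧ ∑ i, w i = 1 ∧ ∑ i, w i * a i = 0 ∧
      p = ∏ i, ((n : ℝ) * w i)} := by
  refine ⟨1, ?_⟩
  rintro p ⟨w, hw, hw1, hwa, rfl⟩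
  simpa using prod_mul_prod_one_add_le_one hw hw1 hwa (t := 0) (by simp)

theorem empLik_nonneg (a : Fin n → ℝ) : 0 ≤ empLik a := by
  refine Real.sSup_nonneg ?_
  rintro p ⟨w, hw, -, -, rfl⟩
  exact Finset.prod_nonneg fun i _ => mul_nonneg n.cast_nonneg (hw i).le

theorem empLik_const_mul {c : ℝ} (hc : c ≠ 0) (a : Fin n → ℝ) :
    empLik (fun i => c * a i) = empLik a := by
  unfold empLik
  congr 1
  ext p
  refine exists_congr fun w => and_congr_right fun _ => and_congr_right fun _ =>
    and_congr_left fun _ => ?_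
  have : ∑ i, w i * (c * a i) = c * ∑ i, w i * a i := by
    rw [Finset.mul_sum]
    exact Finset.sum_congr rfl fun i _ => by ring
  rw [this, mul_eq_zero, or_iff_right hc]

/-- The superlevel sets of the empirical likelihood are projections of `σ`-compact sets. -/
theorem measurable_empLik : Measurable (empLik : (Fin n → ℝ) → ℝ) := by
  refine measurable_of_Ioi fun c => ?_
  rcases lt_or_ge c 0 with hc | hc
  · have : empLik (n := n) ⁻¹' Set.Ioi c = Set.univ :=
      Set.eq_univ_of_forall fun a => lt_of_lt_of_le hc (empLik_nonneg a)
    rw [this]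
    exact MeasurableSet.univ
  let O : Set ((Fin n → ℝ) × (Fin n → ℝ)) :=
    {p | (∀ i, 0 < p.1 i) ∧ c < ∏ i, ((n : ℝ) * p.1 i)}
  let K : Set ((Fin n → ℝ) × (Fin n → ℝ)) :=
    {p | ∑ i, p.1 i = 1 ∧ ∑ i, p.1 i * p.2 i = 0}
  have hO : IsOpen O := by
    have h1 : IsOpen {p : (Fin n → ℝ) × (Fin n → ℝ) | ∀ i, 0 < p.1 i} := by
      simp only [Set.ofPred_forall]
      exact isOpen_iInter_of_finite fun i => isOpen_lt (by fun_prop) (by fun_prop)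
    have h2 : IsOpen {p : (Fin n → ℝ) × (Fin n → ℝ) | c < ∏ i, ((n : ℝ) * p.1 i)} :=
      isOpen_lt (by fun_prop) (by fun_prop)
    exact h1.inter h2
  have hK : IsClosed K := by
    have h1 : IsClosed {p : (Fin n → ℝ) × (Fin n → ℝ) | ∑ i, p.1 i = 1} :=
      isClosed_eq (by fun_prop) (by fun_prop)
    have h2 : IsClosed {p : (Fin n → ℝ) × (Fin n → ℝ) | ∑ i, p.1 i * p.2 i = 0} :=
      isClosed_eq (by fun_prop) (by fun_prop)
    exact h1.inter h2
  have himg : empLik (n := n) ⁻¹' Set.Ioi c = Prod.snd '' (O ∩ K) := by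
    ext a
    simp only [Set.mem_preimage, Set.mem_Ioi, Set.mem_image]
    constructor
    · intro h
      have hne : {p : ℝ | ∃ w : Fin n → ℝ, (∀ i, 0 < w i) ∧ ∑ i, w i = 1 ∧
          ∑ i, w i * a i = 0 ∧ p = ∏ i, ((n : ℝ) * w i)}.Nonempty := by
        by_contra hne
        rw [Set.not_nonempty_iff_eq_empty] at hne
        rw [empLik, hne, Real.sSup_empty] at h
        exact absurd h (not_lt.2 hc)
      obtain ⟨p, ⟨w, hw, hw1, hwa, rfl⟩, hp⟩ := exists_lt_of_lt_csSup hne h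
      exact ⟨(w, a), ⟨⟨hw, hp⟩, hw1, hwa⟩, rfl⟩
    · rintro ⟨⟨w, b⟩, ⟨⟨hw, hp⟩, hw1, hwa⟩, rfl⟩
      exact lt_of_lt_of_le hp (le_csSup (bddAbove_empLik_set _) ⟨w, hw, hw1, hwa, rfl⟩)
  rw [himg]
  obtain ⟨G, hG, -, hGO, -⟩ := hO.exists_iUnion_isClosed
  rw [← hGO, Set.iUnion_inter, Set.image_iUnion]
  refine MeasurableSet.iUnion fun j => ?_
  obtain ⟨C, hC, hCe⟩ := (isSigmaCompact_univ.of_isClosed_subset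
    ((hG j).inter hK) (Set.subset_univ _)).image (continuous_snd : Continuous (Prod.snd : (Fin n → ℝ) × (Fin n → ℝ) → _))
  rw [← hCe]
  exact MeasurableSet.iUnion fun i => (hC i).measurableSet

theorem abs_log_one_add_sub_le {x : ℝ} (hx : |x| ≤ 1 / 2) :
    |Real.log (1 + x) - (x - x ^ 2 / 2)| ≤ 2 * |x| ^ 3 := by
  have h := Real.abs_log_sub_add_sum_range_le (x := -x) (by rw [abs_neg]; linarith) 2
  rw [abs_neg] at h
  have h2 : |x| ^ (2 + 1) / (1 - |x|) ≤ 2 * |x| ^ 3 := by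
    rw [div_le_iff₀ (by linarith)]
    have : 0 ≤ |x| ^ 3 := by positivity
    have h3 := mul_le_mul_of_nonneg_left hx this
    have e : |x| ^ (2 + 1) = |x| ^ 3 := rfl
    rw [e]
    linarith
  refine le_trans (le_of_eq ?_) (h.trans h2)
  congr 1
  simp [Finset.sum_range_succ]
  ring

/-- For a sample `a` whose entries are small and whose squares sum to about `1`, the log empirical
likelihood ratio is close to the square of the sum `S` of `a`. The dual objective
`∑ log (1 + t aᵢ)` is about `t S - t² / 2`, which is at most `S² / 2` with equality at `t = S`. Weak
duality at `t = S` bounds the ratio from above, and the weights of the exact dual optimum from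
below. -/
theorem abs_neg_two_log_empLik_sub_sq_le {a : Fin n → ℝ} {A κ : ℝ} (hA : 1 ≤ A)
    (hκA : 8 * A * κ ≤ 1) (hS : |∑ i, a i| ≤ A) (hQ : |∑ i, a i ^ 2 - 1| ≤ κ)
    (ha : ∀ i, |a i| ≤ κ) :
    0 < empLik a ∧ |-2 * Real.log (empLik a) - (∑ i, a i) ^ 2| ≤ 500 * A ^ 3 * κ := by
  set S := ∑ i, a i with hSdef
  set Q := ∑ i, a i ^ 2 with hQdef
  have hκ0 : 0 ≤ κ := (abs_nonneg _).trans hQ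
  have hκ8 : κ ≤ 1 / 8 := by nlinarith
  -- `4 A` bounds all the dual variables in use: both `S` and, as found below, the dual optimum
  obtain ⟨hQ1, hQ2⟩ := abs_le.1 hQ
  obtain ⟨hS1, hS2⟩ := abs_le.1 hS
  have hsmall : ∀ t : ℝ, |t| ≤ 4 * A → ∀ i, |t * a i| ≤ 1 / 2 := by
    intro t ht i
    rw [abs_mul]
    calc |t| * |a i| ≤ 4 * A * κ := mul_le_mul ht (ha i) (abs_nonneg _) (by linarith)
      _ ≤ 1 / 2 := by linarith
  have hpos : ∀ t : ℝ, |t| ≤ 4 * A → ∀ i, 1 / 2 ≤ 1 + t * a i := by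
    intro t ht i
    have := (abs_le.1 (hsmall t ht i)).1
    linarith
  -- second order expansion of the dual objective, uniformly in the dual variable
  have hlog : ∀ t : ℝ, |t| ≤ 4 * A →
      |∑ i, Real.log (1 + t * a i) - (t * S - t ^ 2 * Q / 2)| ≤ 2 * (64 * A ^ 3) * κ * Q := by
    intro t ht
    have h1 : t * S - t ^ 2 * Q / 2 = ∑ i, (t * a i - (t * a i) ^ 2 / 2) := by
      rw [Finset.sum_sub_distrib, ← Finset.mul_sum, ← Finset.sum_div, hQdef, Finset.mul_sum]
      simp only [mul_pow, Finset.mul_sum]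
    rw [h1, ← Finset.sum_sub_distrib, hQdef, Finset.mul_sum]
    refine (Finset.abs_sum_le_sum_abs _ _).trans (Finset.sum_le_sum fun i _ => ?_)
    refine (abs_log_one_add_sub_le (hsmall t ht i)).trans ?_
    have h3 : |t| ^ 3 ≤ 64 * A ^ 3 := by
      calc |t| ^ 3 ≤ (4 * A) ^ 3 := pow_le_pow_left₀ (abs_nonneg _) ht 3
        _ = _ := by ring
    have h4 : |a i| ^ 3 ≤ κ * a i ^ 2 := by
      rw [← sq_abs (a i)]
      nlinarith [ha i, sq_nonneg |a i|]
    rw [abs_mul, mul_pow]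
    calc 2 * (|t| ^ 3 * |a i| ^ 3) ≤ 2 * ((64 * A ^ 3) * (κ * a i ^ 2)) := by gcongr
      _ = _ := by ring
  have hA3 : 0 < A ^ 3 := by positivity
  have herr : 2 * (64 * A ^ 3) * κ * Q ≤ 150 * A ^ 3 * κ := by
    have : 0 ≤ A ^ 3 * κ := by positivity
    nlinarith
  have hA23 : A ^ 2 ≤ A ^ 3 := pow_le_pow_right₀ hA (by norm_num)
  have hn : (n : ℝ) ≠ 0 := by
    intro h0
    have : n = 0 := by exact_mod_cast h0
    subst this
    simp at hQdef
    rw [hQdef] at hQ1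
    linarith
  -- the optimal dual variable, whose weights are feasible
  obtain ⟨t, ht, hroot⟩ : ∃ t ∈ Set.Icc (-(4 * A)) (4 * A), ∑ i, a i / (1 + t * a i) = 0 := by
    have hsplit : ∀ t : ℝ, |t| ≤ 4 * A →
        ∑ i, a i / (1 + t * a i) = S - t * ∑ i, a i ^ 2 / (1 + t * a i) := by
      intro t ht
      rw [Finset.mul_sum, hSdef, ← Finset.sum_sub_distrib]
      refine Finset.sum_congr rfl fun i _ => ?_
      have : 1 + t * a i ≠ 0 := by
        have := hpos t ht i
        positivity
      rw [eq_sub_iff_add_eq, mul_div_assoc', ← add_div, div_eq_iff this]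
      ring
    have hlow : ∀ t : ℝ, |t| ≤ 4 * A → Q * (2 / 3) ≤ ∑ i, a i ^ 2 / (1 + t * a i) := by
      intro t ht
      rw [hQdef, Finset.sum_mul]
      refine Finset.sum_le_sum fun i _ => ?_
      have h1 := hpos t ht i
      have h2 := (abs_le.1 (hsmall t ht i)).2
      rw [le_div_iff₀ (by linarith)]
      nlinarith [sq_nonneg (a i)]
    have habsA : |4 * A| = 4 * A := abs_of_nonneg (by linarith)
    have habsA' : |-(4 * A)| = 4 * A := by rw [abs_neg, habsA]
    refine intermediate_value_Icc' (by linarith : -(4 * A) ≤ 4 * A)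
      (f := fun t => ∑ i, a i / (1 + t * a i)) ?_ ⟨?_, ?_⟩
    · refine continuousOn_finsetSum _ fun i _ => ?_
      refine ContinuousOn.div (by fun_prop) (by fun_prop) fun t ht => ?_
      have := hpos t (abs_le.2 ht) i
      linarith
    · show ∑ i, a i / (1 + 4 * A * a i) ≤ 0
      rw [hsplit _ habsA.le]
      have := hlow _ habsA.le
      nlinarith
    · show 0 ≤ ∑ i, a i / (1 + -(4 * A) * a i)
      rw [hsplit _ habsA'.le]
      have := hlow _ habsA'.le
      nlinarith
  have ht' : |t| ≤ 4 * A := abs_le.2 ht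
  have hposS : ∀ i, 0 < 1 + S * a i := fun i => by
    have := hpos S (by linarith) i
    linarith
  have hpost : ∀ i, 0 < 1 + t * a i := fun i => by
    have := hpos t ht' i
    linarith
  -- the weights `(n (1 + t aᵢ))⁻¹` are feasible
  have hmem : (∏ i, (1 + t * a i))⁻¹ ∈ {p : ℝ | ∃ w : Fin n → ℝ, (∀ i, 0 < w i) ∧
      ∑ i, w i = 1 ∧ ∑ i, w i * a i = 0 ∧ p = ∏ i, ((n : ℝ) * w i)} := by
    have hn0 : 0 < (n : ℝ) := lt_of_le_of_ne n.cast_nonneg hn.symm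
    refine ⟨fun i => 1 / n * (1 + t * a i)⁻¹, fun i => ?_, ?_, ?_, ?_⟩
    · have := hpost i
      positivity
    · have h1 : ∑ i, (1 + t * a i)⁻¹ = n - t * ∑ i, a i / (1 + t * a i) := by
        have : (n : ℝ) = ∑ _i : Fin n, (1 : ℝ) := by simp
        rw [Finset.mul_sum, this, ← Finset.sum_sub_distrib]
        refine Finset.sum_congr rfl fun i _ => ?_
        have := hpost i
        field_simp
        ring
      rw [← Finset.mul_sum, h1, hroot]
      field_simp
      ring
    · have : ∑ i, 1 / (n : ℝ) * (1 + t * a i)⁻¹ * a i = 1 / n * ∑ i, a i / (1 + t * a i) := by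
        rw [Finset.mul_sum]
        exact Finset.sum_congr rfl fun i _ => by ring
      rw [this, hroot, mul_zero]
    · rw [← Finset.prod_inv_distrib]
      refine Finset.prod_congr rfl fun i _ => ?_
      field_simp
  have hge : (∏ i, (1 + t * a i))⁻¹ ≤ empLik a := le_csSup (bddAbove_empLik_set a) hmem
  have hpos_prod : 0 < (∏ i, (1 + t * a i))⁻¹ :=
    inv_pos.2 (Finset.prod_pos fun i _ => hpost i)
  -- weak duality at `t = S`
  have hle : empLik a ≤ (∏ i, (1 + S * a i))⁻¹ := by
    refine csSup_le ⟨_, hmem⟩ ?_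
    rintro p ⟨w, hw, hw1, hwa, rfl⟩
    rw [le_inv_comm₀ (Finset.prod_pos fun i _ => mul_pos (lt_of_le_of_ne n.cast_nonneg hn.symm)
      (hw i)) (Finset.prod_pos fun i _ => hposS i)]
    rw [← one_div, le_div_iff₀ (Finset.prod_pos fun i _ =>
      mul_pos (lt_of_le_of_ne n.cast_nonneg hn.symm) (hw i)), mul_comm]
    exact prod_mul_prod_one_add_le_one hw hw1 hwa fun i => (hposS i).le
  have hEL : 0 < empLik a := hpos_prod.trans_le hge
  refine ⟨hEL, ?_⟩
  have hlog1 := Real.log_le_log hpos_prod hge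
  have hlog2 := Real.log_le_log hEL hle
  rw [Real.log_inv, Real.log_prod (fun i _ => (hpost i).ne')] at hlog1
  rw [Real.log_inv, Real.log_prod (fun i _ => (hposS i).ne')] at hlog2
  have e1 := (abs_le.1 (hlog t ht')).2
  have e2 := (abs_le.1 (hlog S (by linarith))).1
  have hS2A : S ^ 2 ≤ A ^ 2 := sq_le_sq' hS1 hS2
  have ht2A : t ^ 2 ≤ 16 * A ^ 2 := by nlinarith [ht.1, ht.2]
  have f1 : S ^ 2 * (Q - 1) ≤ A ^ 3 * κ := by nlinarith [sq_nonneg S]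
  have f2 : t ^ 2 * (1 - Q) ≤ 16 * A ^ 3 * κ := by nlinarith [sq_nonneg t]
  have f3 : 0 ≤ A ^ 3 * κ := by positivity
  rw [abs_le]
  constructor
  · nlinarith
  · nlinarith [sq_nonneg (t - S)]

end EmpiricalLikelihood

theorem negTwoLog_of_pos {p : ℝ} (hp : 0 < p) : negTwoLog p = ((-2 * Real.log p : ℝ) : EReal) := by
  rw [negTwoLog, ENNReal.log_ofReal_of_pos hp, EReal.coe_mul]
  rfl

theorem negTwoLog_of_nonpos {p : ℝ} (hp : p ≤ 0) : negTwoLog p = ⊤ := by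
  rw [negTwoLog, ENNReal.ofReal_of_nonpos hp, ENNReal.log_zero]
  exact EReal.coe_mul_bot_of_neg (x := -2) (by norm_num)

theorem negTwoLog_le_coe_iff {p q : ℝ} : negTwoLog p ≤ (q : EReal) ↔ Real.exp (-q / 2) ≤ p := by
  rcases lt_or_ge 0 p with hp | hp
  · rw [negTwoLog_of_pos hp, EReal.coe_le_coe_iff, ← Real.le_log_iff_exp_le hp]
    constructor <;> intro h <;> linarith
  · rw [negTwoLog_of_nonpos hp, top_le_iff]
    exact ⟨fun h => absurd h (EReal.coe_ne_top q),
      fun h => absurd (h.trans hp) (not_le.2 (Real.exp_pos _))⟩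

theorem measurable_negTwoLog : Measurable negTwoLog := by
  have h : negTwoLog = fun p => if 0 < p then ((-2 * Real.log p : ℝ) : EReal) else ⊤ := by
    ext p
    split_ifs with hp
    · exact negTwoLog_of_pos hp
    · exact negTwoLog_of_nonpos (not_lt.1 hp)
  rw [h]
  exact Measurable.ite measurableSet_Ioi
    (Real.measurable_log.const_mul _).coe_real_ereal measurable_const

/-! ### Limit theorems for triangular arrays with i.i.d. rows -/

section TriangularArray

variable {Ω : Type*} [MeasurableSpace Ω] {P : Measure Ω}

/-- The part of `y²` beyond the truncation level `η`; its expectation is the Lindeberg term. -/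
noncomputable def tailSq (η y : ℝ) : ℝ := if η < |y| then y ^ 2 else 0

theorem tailSq_nonneg (η y : ℝ) : 0 ≤ tailSq η y := by
  unfold tailSq
  split_ifs <;> positivity

theorem tailSq_le (η y : ℝ) : tailSq η y ≤ y ^ 2 := by
  unfold tailSq
  split_ifs
  · exact le_rfl
  · positivity

/-- The truncated square lies in `[0, η²]`. -/
theorem sq_sub_tailSq_mem (η y : ℝ) :
    0 ≤ y ^ 2 - tailSq η y ∧ (0 ≤ η → y ^ 2 - tailSq η y ≤ η ^ 2) := by
  refine ⟨sub_nonneg.2 (tailSq_le η y), fun hη => ?_⟩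
  unfold tailSq
  split_ifs with h
  · rw [sub_self]; positivity
  · rw [sub_zero, ← sq_abs y]
    exact pow_le_pow_left₀ (abs_nonneg y) (not_lt.1 h) 2

theorem measurable_tailSq (η : ℝ) : Measurable (tailSq η) :=
  Measurable.ite (measurableSet_lt measurable_const (by fun_prop)) (by fun_prop) measurable_const

/-- Lyapunov's condition controls the Lindeberg term. -/
theorem tailSq_le_rpow {δ η : ℝ} (hδ : 0 < δ) (hη : 0 < η) (y : ℝ) :
    tailSq η y ≤ |y| ^ (2 + δ) / η ^ δ := by
  unfold tailSq
  split_ifs with h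
  · rw [le_div_iff₀ (Real.rpow_pos_of_pos hη δ), Real.rpow_add (hη.trans h), ← sq_abs y]
    norm_num only [Real.rpow_ofNat]
    exact mul_le_mul_of_nonneg_left (Real.rpow_le_rpow hη.le h.le hδ.le) (by positivity)
  · exact div_nonneg (Real.rpow_nonneg (abs_nonneg y) _) (Real.rpow_nonneg hη.le _)

theorem integrable_tailSq {v : Ω → ℝ} (hv : Measurable v) (hv2 : Integrable (fun ω => v ω ^ 2) P)
    (η : ℝ) : Integrable (fun ω => tailSq η (v ω)) P :=
  hv2.mono' ((measurable_tailSq η).comp hv).aestronglyMeasurable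
    (Eventually.of_forall fun ω => by
      rw [Real.norm_of_nonneg (tailSq_nonneg _ _)]
      exact tailSq_le _ _)

/-- Second order expansion of the imaginary exponential, with a remainder that is cubic for small
and quadratic for large arguments. -/
theorem norm_exp_mul_I_sub_le (x : ℝ) :
    (|x| ≤ 1 → ‖Complex.exp (x * Complex.I) - (1 + x * Complex.I - x ^ 2 / 2)‖ ≤ |x| ^ 3) ∧
      ‖Complex.exp (x * Complex.I) - (1 + x * Complex.I - x ^ 2 / 2)‖ ≤ 4 * x ^ 2 := by
  have hcube : |x| ≤ 1 →
      ‖Complex.exp (x * Complex.I) - (1 + x * Complex.I - x ^ 2 / 2)‖ ≤ |x| ^ 3 := by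
    intro hx
    have hn : ‖(x * Complex.I : ℂ)‖ = |x| := by simp
    have h := Complex.exp_bound (x := x * Complex.I) (by rw [hn]; exact hx) (n := 3) (by norm_num)
    rw [hn] at h
    refine le_trans (le_of_eq ?_) (h.trans ?_)
    · congr 2
      simp [Finset.sum_range_succ, mul_pow, Complex.I_sq, Nat.factorial]
      ring
    · refine mul_le_of_le_one_right (by positivity) ?_
      norm_num [Nat.factorial]
  refine ⟨hcube, ?_⟩
  rcases le_or_gt |x| 1 with hx | hx
  · refine (hcube hx).trans ?_
    rw [← sq_abs x]
    nlinarith [sq_nonneg |x|, abs_nonneg x]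
  · refine (norm_sub_le _ _).trans ?_
    have h1 : ‖(1 + x * Complex.I - x ^ 2 / 2 : ℂ)‖ ≤ 1 + |x| + x ^ 2 / 2 := by
      refine (norm_sub_le _ _).trans (add_le_add ((norm_add_le _ _).trans ?_) ?_)
      · simp
      · simp
    rw [Complex.norm_exp_ofReal_mul_I]
    rw [← sq_abs x] at h1 ⊢
    nlinarith

/-- Markov's inequality for a row of an array of nonnegative variables. -/
theorem measureReal_sum_ge_le {x : ℕ → Ω → ℝ} {v : Ω → ℝ} (hid : ∀ i, IdentDistrib (x i) v P P)
    (hx : ∀ i ω, 0 ≤ x i ω) (hv : Integrable v P) (n : ℕ) {c : ℝ} (hc : 0 < c) :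
    P.real {ω | c ≤ ∑ i : Fin n, x i ω} ≤ n * (∫ ω, v ω ∂P) / c := by
  have hxL : ∀ i, Integrable (x i) P := fun i => (hid i).integrable_iff.2 hv
  have h := mul_meas_ge_le_integral_of_nonneg (μ := P) (f := fun ω => ∑ i : Fin n, x i ω)
    (Eventually.of_forall fun ω => Finset.sum_nonneg fun i _ => hx i ω)
    (integrable_finsetSum _ fun i _ => hxL i) c
  rw [integral_finsetSum Finset.univ (f := fun i : Fin n => x i) fun i _ => hxL i] at h
  simp only [fun i => (hid i).integral_eq, Finset.sum_const, Finset.card_univ, Fintype.card_fin,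
    nsmul_eq_mul] at h
  rwa [le_div_iff₀ hc, mul_comm]

variable [IsProbabilityMeasure P]

/-- The Lindeberg estimate of a characteristic function near the origin. -/
theorem norm_charFun_sub_le {v : Ω → ℝ} (hv : Measurable v)
    (hv2 : Integrable (fun ω => v ω ^ 2) P) {η : ℝ} (hη : 0 ≤ η) (t : ℝ)
    (ht : |t| * η ≤ 1) :
    ‖charFun (P.map v) t - 1 - (t * (∫ ω, v ω ∂P) * Complex.I - t ^ 2 * (∫ ω, v ω ^ 2 ∂P) / 2)‖
      ≤ |t| ^ 3 * η * (∫ ω, v ω ^ 2 ∂P) + 4 * t ^ 2 * ∫ ω, tailSq η (v ω) ∂P := by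
  have hv1 : Integrable v P :=
    ((memLp_two_iff_integrable_sq hv.aestronglyMeasurable).2 hv2).integrable (by norm_num)
  have hexp : Integrable (fun ω => Complex.exp ((t * v ω : ℝ) * Complex.I)) P := by
    refine (integrable_const (1 : ℝ)).mono' (by fun_prop) (Eventually.of_forall fun ω => ?_)
    rw [Complex.norm_exp_ofReal_mul_I]
  have hpoly : Integrable (fun ω => (1 + ((t * v ω : ℝ) : ℂ) * Complex.I
      - ((t * v ω : ℝ) : ℂ) ^ 2 / 2)) P := by
    have h1 : Integrable (fun ω => ((t * v ω : ℝ) : ℂ) * Complex.I) P :=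
      (hv1.const_mul t).ofReal.mul_const _
    have h2 : Integrable (fun ω => ((t * v ω : ℝ) : ℂ) ^ 2 / 2) P := by
      have : (fun ω => ((t * v ω : ℝ) : ℂ) ^ 2 / 2) =
          fun ω => ((t ^ 2 / 2 * v ω ^ 2 : ℝ) : ℂ) := by
        ext ω; push_cast; ring
      rw [this]
      exact (hv2.const_mul _).ofReal
    exact ((integrable_const _).fun_add h1).sub h2
  have hpint : ∫ ω, (1 + ((t * v ω : ℝ) : ℂ) * Complex.I - ((t * v ω : ℝ) : ℂ) ^ 2 / 2) ∂P =
      1 + (t * (∫ ω, v ω ∂P) * Complex.I - t ^ 2 * (∫ ω, v ω ^ 2 ∂P) / 2) := by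
    have h1 : Integrable (fun ω => (t * Complex.I) * (v ω : ℂ)) P := hv1.ofReal.const_mul _
    have h2 : Integrable (fun ω => (t ^ 2 / 2 : ℂ) * ((v ω ^ 2 : ℝ) : ℂ)) P :=
      hv2.ofReal.const_mul _
    have : (fun ω => (1 + ((t * v ω : ℝ) : ℂ) * Complex.I - ((t * v ω : ℝ) : ℂ) ^ 2 / 2)) =
        fun ω => 1 + (t * Complex.I) * (v ω : ℂ) - (t ^ 2 / 2 : ℂ) * ((v ω ^ 2 : ℝ) : ℂ) := by
      ext ω; push_cast; ring
    rw [this, integral_sub ((integrable_const _).fun_add h1) h2,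
      integral_add (integrable_const _) h1, integral_const_mul, integral_const_mul,
      integral_complex_ofReal, integral_complex_ofReal]
    simp
    ring
  have hchar : charFun (P.map v) t = ∫ ω, Complex.exp ((t * v ω : ℝ) * Complex.I) ∂P := by
    rw [charFun_apply_real, integral_map hv.aemeasurable (by fun_prop)]
    simp
  rw [sub_sub, hchar, ← hpint, ← integral_sub hexp hpoly]
  have htail := integrable_tailSq (P := P) hv hv2 η
  rw [← integral_const_mul, ← integral_const_mul, ← integral_add (hv2.const_mul _)
    (htail.const_mul _)]
  refine norm_integral_le_of_norm_le ((hv2.const_mul _).fun_add (htail.const_mul _))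
    (Eventually.of_forall fun ω => ?_)
  obtain ⟨h1, h2⟩ := norm_exp_mul_I_sub_le (t * v ω)
  unfold tailSq
  split_ifs with h
  · refine h2.trans ?_
    have h3 : 0 ≤ |t| ^ 3 * η * v ω ^ 2 := by positivity
    nlinarith
  · have h3 : |v ω| ≤ η := not_lt.1 h
    rw [mul_zero, add_zero]
    refine (h1 ?_).trans ?_
    · rw [abs_mul]
      exact (mul_le_mul_of_nonneg_left h3 (abs_nonneg t)).trans ht
    · rw [abs_mul, mul_pow, mul_assoc]
      refine mul_le_mul_of_nonneg_left ?_ (by positivity)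
      rw [← sq_abs (v ω), pow_succ']
      exact mul_le_mul_of_nonneg_right h3 (by positivity)

/-- Chebyshev's inequality for a row of an array. -/
theorem measureReal_abs_sum_sub_ge_le {x : ℕ → Ω → ℝ} {v : Ω → ℝ} (hx : iIndepFun x P)
    (hid : ∀ i, IdentDistrib (x i) v P P) (hv : MemLp v 2 P) (n : ℕ) {c : ℝ} (hc : 0 < c) :
    P.real {ω | c ≤ |∑ i : Fin n, x i ω - n * ∫ ω, v ω ∂P|} ≤
      n * (∫ ω, v ω ^ 2 ∂P) / c ^ 2 := by
  have hxL : ∀ i, MemLp (x i) 2 P := fun i => (hid i).memLp_iff.2 hv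
  have hsum : ∀ ω, ∑ i : Fin n, x i ω = (∑ i ∈ Finset.range n, x i) ω := fun ω => by
    rw [Finset.sum_apply, Finset.sum_range]
  have hmean : ∫ ω, (∑ i ∈ Finset.range n, x i) ω ∂P = n * ∫ ω, v ω ∂P := by
    simp only [Finset.sum_apply]
    rw [integral_finsetSum _ fun i _ => (hxL i).integrable (by norm_num)]
    simp [fun i => (hid i).integral_eq]
  have hvar : Var[∑ i ∈ Finset.range n, x i; P] ≤ n * ∫ ω, v ω ^ 2 ∂P := by
    rw [IndepFun.variance_sum (fun i _ => hxL i) fun i _ j _ hij => hx.indepFun hij]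
    simp only [fun i => (hid i).variance_eq, Finset.sum_const, Finset.card_range, nsmul_eq_mul]
    exact mul_le_mul_of_nonneg_left (variance_le_expectation_sq hv.1) n.cast_nonneg
  have h := meas_ge_le_variance_div_sq (memLp_finsetSum' (Finset.range n) fun i _ => hxL i) hc
  rw [hmean] at h
  simp only [hsum]
  refine (ENNReal.toReal_le_of_le_ofReal (div_nonneg (variance_nonneg _ _) (by positivity)) h).trans
    ?_
  gcongr

/-- A triangular array with i.i.d. rows whose entries in row `n` are distributed as `v n`, is
asymptotically centered and normalized, and satisfies Lindeberg's condition. -/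
structure IsLindebergArray (P : Measure Ω) (a : ℕ → ℕ → Ω → ℝ) (v : ℕ → Ω → ℝ) : Prop where
  indep : ∀ n, iIndepFun (a n) P
  identDistrib : ∀ n i, IdentDistrib (a n i) (v n) P P
  measurable : ∀ n, Measurable (v n)
  integrable_sq : ∀ n, Integrable (fun ω => v n ω ^ 2) P
  sq_eq : ∀ n : ℕ, 1 ≤ n → n * ∫ ω, v n ω ^ 2 ∂P = 1
  mean : Tendsto (fun n : ℕ => n * ∫ ω, v n ω ∂P) atTop (𝓝 0)
  lindeberg : ∀ η : ℝ, 0 < η → Tendsto (fun n : ℕ => n * ∫ ω, tailSq η (v n ω) ∂P) atTop (𝓝 0)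

namespace IsLindebergArray

variable {a : ℕ → ℕ → Ω → ℝ} {v : ℕ → Ω → ℝ}

/-- **Lindeberg's central limit theorem** for arrays with i.i.d. rows. -/
theorem tendstoInDistribution_sum (h : IsLindebergArray P a v) :
    TendstoInDistribution (fun (n : ℕ) ω => ∑ i : Fin n, a n i ω) atTop (id : ℝ → ℝ)
      (fun _ => P) (gaussianReal 0 1) where
  forall_aemeasurable n := Finset.aemeasurable_fun_sum _ fun i _ =>
    (h.identDistrib n i).aemeasurable_fst
  tendsto := by
    refine ProbabilityMeasure.tendsto_iff_tendsto_charFun.2 fun t => ?_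
    have hsum : ∀ n : ℕ, charFun (P.map fun ω => ∑ i : Fin n, a n i ω) t =
        (1 + (charFun (P.map (v n)) t - 1)) ^ n := by
      intro n
      have h1 : (fun ω => ∑ i : Fin n, a n i ω) = fun ω => ∑ i ∈ Finset.range n, a n i ω := by
        ext ω
        rw [Finset.sum_range]
      rw [h1, ((h.indep n).restrict _).charFun_map_fun_finsetSum_eq_prod
        fun i _ => (h.identDistrib n i).aemeasurable_fst]
      simp [fun i => (h.identDistrib n i).map_eq]
    simp only [ProbabilityMeasure.coe_mk, hsum, Measure.map_id, charFun_gaussianReal]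
    refine Complex.tendsto_one_add_pow_exp_of_tendsto ?_
    have hmain : Tendsto (fun n : ℕ => (n : ℂ) * (charFun (P.map (v n)) t - 1
        - (t * (∫ ω, v n ω ∂P) * Complex.I - t ^ 2 * (∫ ω, v n ω ^ 2 ∂P) / 2)))
        atTop (𝓝 0) := by
      rw [tendsto_zero_iff_norm_tendsto_zero]
      refine tendsto_order.2 ⟨fun b hb => Eventually.of_forall fun n =>
        hb.trans_le (norm_nonneg _), fun b hb => ?_⟩
      obtain ⟨η, hη, hη1, hη2⟩ : ∃ η : ℝ, 0 < η ∧ |t| * η ≤ 1 ∧ |t| ^ 3 * η ≤ b / 2 := by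
        refine ⟨min (1 / (|t| + 1)) (b / 2 / (|t| ^ 3 + 1)), by positivity, ?_, ?_⟩
        · calc |t| * min (1 / (|t| + 1)) (b / 2 / (|t| ^ 3 + 1)) ≤ |t| * (1 / (|t| + 1)) := by
                gcongr
                exact min_le_left _ _
            _ ≤ 1 := by
                rw [mul_one_div, div_le_one (by positivity)]
                linarith
        · calc |t| ^ 3 * min (1 / (|t| + 1)) (b / 2 / (|t| ^ 3 + 1))
              ≤ |t| ^ 3 * (b / 2 / (|t| ^ 3 + 1)) := by
                gcongr
                exact min_le_right _ _
            _ ≤ b / 2 := by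
                rw [mul_div_assoc', div_le_iff₀ (by positivity)]
                nlinarith [pow_nonneg (abs_nonneg t) 3]
      have hL := (h.lindeberg η hη).const_mul (4 * t ^ 2)
      rw [mul_zero] at hL
      filter_upwards [hL.eventually (gt_mem_nhds (half_pos hb)), eventually_ge_atTop 1]
        with n hn hn1
      rw [norm_mul, Complex.norm_natCast]
      have := mul_le_mul_of_nonneg_left
        (norm_charFun_sub_le (h.measurable n) (h.integrable_sq n) hη.le t hη1)
        (n.cast_nonneg : (0 : ℝ) ≤ n)
      refine this.trans_lt ?_
      have h1 := h.sq_eq n hn1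
      calc (n : ℝ) * (|t| ^ 3 * η * (∫ ω, v n ω ^ 2 ∂P) + 4 * t ^ 2 * ∫ ω, tailSq η (v n ω) ∂P)
          = |t| ^ 3 * η * (n * ∫ ω, v n ω ^ 2 ∂P)
              + 4 * t ^ 2 * (n * ∫ ω, tailSq η (v n ω) ∂P) := by ring
        _ < b := by rw [h1]; linarith
    have hmean : Tendsto (fun n : ℕ => ((n * ∫ ω, v n ω ∂P : ℝ) : ℂ) * (t * Complex.I)
        - t ^ 2 / 2) atTop (𝓝 (((0 : ℝ) : ℂ) * (t * Complex.I) - t ^ 2 / 2)) :=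
      (((Complex.continuous_ofReal.tendsto _).comp h.mean).mul_const _).sub_const _
    have hadd := hmain.add hmean
    refine (hadd.congr' ?_).trans (le_of_eq ?_)
    · filter_upwards [eventually_ge_atTop 1] with n hn
      have h1 : (n : ℂ) * ((∫ ω, v n ω ^ 2 ∂P : ℝ) : ℂ) = 1 := by
        exact_mod_cast h.sq_eq n hn
      push_cast
      linear_combination (t ^ 2 / 2 : ℂ) * h1
    · simp

/-- The squares of a row sum to about `1`. -/
theorem tendsto_measureReal_abs_sum_sq_sub_one (h : IsLindebergArray P a v) {κ : ℝ} (hκ : 0 < κ) :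
    Tendsto (fun n : ℕ => P.real {ω | κ < |∑ i : Fin n, a n i ω ^ 2 - 1|}) atTop (𝓝 0) := by
  refine tendsto_order.2 ⟨fun b hb => Eventually.of_forall fun n =>
    hb.trans_le measureReal_nonneg, fun b hb => ?_⟩
  -- truncation at `η` costs at most `(3 / κ)² η²` in Chebyshev's inequality
  obtain ⟨η, hη, hη1⟩ : ∃ η : ℝ, 0 < η ∧ η ^ 2 / (κ / 3) ^ 2 ≤ b / 3 := by
    refine ⟨√(b / 3) * (κ / 3), by positivity, ?_⟩
    rw [mul_pow, mul_div_assoc, div_self (by positivity), mul_one, Real.sq_sqrt (by positivity)]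
  have hL := h.lindeberg η hη
  filter_upwards [eventually_ge_atTop 1, hL.eventually (gt_mem_nhds (by positivity : 0 < κ / 3)),
    hL.eventually (gt_mem_nhds (by positivity : 0 < κ / 3 * (b / 3)))] with n hn hL1 hL2
  have hcoreM : Measurable fun y : ℝ => y ^ 2 - tailSq η y :=
    (by fun_prop : Measurable fun y : ℝ => y ^ 2).sub (measurable_tailSq η)
  have htail := integrable_tailSq (h.measurable n) (h.integrable_sq n) η
  have hcoreI : Integrable (fun ω => (v n ω ^ 2 - tailSq η (v n ω)) ^ 2) P := by
    refine ((h.integrable_sq n).const_mul (η ^ 2)).mono'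
      ((hcoreM.comp (h.measurable n)).pow_const 2).aestronglyMeasurable
      (Eventually.of_forall fun ω => ?_)
    obtain ⟨h1, h2⟩ := sq_sub_tailSq_mem η (v n ω)
    have h3 := tailSq_nonneg η (v n ω)
    rw [Real.norm_of_nonneg (by positivity), sq]
    exact mul_le_mul (h2 hη.le) (by linarith) h1 (by positivity)
  have hcoreL : MemLp (fun ω => v n ω ^ 2 - tailSq η (v n ω)) 2 P :=
    (memLp_two_iff_integrable_sq (hcoreM.comp (h.measurable n)).aestronglyMeasurable).2 hcoreI
  have hmean : n * ∫ ω, (v n ω ^ 2 - tailSq η (v n ω)) ∂P =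
      1 - n * ∫ ω, tailSq η (v n ω) ∂P := by
    rw [integral_sub (h.integrable_sq n) htail, mul_sub, h.sq_eq n hn]
  have hcoreE : n * ∫ ω, (v n ω ^ 2 - tailSq η (v n ω)) ^ 2 ∂P ≤ η ^ 2 := by
    calc n * ∫ ω, (v n ω ^ 2 - tailSq η (v n ω)) ^ 2 ∂P
        ≤ n * ∫ ω, η ^ 2 * v n ω ^ 2 ∂P := by
          refine mul_le_mul_of_nonneg_left (integral_mono hcoreI
            ((h.integrable_sq n).const_mul _) fun ω => ?_) n.cast_nonneg
          obtain ⟨h1, h2⟩ := sq_sub_tailSq_mem η (v n ω)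
          have h3 := tailSq_nonneg η (v n ω)
          simp only [sq (v n ω ^ 2 - tailSq η (v n ω))]
          exact mul_le_mul (h2 hη.le) (by linarith) h1 (by positivity)
      _ = η ^ 2 := by
          rw [integral_const_mul, mul_left_comm, h.sq_eq n hn, mul_one]
  have hA := measureReal_abs_sum_sub_ge_le (P := P)
    (x := fun i ω => a n i ω ^ 2 - tailSq η (a n i ω))
    (v := fun ω => v n ω ^ 2 - tailSq η (v n ω))
    ((h.indep n).comp (fun _ y => y ^ 2 - tailSq η y) fun _ => hcoreM)
    (fun i => (h.identDistrib n i).comp hcoreM) hcoreL n (by positivity : 0 < κ / 3)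
  have hB := measureReal_sum_ge_le (P := P) (x := fun i ω => tailSq η (a n i ω))
    (v := fun ω => tailSq η (v n ω))
    (fun i => (h.identDistrib n i).comp (measurable_tailSq η)) (fun i ω => tailSq_nonneg _ _)
    htail n (by positivity : 0 < κ / 3)
  rw [hmean] at hA
  have hB' : P.real {ω | κ / 3 ≤ ∑ i : Fin n, tailSq η (a n i ω)} ≤ b / 3 := by
    refine hB.trans ?_
    rw [div_le_iff₀ (by positivity)]
    linarith
  have hA' := hA.trans (div_le_div_of_nonneg_right hcoreE (by positivity)) |>.trans hη1
  refine ((measureReal_mono ?_).trans (measureReal_union_le _ _)).trans_lt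
    ((add_le_add hA' hB').trans_lt (by linarith))
  intro ω hω
  by_contra hcon
  rw [Set.mem_union, not_or] at hcon
  obtain ⟨hc1, hc2⟩ := hcon
  simp only [Set.mem_ofPred_eq, not_le] at hω hc1 hc2
  have hsplit : ∑ i : Fin n, a n i ω ^ 2 = ∑ i : Fin n, (a n i ω ^ 2 - tailSq η (a n i ω))
      + ∑ i : Fin n, tailSq η (a n i ω) := by
    rw [← Finset.sum_add_distrib]
    simp
  have hnn : 0 ≤ ∑ i : Fin n, tailSq η (a n i ω) :=
    Finset.sum_nonneg fun i _ => tailSq_nonneg _ _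
  have hnn' : 0 ≤ n * ∫ ω, tailSq η (v n ω) ∂P :=
    mul_nonneg n.cast_nonneg (integral_nonneg fun ω => tailSq_nonneg _ _)
  rw [hsplit] at hω
  obtain ⟨d1, d2⟩ := abs_lt.1 hc1
  refine absurd hω (not_lt.2 (abs_le.2 ⟨?_, ?_⟩)) <;> linarith

/-- The entries of a row are uniformly small. -/
theorem tendsto_measureReal_exists_lt_abs (h : IsLindebergArray P a v) {κ : ℝ} (hκ : 0 < κ) :
    Tendsto (fun n : ℕ => P.real {ω | ∃ i : Fin n, κ < |a n i ω|}) atTop (𝓝 0) := by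
  have hL := (h.lindeberg κ hκ).div_const (κ ^ 2)
  rw [zero_div] at hL
  refine squeeze_zero (fun n => measureReal_nonneg) (fun n => ?_) hL
  refine le_trans (measureReal_mono ?_) (measureReal_sum_ge_le (P := P)
    (x := fun i ω => tailSq κ (a n i ω))
    (fun i => (h.identDistrib n i).comp (measurable_tailSq κ)) (fun i ω => tailSq_nonneg _ _)
    (integrable_tailSq (h.measurable n) (h.integrable_sq n) κ) n (by positivity : 0 < κ ^ 2))
  rintro ω ⟨i, hi⟩
  have h1 : tailSq κ (a n i ω) ≤ ∑ i : Fin n, tailSq κ (a n i ω) :=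
    Finset.single_le_sum (f := fun i : Fin n => tailSq κ (a n i ω))
      (fun i _ => tailSq_nonneg _ _) (Finset.mem_univ i)
  refine le_trans ?_ h1
  -- a single entry beyond `κ` contributes more than `κ²` to the sum of the tails
  rw [tailSq, if_pos hi, ← sq_abs (a n i ω)]
  exact pow_le_pow_left₀ hκ.le hi.le 2

/-- The row sums are tight. -/
theorem eventually_measureReal_abs_sum_le (h : IsLindebergArray P a v) {A : ℝ} (hA : 1 < A) :
    ∀ᶠ n : ℕ in atTop, P.real {ω | A < |∑ i : Fin n, a n i ω|} ≤ 1 / (A - 1) ^ 2 := by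
  have hm := (h.mean.abs).eventually (gt_mem_nhds (by rw [abs_zero]; exact one_pos))
  filter_upwards [eventually_ge_atTop 1, hm] with n hn hmn
  have hC := measureReal_abs_sum_sub_ge_le (h.indep n) (h.identDistrib n)
    ((memLp_two_iff_integrable_sq (h.measurable n).aestronglyMeasurable).2 (h.integrable_sq n)) n
    (sub_pos.2 hA)
  rw [h.sq_eq n hn] at hC
  refine (measureReal_mono fun ω hω => ?_).trans hC
  simp only [Set.mem_ofPred_eq] at hω ⊢
  have := abs_sub_abs_le_abs_sub (∑ i : Fin n, a n i ω) (n * ∫ ω, v n ω ∂P)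
  linarith

/-- With probability tending to one the empirical likelihood of a row is positive and its log ratio
is close to the squared row sum. -/
theorem tendsto_measureReal_empLik_bad (h : IsLindebergArray P a v) {τ : ℝ} (hτ : 0 < τ) :
    Tendsto (fun n : ℕ => P.real {ω | ¬ (0 < empLik (fun i : Fin n => a n i ω) ∧
      |-2 * Real.log (empLik fun i : Fin n => a n i ω) - (∑ i : Fin n, a n i ω) ^ 2| < τ)})
      atTop (𝓝 0) := by
  refine tendsto_order.2 ⟨fun b hb => Eventually.of_forall fun n =>
    hb.trans_le measureReal_nonneg, fun b hb => ?_⟩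
  obtain ⟨A, hA, hAb⟩ : ∃ A : ℝ, 1 < A ∧ 1 / (A - 1) ^ 2 ≤ b / 4 := by
    refine ⟨1 + √(4 / b), by simp; positivity, ?_⟩
    rw [add_sub_cancel_left, Real.sq_sqrt (by positivity), one_div_div]
  obtain ⟨κ, hκ, hκA, hκτ⟩ : ∃ κ : ℝ, 0 < κ ∧ 8 * A * κ ≤ 1 ∧ 500 * A ^ 3 * κ < τ := by
    refine ⟨min (1 / (8 * A)) (τ / (1000 * A ^ 3)), by positivity, ?_, ?_⟩
    · calc 8 * A * min (1 / (8 * A)) (τ / (1000 * A ^ 3)) ≤ 8 * A * (1 / (8 * A)) := by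
            gcongr
            exact min_le_left _ _
        _ = 1 := by field_simp
    · calc 500 * A ^ 3 * min (1 / (8 * A)) (τ / (1000 * A ^ 3))
            ≤ 500 * A ^ 3 * (τ / (1000 * A ^ 3)) := by
            gcongr
            exact min_le_right _ _
        _ = τ / 2 := by field_simp; norm_num
        _ < τ := half_lt_self hτ
  filter_upwards [h.eventually_measureReal_abs_sum_le hA,
    (h.tendsto_measureReal_abs_sum_sq_sub_one hκ).eventually (gt_mem_nhds (by positivity : 0 < b / 4)),
    (h.tendsto_measureReal_exists_lt_abs hκ).eventually (gt_mem_nhds (by positivity : 0 < b / 4))]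
    with n h1 h2 h3
  refine ((measureReal_mono ?_).trans ((measureReal_union_le
    ({ω | A < |∑ i : Fin n, a n i ω|} ∪ {ω | κ < |∑ i : Fin n, a n i ω ^ 2 - 1|})
    {ω | ∃ i : Fin n, κ < |a n i ω|}).trans (add_le_add_left (measureReal_union_le _ _) _))).trans_lt
    (by linarith)
  intro ω hω
  by_contra hcon
  simp only [Set.mem_union, Set.mem_ofPred_eq, not_or, not_lt, not_exists] at hcon
  obtain ⟨⟨c1, c2⟩, c3⟩ := hcon
  obtain ⟨e1, e2⟩ := abs_neg_two_log_empLik_sub_sq_le hA.le hκA c1 c2 c3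
  exact hω ⟨e1, e2.trans_lt hκτ⟩

/-- Wilks' theorem for the empirical likelihood of a Lindeberg array. -/
theorem tendstoInDistribution_negTwoLog_empLik (h : IsLindebergArray P a v) :
    TendstoInDistribution (fun (n : ℕ) ω => negTwoLog (empLik fun i : Fin n => a n i ω)) atTop
      (fun t : ℝ => (t : EReal)) (fun _ => P) chiSqOne := by
  have hEm : ∀ n : ℕ, AEMeasurable (fun ω => empLik fun i : Fin n => a n i ω) P := fun n =>
    measurable_empLik.comp_aemeasurable
      (aemeasurable_pi_lambda _ fun i => (h.identDistrib n i).aemeasurable_fst)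
  have hVm : ∀ n : ℕ, AEMeasurable (fun ω => -2 * Real.log (empLik fun i : Fin n => a n i ω)) P :=
    fun n => (Real.measurable_log.comp_aemeasurable (hEm n)).const_mul _
  -- the real-valued statistic, with the value `0` when the empirical likelihood vanishes
  have hreal : TendstoInDistribution
      (fun (n : ℕ) ω => -2 * Real.log (empLik fun i : Fin n => a n i ω)) atTop
      ((fun z : ℝ => z ^ 2) ∘ id) (fun _ => P) (gaussianReal 0 1) := by
    refine tendstoInDistribution_of_tendstoInMeasure_sub _ _
      (h.tendstoInDistribution_sum.continuous_comp (g := fun z : ℝ => z ^ 2) (by fun_prop)) ?_ hVm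
    rw [tendstoInMeasure_iff_measureReal_norm]
    intro τ hτ
    refine squeeze_zero (fun n => measureReal_nonneg) (fun n => measureReal_mono ?_)
      (h.tendsto_measureReal_empLik_bad hτ)
    intro ω hω hcon
    simp only [Set.mem_ofPred_eq, Pi.sub_apply, Function.comp_apply, Pi.zero_apply, sub_zero,
      Real.norm_eq_abs] at hω
    exact absurd hcon.2 (not_lt.2 hω)
  have hE : TendstoInDistribution
      (fun (n : ℕ) ω => ((-2 * Real.log (empLik fun i : Fin n => a n i ω) : ℝ) : EReal)) atTop
      (fun z : ℝ => ((z ^ 2 : ℝ) : EReal)) (fun _ => P) (gaussianReal 0 1) :=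
    hreal.continuous_comp (g := fun t : ℝ => (t : EReal)) continuous_coe_real_ereal
  have hNm : ∀ n : ℕ,
      AEMeasurable (fun ω => negTwoLog (empLik fun i : Fin n => a n i ω)) P := fun n =>
    measurable_negTwoLog.comp_aemeasurable (hEm n)
  refine ⟨hNm, measurable_coe_real_ereal.aemeasurable, ?_⟩
  refine ProbabilityMeasure.tendsto_iff_forall_integral_tendsto.2 fun f => ?_
  have h0 := ProbabilityMeasure.tendsto_iff_forall_integral_tendsto.1 hE.tendsto f
  simp only [ProbabilityMeasure.coe_mk] at h0 ⊢
  have hfm : ∀ μ : Measure EReal, AEStronglyMeasurable f μ :=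
    fun μ => f.continuous.aestronglyMeasurable
  have hmap : (chiSqOne.map fun t : ℝ => (t : EReal)) =
      (gaussianReal 0 1).map fun z : ℝ => ((z ^ 2 : ℝ) : EReal) := by
    rw [chiSqOne, Measure.map_map measurable_coe_real_ereal (by fun_prop)]
    rfl
  rw [hmap]
  refine (tendsto_iff_of_dist ?_).1 h0
  -- the two statistics differ only when the empirical likelihood vanishes
  have hbad := (h.tendsto_measureReal_empLik_bad one_pos).const_mul (2 * ‖f‖)
  rw [mul_zero] at hbad
  refine squeeze_zero (fun n => dist_nonneg) (fun n => ?_) hbad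
  rw [integral_map (hVm n).coe_real_ereal (hfm _), integral_map (hNm n) (hfm _), dist_eq_norm,
    ← integral_sub]
  · set D : Set Ω := {ω | ¬ (0 < empLik (fun i : Fin n => a n i ω) ∧
      |-2 * Real.log (empLik fun i : Fin n => a n i ω) - (∑ i : Fin n, a n i ω) ^ 2| < 1)} with hD
    have hDm : NullMeasurableSet D P := by
      have hs : AEMeasurable (fun ω => |-2 * Real.log (empLik fun i : Fin n => a n i ω)
          - (∑ i : Fin n, a n i ω) ^ 2|) P :=
        ((hVm n).sub ((Finset.aemeasurable_fun_sum _ fun (i : Fin n) _ =>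
          (h.identDistrib n i).aemeasurable_fst).pow_const 2)).norm
      exact ((nullMeasurableSet_lt aemeasurable_const (hEm n)).inter
        (nullMeasurableSet_lt hs aemeasurable_const)).compl
    have hint : Integrable (D.indicator fun _ => 2 * ‖f‖) P :=
      (integrable_const _).indicator₀ hDm
    refine (norm_integral_le_of_norm_le hint (Eventually.of_forall fun ω => ?_)).trans
      (le_of_eq ?_)
    · by_cases hω : ω ∈ D
      · rw [Set.indicator_of_mem hω]
        refine (norm_sub_le _ _).trans ?_
        have := f.norm_coe_le_norm
        linarith [this ((-2 * Real.log (empLik fun i : Fin n => a n i ω) : ℝ) : EReal),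
          this (negTwoLog (empLik fun i : Fin n => a n i ω))]
      · rw [Set.indicator_of_notMem hω]
        simp only [hD, Set.mem_ofPred_eq, not_not] at hω
        rw [negTwoLog_of_pos hω.1, sub_self, norm_zero]
    · rw [integral_indicator₀ hDm, setIntegral_const, smul_eq_mul, mul_comm]
  · exact (f.integrable _).comp_aemeasurable (hVm n).coe_real_ereal
  · exact (f.integrable _).comp_aemeasurable (hNm n)

end IsLindebergArray

end TriangularArray

/-! ### Quantiles of the chi-square distribution -/

theorem chiSqOne_singleton (q : ℝ) : chiSqOne {q} = 0 := by
  rw [chiSqOne, Measure.map_apply (by fun_prop) (measurableSet_singleton q)]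
  have : NullSingletonClass (gaussianReal 0 1) := nullSingletonClass_gaussianReal one_ne_zero
  refine measure_mono_null (t := {√q, -√q}) (fun z hz => ?_) ?_
  · have hz' : z ^ 2 = q := hz
    have h := Real.sqrt_sq_eq_abs z
    rw [hz'] at h
    rcases abs_choice z with h1 | h1
    · left
      rw [h, h1]
    · right
      rw [Set.mem_singleton_iff, h, h1, neg_neg]
  · exact (Set.toFinite _).measure_zero _

/-- The quantile is attained, since the distribution function is continuous. -/
theorem cdf_chiSqOne_chiSqOneUpper {α : ℝ} (h0 : 0 < α) (h1 : α < 1) :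
    cdf chiSqOne (chiSqOneUpper α) = 1 - α := by
  have hcont : Continuous (cdf chiSqOne) := by
    refine continuous_iff_continuousAt.2 fun x => ?_
    rw [(monotone_cdf chiSqOne).continuousAt_iff_leftLim_eq_rightLim, StieltjesFunction.rightLim_eq]
    have h := (cdf chiSqOne).measure_singleton x
    rw [measure_cdf, chiSqOne_singleton, eq_comm, ENNReal.ofReal_eq_zero] at h
    exact le_antisymm ((monotone_cdf chiSqOne).leftLim_le le_rfl) (by linarith)
  obtain ⟨s, hs⟩ := ((tendsto_cdf_atBot chiSqOne).eventually
    (gt_mem_nhds (by linarith : (0 : ℝ) < 1 - α))).exists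
  obtain ⟨t, ht⟩ := ((tendsto_cdf_atTop chiSqOne).eventually
    (lt_mem_nhds (by linarith : 1 - α < (1 : ℝ)))).exists
  obtain ⟨r, hr⟩ := mem_range_of_exists_le_of_exists_ge hcont ⟨s, hs.le⟩ ⟨t, ht.le⟩
  have hbdd : BddBelow {t : ℝ | 1 - α ≤ cdf chiSqOne t} := by
    refine ⟨s, fun u hu => le_of_not_gt fun hlt => ?_⟩
    have h2 : 1 - α ≤ cdf chiSqOne u := hu
    linarith [monotone_cdf chiSqOne hlt.le]
  have hclosed : IsClosed {t : ℝ | 1 - α ≤ cdf chiSqOne t} := isClosed_le continuous_const hcont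
  have hmem : 1 - α ≤ cdf chiSqOne (chiSqOneUpper α) := hclosed.csInf_mem ⟨r, hr.ge⟩ hbdd
  exact le_antisymm ((monotone_cdf chiSqOne (csInf_le hbdd hr.ge)).trans hr.le) hmem

/-- Convergence in distribution to the chi-square law gives the asymptotic level of the region
below its quantile. -/
theorem tendsto_measureReal_le_chiSqOneUpper {Ω : Type*} [MeasurableSpace Ω] {P : Measure Ω}
    [IsProbabilityMeasure P] {V : ℕ → Ω → EReal}
    (hV : TendstoInDistribution V atTop (fun t : ℝ => (t : EReal)) (fun _ => P) chiSqOne)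
    {α : ℝ} (h0 : 0 < α) (h1 : α < 1) :
    Tendsto (fun n => P.real {ω | V n ω ≤ (chiSqOneUpper α : EReal)}) atTop (𝓝 (1 - α)) := by
  set q := chiSqOneUpper α with hq
  have hfr : (chiSqOne.map fun t : ℝ => (t : EReal)) (frontier (Set.Iic (q : EReal))) = 0 := by
    refine measure_mono_null (frontier_Iic_subset _) ?_
    rw [Measure.map_apply measurable_coe_real_ereal (measurableSet_singleton _)]
    refine measure_mono_null (fun t ht => ?_) (chiSqOne_singleton q)
    exact EReal.coe_injective ht
  have h := ProbabilityMeasure.tendsto_measure_of_null_frontier_of_tendsto' hV.tendsto hfr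
  have hprob : IsProbabilityMeasure (chiSqOne.map fun t : ℝ => (t : EReal)) :=
    Measure.isProbabilityMeasure_map measurable_coe_real_ereal.aemeasurable
  simp only [ProbabilityMeasure.coe_mk] at h
  have h2 := (ENNReal.tendsto_toReal (measure_ne_top _ _)).comp h
  have hlim : ((chiSqOne.map fun t : ℝ => (t : EReal)) (Set.Iic (q : EReal))).toReal = 1 - α := by
    rw [Measure.map_apply measurable_coe_real_ereal measurableSet_Iic,
      ← cdf_chiSqOne_chiSqOneUpper h0 h1, cdf_eq_real, measureReal_def]
    congr 2
    ext t
    simp [hq]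
  rw [hlim] at h2
  refine h2.congr fun n => ?_
  simp only [Function.comp_apply]
  rw [Measure.map_apply_of_aemeasurable (hV.forall_aemeasurable n) measurableSet_Iic]
  rfl

/-! ### Rates of the truncation level and normalization of the estimating functions -/

/-- Consequences of `T ≍ n^(1/p)`: the truncation level diverges, `n = O(T^p)` and `T^q = o(n)` for
`q < p`. -/
theorem truncation_rates {p q : ℝ} (hp : 0 < p) (hq : 0 ≤ q) (hqp : q < p) {T : ℕ → ℝ}
    (hT_pos : ∀ n, 0 < T n) (hT : T =Θ[atTop] fun n : ℕ => (n : ℝ) ^ (1 / p)) :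
    Tendsto T atTop atTop ∧ (∃ K : ℝ, 0 < K ∧ ∀ᶠ n : ℕ in atTop, (n : ℝ) ≤ K * T n ^ p) ∧
      Tendsto (fun n : ℕ => T n ^ q / n) atTop (𝓝 0) := by
  obtain ⟨c₁, hc₁, h1⟩ := hT.1.exists_pos
  obtain ⟨c₂, hc₂, h2⟩ := hT.2.exists_pos
  rw [Asymptotics.isBigOWith_iff] at h1 h2
  have hpow : Tendsto (fun n : ℕ => (n : ℝ) ^ (1 / p)) atTop atTop :=
    (tendsto_rpow_atTop (by positivity)).comp tendsto_natCast_atTop_atTop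
  have h1' : ∀ᶠ n : ℕ in atTop, T n ≤ c₁ * (n : ℝ) ^ (1 / p) := by
    filter_upwards [h1] with n hn
    rwa [Real.norm_of_nonneg (hT_pos n).le, Real.norm_of_nonneg (by positivity)] at hn
  have h2' : ∀ᶠ n : ℕ in atTop, (n : ℝ) ^ (1 / p) ≤ c₂ * T n := by
    filter_upwards [h2] with n hn
    rwa [Real.norm_of_nonneg (hT_pos n).le, Real.norm_of_nonneg (by positivity)] at hn
  refine ⟨?_, ⟨c₂ ^ p, by positivity, ?_⟩, ?_⟩
  · refine tendsto_atTop_mono' _ ?_ (hpow.atTop_div_const hc₂)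
    filter_upwards [h2'] with n hn
    rwa [div_le_iff₀' hc₂]
  · filter_upwards [h2'] with n hn
    have := Real.rpow_le_rpow (by positivity) hn hp.le
    rwa [← Real.rpow_mul n.cast_nonneg, one_div_mul_cancel hp.ne', Real.rpow_one,
      Real.mul_rpow hc₂.le (hT_pos n).le] at this
  · have hlim : Tendsto (fun n : ℕ => c₁ ^ q * (n : ℝ) ^ (-(1 - q / p))) atTop (𝓝 0) := by
      have h3 : 0 < 1 - q / p := by rw [sub_pos, div_lt_one hp]; exact hqp
      have := ((tendsto_rpow_neg_atTop h3).comp tendsto_natCast_atTop_atTop).const_mul (c₁ ^ q)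
      rwa [mul_zero] at this
    refine squeeze_zero' (Eventually.of_forall fun n => ?_) ?_ hlim
    · have := hT_pos n
      positivity
    · filter_upwards [h1', eventually_ge_atTop 1] with n hn hn1
      have hn0 : (0 : ℝ) < n := by exact_mod_cast hn1
      have := Real.rpow_le_rpow (hT_pos n).le hn hq
      rw [Real.mul_rpow hc₁.le (by positivity), ← Real.rpow_mul n.cast_nonneg] at this
      rw [div_le_iff₀ hn0]
      refine this.trans (le_of_eq ?_)
      have e : (n : ℝ) ^ (-(1 - q / p)) * n = (n : ℝ) ^ (1 / p * q) := by
        rw [← Real.rpow_add_one hn0.ne']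
        congr 1
        ring
      rw [mul_assoc, e]

/-- I.i.d. estimating functions whose variance, bias and Lyapunov moment have the orders of the
deconvolution kernel form a Lindeberg array after normalization. -/
theorem isLindebergArray_of_rates {Ω : Type*} [MeasurableSpace Ω] {P : Measure Ω}
    {G : ℕ → ℕ → Ω → ℝ} {F : ℕ → Ω → ℝ}
    (hindep : ∀ n, iIndepFun (G n) P) (hid : ∀ n i, IdentDistrib (G n i) (F n) P P)
    (hF : ∀ n, Measurable (F n)) (hF2 : ∀ n, Integrable (fun ω => F n ω ^ 2) P)
    {T : ℕ → ℝ} (hT_pos : ∀ n, 0 < T n) {d k : ℕ} {β : ℝ} (hβ : 0 ≤ β) (hk : 0 < k)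
    (hT : T =Θ[atTop] fun n : ℕ => (n : ℝ) ^ (1 / (4 * (k : ℝ) + 2 * β + d)))
    {c : ℝ} (hc : 0 < c)
    (hvar : ∀ n : ℕ, 1 ≤ n → c * T n ^ (2 * β + d) ≤ ∫ ω, F n ω ^ 2 ∂P)
    (hmean : Tendsto (fun n => T n ^ (2 * k) * |∫ ω, F n ω ∂P|) atTop (𝓝 0))
    {δ D : ℝ} (hδ : 0 < δ) (hmomI : ∀ n, Integrable (fun ω => |F n ω| ^ (2 + δ)) P)
    (hmom : ∀ᶠ n in atTop,
      ∫ ω, |F n ω| ^ (2 + δ) ∂P ≤ D * (T n ^ (β + d)) ^ δ * T n ^ (2 * β + d)) :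
    IsLindebergArray P (fun n i ω => (√(n * ∫ ω, F n ω ^ 2 ∂P))⁻¹ * G n i ω)
      (fun n ω => (√(n * ∫ ω, F n ω ^ 2 ∂P))⁻¹ * F n ω) := by
  have hk' : (0 : ℝ) < k := by exact_mod_cast hk
  have hd0 : (0 : ℝ) ≤ d := d.cast_nonneg
  obtain ⟨-, ⟨K, hK, hKT⟩, hTd⟩ := truncation_rates (p := 4 * (k : ℝ) + 2 * β + d) (q := d)
    (by linarith) hd0 (by linarith) hT_pos hT
  have hσ : ∀ n : ℕ, 1 ≤ n → 0 < ∫ ω, F n ω ^ 2 ∂P := fun n hn =>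
    lt_of_lt_of_le (mul_pos hc (Real.rpow_pos_of_pos (hT_pos n) _)) (hvar n hn)
  have hr : ∀ n : ℕ, 1 ≤ n → 0 < √(n * ∫ ω, F n ω ^ 2 ∂P) := fun n hn =>
    Real.sqrt_pos.2 (mul_pos (by exact_mod_cast hn) (hσ n hn))
  have hmeas : ∀ n : ℕ, Measurable fun y : ℝ => (√(n * ∫ ω, F n ω ^ 2 ∂P))⁻¹ * y :=
    fun n => measurable_id.const_mul _
  refine ⟨fun n => (hindep n).comp _ fun _ => hmeas n, fun n i => (hid n i).comp (hmeas n),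
    fun n => (hF n).const_mul _, fun n => ?_, fun n hn => ?_, ?_, fun η hη => ?_⟩
  · simp only [mul_pow]
    exact (hF2 n).const_mul _
  · simp only [mul_pow]
    have h0 := hσ n hn
    have hn0 : (0 : ℝ) < n := by exact_mod_cast hn
    rw [integral_const_mul, inv_pow, Real.sq_sqrt (by positivity)]
    field_simp
  · -- `√(n / E F²)` is of the order of `T^(2k)`
    have hlim := hmean.const_mul √(K / c)
    rw [mul_zero] at hlim
    refine squeeze_zero_norm' ?_ hlim
    filter_upwards [hKT, eventually_ge_atTop 1] with n hn hn1
    have hn0 : (0 : ℝ) < n := by exact_mod_cast hn1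
    have h0 := hσ n hn1
    rw [integral_const_mul, ← mul_assoc, norm_mul, ← mul_assoc, Real.norm_eq_abs, Real.norm_eq_abs]
    refine mul_le_mul_of_nonneg_right ?_ (abs_nonneg _)
    have hr0 := hr n hn1
    rw [abs_of_nonneg (by positivity), ← div_eq_mul_inv, div_le_iff₀ hr0]
    have hTn := hT_pos n
    refine le_of_sq_le_sq ?_ (by positivity)
    rw [mul_pow, mul_pow, Real.sq_sqrt (by positivity), Real.sq_sqrt (by positivity)]
    have hsplit : T n ^ (4 * (k : ℝ) + 2 * β + d) = (T n ^ (2 * k)) ^ 2 * T n ^ (2 * β + d) := by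
      rw [← pow_mul, ← Real.rpow_natCast, ← Real.rpow_add hTn]
      congr 1
      push_cast
      ring
    calc (n : ℝ) ^ 2 = n * n := sq _
      _ ≤ n * (K * ((T n ^ (2 * k)) ^ 2 * T n ^ (2 * β + d))) := by
          rw [← hsplit]
          exact mul_le_mul_of_nonneg_left hn hn0.le
      _ = n * (K / c * (T n ^ (2 * k)) ^ 2 * (c * T n ^ (2 * β + d))) := by
          field_simp
      _ ≤ n * (K / c * (T n ^ (2 * k)) ^ 2 * ∫ ω, F n ω ^ 2 ∂P) := by
          gcongr
          exact hvar n hn1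
      _ = _ := by ring
  · -- Lyapunov's ratio is of the order of `(T^d / n)^(δ/2)`
    have hlim : Tendsto (fun n : ℕ => |D| / c * (√(T n ^ (d : ℝ) / n / c) / η) ^ δ)
        atTop (𝓝 0) := by
      have h1 := ((hTd.div_const c).sqrt.div_const η).rpow_const (p := δ) (Or.inr hδ.le)
      have h2 := h1.const_mul (|D| / c)
      simpa [Real.zero_rpow hδ.ne'] using h2
    refine squeeze_zero' (Eventually.of_forall fun n => mul_nonneg n.cast_nonneg
      (integral_nonneg fun ω => tailSq_nonneg _ _)) ?_ hlim
    filter_upwards [hmom, eventually_ge_atTop 1] with n hn hn1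
    have hn0 : (0 : ℝ) < n := by exact_mod_cast hn1
    have h0 := hσ n hn1
    have hTn := hT_pos n
    have hr0 := hr n hn1
    set s := ∫ ω, F n ω ^ 2 ∂P with hs
    set r := √(n * s) with hrdef
    have hr2 : r ^ 2 = n * s := Real.sq_sqrt (by positivity)
    have hrδ : r ^ (2 + δ) = n * s * r ^ δ := by
      rw [Real.rpow_add hr0, Real.rpow_two, hr2]
    have hTs : 0 < T n ^ (2 * β + d) := Real.rpow_pos_of_pos hTn _
    have hratio : T n ^ (β + d) / r ≤ √(T n ^ (d : ℝ) / n / c) := by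
      rw [div_le_iff₀ hr0, hrdef, ← Real.sqrt_mul (by positivity)]
      refine Real.le_sqrt_of_sq_le ?_
      have e : (T n ^ (β + d)) ^ 2 = T n ^ (d : ℝ) * T n ^ (2 * β + d) := by
        rw [← Real.rpow_natCast, ← Real.rpow_mul hTn.le, ← Real.rpow_add hTn]
        congr 1
        push_cast
        ring
      rw [e]
      calc T n ^ (d : ℝ) * T n ^ (2 * β + d)
          = T n ^ (d : ℝ) / n / c * (n * (c * T n ^ (2 * β + d))) := by field_simp
        _ ≤ _ := by
            gcongr
            exact hvar n hn1
    calc n * ∫ ω, tailSq η (r⁻¹ * F n ω) ∂P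
        ≤ n * ∫ ω, |F n ω| ^ (2 + δ) / (r ^ (2 + δ) * η ^ δ) ∂P := by
          refine mul_le_mul_of_nonneg_left (integral_mono_of_nonneg
            (Eventually.of_forall fun ω => tailSq_nonneg _ _) ((hmomI n).div_const _)
            (Eventually.of_forall fun ω => ?_)) hn0.le
          refine (tailSq_le_rpow hδ hη _).trans (le_of_eq ?_)
          simp only
          rw [abs_mul, abs_of_pos (inv_pos.2 hr0), Real.mul_rpow (by positivity) (abs_nonneg _),
            Real.inv_rpow hr0.le]
          field_simp
      _ = (∫ ω, |F n ω| ^ (2 + δ) ∂P) / (s * (r ^ δ * η ^ δ)) := by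
          rw [integral_div, hrδ]
          field_simp
      _ ≤ (|D| * (T n ^ (β + d)) ^ δ * T n ^ (2 * β + d)) /
            (c * T n ^ (2 * β + d) * (r ^ δ * η ^ δ)) := by
          have hD : D * (T n ^ (β + d)) ^ δ * T n ^ (2 * β + d) ≤
              |D| * (T n ^ (β + d)) ^ δ * T n ^ (2 * β + d) := by
            gcongr
            exact le_abs_self D
          refine div_le_div₀ (by positivity) (hn.trans hD) (by positivity) ?_
          gcongr
          exact hvar n hn1
      _ = |D| / c * (T n ^ (β + d) / r / η) ^ δ := by
          rw [Real.div_rpow (by positivity) hη.le, Real.div_rpow (by positivity) hr0.le]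
          field_simp
      _ ≤ |D| / c * (√(T n ^ (d : ℝ) / n / c) / η) ^ δ := by
          gcongr

/-! ### The estimating functions of the regression model -/

section Estimating

variable {d : ℕ} {B : ∀ l, Fin (harmDim d l) → Sph d → ℂ} {fU : SO d → ℝ}

theorem harmProj_sub_const_mul (hB : IsHarmonicBasis B) {g h : Sph d → ℝ} (hg : Continuous g)
    (hh : Continuous h) (θ : ℝ) (l : ℕ) (x : Sph d) :
    harmProj B (fun y => g y - θ * h y) l x = harmProj B g l x - θ * harmProj B h l x := by
  have hcoeff : ∀ q, fourierCoeff B (fun y => g y - θ * h y) l q =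
      fourierCoeff B g l q - θ * fourierCoeff B h l q := by
    intro q
    have hb := hB.continuous l q
    have i1 : Integrable (fun y => (g y : ℂ) * conj (B l q y)) (surf d) :=
      integrable_surf_of_continuous (by fun_prop)
    have i2 : Integrable (fun y => (θ : ℂ) * ((h y : ℂ) * conj (B l q y))) (surf d) :=
      integrable_surf_of_continuous (by fun_prop)
    rw [fourierCoeff, fourierCoeff, fourierCoeff, ← integral_const_mul, ← integral_sub i1 i2]
    congr 1
    ext y
    push_cast
    ring
  simp only [harmProj, hcoeff, sub_mul, Finset.sum_sub_distrib, Finset.mul_sum, mul_assoc]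

/-- The real part may be taken outside the integral. -/
theorem integral_re_rot_mul {PU : Measure (SO d)} [IsFiniteMeasure PU] {K : Sph d → ℂ}
    (hK : Continuous K) {g : Sph d → ℝ} (hg : Continuous g) :
    ∫ u, ∫ y, (K (rot u y)).re * g y ∂surf d ∂PU =
      (∫ u, ∫ y, K (rot u y) * (g y : ℂ) ∂surf d ∂PU).re := by
  have hsc := secondCountableTopology_SO d
  have hc : Continuous fun p : SO d × Sph d => K (rot p.1 p.2) * (g p.2 : ℂ) :=
    (hK.comp continuous_rot).mul (Complex.continuous_ofReal.comp (hg.comp continuous_snd))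
  have hI : Continuous fun u => ∫ y, K (rot u y) * (g y : ℂ) ∂surf d := by
    have := continuous_parametric_integral_of_continuous (μ := surf d)
      (f := fun u y => K (rot u y) * (g y : ℂ)) hc isCompact_univ
    simpa only [Measure.restrict_univ] using this
  have hIint : Integrable (fun u => ∫ y, K (rot u y) * (g y : ℂ) ∂surf d) PU := by
    obtain ⟨M, hM⟩ := exists_norm_le_of_continuous hI
    exact Integrable.of_bound hI.aestronglyMeasurable M (Eventually.of_forall hM)
  have hu : ∀ u, Integrable (fun y => K (rot u y) * (g y : ℂ)) (surf d) := fun u =>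
    integrable_surf_of_continuous (hc.comp (Continuous.prodMk_right u))
  rw [← Complex.reCLM_apply, ← Complex.reCLM.integral_comp_comm hIint]
  refine integral_congr_ae (Eventually.of_forall fun u => ?_)
  simp only
  rw [← Complex.reCLM.integral_comp_comm (hu u)]
  simp

/-- The truncation bias of the estimating function at the true regression value is of smaller order
than `T^(-2k)`. -/
theorem tendsto_pow_mul_re_sum_harmProj (hd : 1 ≤ d) (hB : IsHarmonicBasis B) {k : ℕ}
    (hk : (d : ℝ) / 4 < k) {f m : Sph d → ℝ} (hf : RadialSmooth (2 * k) f)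
    (hmf : RadialSmooth (2 * k) fun y => m y * f y)
    (hΔf : FourierLaplaceAbsConv B (laplaceBeltrami^[k] f))
    (hΔmf : FourierLaplaceAbsConv B (laplaceBeltrami^[k] fun y => m y * f y)) (x : Sph d)
    {T : ℕ → ℝ} (hT_pos : ∀ n, 0 < T n) (hT : Tendsto T atTop atTop) :
    Tendsto (fun n => T n ^ (2 * k) *
      |(∑ l ∈ Finset.range (⌊T n⌋₊ + 1), harmProj B (fun y => (m y - m x) * f y) l x).re|)
      atTop (𝓝 0) := by
  have hL : Tendsto (fun n => ⌊T n⌋₊) atTop atTop := tendsto_nat_floor_atTop.comp hT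
  have h1 := (tendsto_pow_mul_truncation_error hd hB hk hmf hΔmf x).comp hL
  have h2 := ((tendsto_pow_mul_truncation_error hd hB hk hf hΔf x).comp hL).const_mul |m x|
  have h3 := h1.add h2
  rw [mul_zero, add_zero] at h3
  refine squeeze_zero (fun n => mul_nonneg (pow_nonneg (hT_pos n).le _) (abs_nonneg _))
    (fun n => ?_) h3
  simp only [Function.comp_apply]
  set L := ⌊T n⌋₊ with hLdef
  have hsum : ∑ l ∈ Finset.range (L + 1), harmProj B (fun y => (m y - m x) * f y) l x =
      (∑ l ∈ Finset.range (L + 1), harmProj B (fun y => m y * f y) l x - ((m x * f x : ℝ) : ℂ))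
        - (m x : ℂ) * (∑ l ∈ Finset.range (L + 1), harmProj B f l x - f x) := by
    have : (fun y => (m y - m x) * f y) = fun y => m y * f y - m x * f y := by
      ext y
      ring
    simp only [this, harmProj_sub_const_mul hB hmf.continuous hf.continuous,
      Finset.sum_sub_distrib, ← Finset.mul_sum]
    push_cast
    ring
  have hT1 : T n ^ (2 * k) ≤ ((L : ℝ) + 1) ^ (2 * k) :=
    pow_le_pow_left₀ (hT_pos n).le (Nat.lt_floor_add_one (T n)).le _
  calc T n ^ (2 * k) *
        |(∑ l ∈ Finset.range (L + 1), harmProj B (fun y => (m y - m x) * f y) l x).re|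
      ≤ ((L : ℝ) + 1) ^ (2 * k) *
        (‖∑ l ∈ Finset.range (L + 1), harmProj B (fun y => m y * f y) l x
            - ((m x * f x : ℝ) : ℂ)‖
          + |m x| * ‖∑ l ∈ Finset.range (L + 1), harmProj B f l x - f x‖) := by
        refine mul_le_mul hT1 ?_ (abs_nonneg _) (by positivity)
        rw [hsum]
        refine (Complex.abs_re_le_norm _).trans ((norm_sub_le _ _).trans (le_of_eq ?_))
        rw [norm_mul, Complex.norm_real, Real.norm_eq_abs]
    _ = _ := by ring

theorem abs_mul_rpow_le {δ a y M : ℝ} (hδ : 0 < δ) (ha : |a| ≤ M) :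
    |a * y| ^ (2 + δ) ≤ M ^ δ * (a ^ 2 * |y| ^ (2 + δ)) := by
  rw [abs_mul, Real.mul_rpow (abs_nonneg a) (abs_nonneg y),
    Real.rpow_add_of_nonneg (abs_nonneg a) zero_le_two hδ.le, Real.rpow_two, sq_abs]
  have := Real.rpow_le_rpow (abs_nonneg a) ha hδ.le
  calc a ^ 2 * |a| ^ δ * |y| ^ (2 + δ) ≤ a ^ 2 * M ^ δ * |y| ^ (2 + δ) := by gcongr
    _ = _ := by ring

/-- The moment of order `2 + δ` of an estimating function with a bounded kernel. -/
theorem integral_abs_rpow_le {Ω : Type*} [MeasurableSpace Ω] {P : Measure Ω} {a y : Ω → ℝ}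
    (ha : Measurable a) (hy : Measurable y) {δ M : ℝ} (hδ : 0 < δ) (hM : ∀ ω, |a ω| ≤ M)
    (hI : Integrable (fun ω => a ω ^ 2 * |y ω| ^ (2 + δ)) P) :
    Integrable (fun ω => |a ω * y ω| ^ (2 + δ)) P ∧
      ∫ ω, |a ω * y ω| ^ (2 + δ) ∂P ≤ M ^ δ * ∫ ω, a ω ^ 2 * |y ω| ^ (2 + δ) ∂P := by
  have h1 : Integrable (fun ω => |a ω * y ω| ^ (2 + δ)) P :=
    (hI.const_mul (M ^ δ)).mono'
      ((ha.mul hy).norm.pow_const (2 + δ)).aestronglyMeasurable (Eventually.of_forall fun ω => by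
      rw [Real.norm_of_nonneg (by positivity)]
      exact abs_mul_rpow_le hδ (hM ω))
  refine ⟨h1, ?_⟩
  rw [← integral_const_mul]
  exact integral_mono h1 (hI.const_mul _) fun ω => abs_mul_rpow_le hδ (hM ω)

end Estimating

end HyperDeconv

open HyperDeconv in
theorem mainTheorem7
    -- the dimension and the orthonormal bases of spherical harmonics
    {d : ℕ} (hd : 1 ≤ d)
    (B : ∀ l, Fin (harmDim d l) → Sph d → ℂ) (hB : IsHarmonicBasis B)
    -- the model `Y = m(X) + ε`, `Z = U X`
    {Ω : Type*} [MeasurableSpace Ω] (P : Measure Ω) [IsProbabilityMeasure P]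
    (X : Ω → Sph d) (U : Ω → SO d) (ε : Ω → ℝ)
    (hX : Measurable X) (hU : Measurable U) (hε : Measurable ε)
    (fX : Sph d → ℝ) (fU : SO d → ℝ) (m : Sph d → ℝ)
    (hfX : P.map X = (surf d).withDensity fun x => ENNReal.ofReal (fX x))
    (hfU_meas : Measurable fU) (hfU_nonneg : ∀ u, 0 ≤ fU u)
    (hfU : P.map U = (haarSO d).withDensity fun u => ENNReal.ofReal (fU u))
    (hfU_sq : MemLp fU 2 (haarSO d))
    (hindep : IndepFun U (fun ω => (X ω, ε ω)) P)
    (hε_int : Integrable ε P)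
    (hε_mean : P[ε | MeasurableSpace.comap X inferInstance] =ᵐ[P] 0)
    (hinv : ∀ l, IsUnit (rotFourier B fU l))
    -- the i.i.d. observations of `(Z, Y)`
    (Z : ℕ → Ω → Sph d) (Y : ℕ → Ω → ℝ)
    (hiid : iIndepFun (fun i ω => (Z i ω, Y i ω)) P)
    (hlaw : ∀ i, IdentDistrib (fun ω => (Z i ω, Y i ω))
      (fun ω => (rot (U ω) (X ω), m (X ω) + ε ω)) P P)
    -- (S1)-(i)
    (β : ℝ) (hβ : 0 ≤ β)
    (hS1 : ∃ c₁ : ℝ, 0 < c₁ ∧ ∀ l : ℕ, 1 ≤ l →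
      ‖Matrix.toEuclideanCLM (𝕜 := ℂ) (rotFourier B fU l)⁻¹‖ ≤ c₁ * (l : ℝ) ^ β)
    -- (A1)
    (k : ℕ) (hk : (d : ℝ) / 4 < k)
    (hA1_f : SmoothSph (2 * k) fX) (hA1_m : SmoothSph (2 * k) m)
    -- (A2)-(i)
    (hA2 : ∃ c : ℝ, 0 < c ∧ ∀ x, c ≤ fX x)
    -- (T1')
    (T : ℕ → ℝ) (hT_pos : ∀ n, 0 < T n)
    (hT : T =Θ[atTop] fun n : ℕ => (n : ℝ) ^ (1 / (4 * (k : ℝ) + 2 * β + d)))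
    -- (B4)
    (hB4_moment : ∃ δ : ℝ, 0 < δ ∧ Integrable (fun ω => |m (X ω) + ε ω| ^ (2 + δ)) P ∧
      ∃ C : ℝ, ∀ᵐ ω ∂P, (P[fun ω => |m (X ω) + ε ω| ^ (2 + δ) |
        MeasurableSpace.comap X inferInstance]) ω ≤ C)
    (hB4_var : ∃ c : ℝ, 0 < c ∧ ∀ᵐ ω ∂P,
      c ≤ (P[fun ω => ε ω ^ 2 | MeasurableSpace.comap X inferInstance]) ω)
    -- (E2)
    (hE2 : ∀ x, Tendsto (fun n : ℕ => P {ω | 0 < regEmpLik B fU (T n)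
      (fun i : Fin n => Z i ω) (fun i => Y i ω) x (m x)}) atTop (𝓝 1))
    -- (B1) with `q = d`
    (hB1 : ∀ x, ∃ c : ℝ, 0 < c ∧ ∀ n : ℕ, 1 ≤ n → c * T n ^ (2 * β + d) ≤
      ∫ ω, (deconvKernel B fU (T n) x (rot (U ω) (X ω))).re ^ 2 ∂P)
    -- absolute convergence of the Fourier-Laplace series
    (hΔf : FourierLaplaceAbsConv B (laplaceBeltrami^[k] fX))
    (hΔmf : FourierLaplaceAbsConv B (laplaceBeltrami^[k] fun x => m x * fX x)) :
    ∀ x : Sph d,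
      TendstoInDistribution
        (fun (n : ℕ) ω => negTwoLog (regEmpLik B fU (T n)
          (fun i : Fin n => Z i ω) (fun i => Y i ω) x (m x)))
        atTop (fun t : ℝ => (t : EReal)) (fun _ => P) chiSqOne ∧
      ∀ α : ℝ, 0 < α → α < 1 →
        (∀ (n : ℕ) (ω : Ω),
          {θ : ℝ | negTwoLog (regEmpLik B fU (T n)
            (fun i : Fin n => Z i ω) (fun i => Y i ω) x θ) ≤ (chiSqOneUpper α : EReal)} =
          {θ : ℝ | Real.exp (-chiSqOneUpper α / 2) ≤ regEmpLik B fU (T n)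
            (fun i : Fin n => Z i ω) (fun i => Y i ω) x θ}) ∧
        Tendsto (fun n : ℕ => P.real {ω | m x ∈ {θ : ℝ | negTwoLog (regEmpLik B fU (T n)
          (fun i : Fin n => Z i ω) (fun i => Y i ω) x θ) ≤ (chiSqOneUpper α : EReal)}})
          atTop (𝓝 (1 - α)) := by
  intro x
  obtain ⟨cf, hcf, hfl⟩ := hA2
  have hf0 : ∀ y, 0 ≤ fX y := fun y => hcf.le.trans (hfl y)
  have hd4 : (0 : ℝ) ≤ (d : ℝ) / 4 := by positivity
  have hk0 : 0 < k := by exact_mod_cast (hd4.trans_lt hk)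
  have hfs := hA1_f.radialSmooth
  have hms := hA1_m.radialSmooth
  have hfc := hfs.continuous
  have hmc := hms.continuous
  obtain ⟨Mf, hMf⟩ := exists_norm_le_of_continuous hfc
  have hMf' : ∀ y, fX y ≤ Mf := fun y => (le_abs_self _).trans (hMf y)
  have hMf0 : 0 ≤ Mf := (hf0 x).trans (hMf' x)
  obtain ⟨δ, hδ, hmom, C, hC⟩ := hB4_moment
  obtain ⟨cε, hcε, hvar⟩ := hB4_var
  obtain ⟨cB, hcB, hBx⟩ := hB1 x
  obtain ⟨CK, hCK, hK⟩ := exists_deconvKernel_bounds hd hB fU hβ hS1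
  obtain ⟨CM, hCM, hmomK⟩ :=
    exists_integral_sq_mul_rpow_le hX hU hε hindep hmc hδ hmom hC (m x)
  have hTtop : Tendsto T atTop atTop :=
    (truncation_rates (p := 4 * (k : ℝ) + 2 * β + d) (q := 0) (by positivity) le_rfl
      (by positivity) hT_pos hT).1
  obtain ⟨κ, hκ_def⟩ : ∃ κ : ℕ → Sph d → ℝ, ∀ n z, κ n z = (deconvKernel B fU (T n) x z).re :=
    ⟨_, fun _ _ => rfl⟩
  have hκ : ∀ n, Continuous (κ n) := fun n => by
    rw [funext (hκ_def n)]
    exact Complex.continuous_re.comp (continuous_deconvKernel hB fU (T n) x)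
  have hrm : Measurable fun ω => rot (U ω) (X ω) :=
    continuous_rot.measurable.comp (hU.prodMk hX)
  have hym : Measurable fun ω => m (X ω) + ε ω := (hmc.measurable.comp hX).add hε
  have hψ : ∀ n, Measurable fun p : Sph d × ℝ => κ n p.1 * (p.2 - m x) := fun n =>
    ((hκ n).measurable.comp measurable_fst).mul (measurable_snd.sub_const _)
  have hsq := fun n =>
    le_integral_sq_mul_sq hX hU hε hindep hε_int hε_mean hmc hδ hmom hvar (m x) (hκ n)
  have hlow : ∀ n : ℕ, 1 ≤ n → cε * cB * T n ^ (2 * β + d) ≤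
      ∫ ω, (κ n (rot (U ω) (X ω)) * (m (X ω) + ε ω - m x)) ^ 2 ∂P := fun n hn => by
    refine le_trans ?_ (hsq n).2
    rw [mul_assoc]
    simp only [hκ_def]
    exact mul_le_mul_of_nonneg_left (hBx n hn) hcε.le
  have hbias : Tendsto (fun n => T n ^ (2 * k) *
      |∫ ω, κ n (rot (U ω) (X ω)) * (m (X ω) + ε ω - m x) ∂P|) atTop (𝓝 0) := by
    have hPU := Measure.isProbabilityMeasure_map (μ := P) hU.aemeasurable
    refine (tendsto_pow_mul_re_sum_harmProj hd hB hk hfs (hms.mul hfs) hΔf hΔmf x hT_pos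
      hTtop).congr fun n => ?_
    rw [integral_comp_rot_mul_response hX hU hε hindep hε_int hε_mean hfc hf0 hfX hmc (hκ n)]
    simp only [hκ_def]
    have hg : Continuous fun y => (m y - m x) * fX y := (hmc.sub continuous_const).mul hfc
    rw [integral_re_rot_mul (continuous_deconvKernel hB fU (T n) x) hg,
      integral_deconvKernel_rot hd hB hfU_meas hfU_nonneg hfU hinv (T n) x hg]
  have hmomI : ∀ n,
      Integrable (fun ω => |κ n (rot (U ω) (X ω)) * (m (X ω) + ε ω - m x)| ^ (2 + δ)) P := fun n => by
    obtain ⟨M, hM⟩ := exists_norm_le_of_continuous (hκ n)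
    exact (integral_abs_rpow_le ((hκ n).measurable.comp hrm) (hym.sub_const _) hδ
      (fun ω => hM _) (hmomK (κ n) (hκ n)).1).1
  have hmomB : ∀ᶠ n in atTop,
      ∫ ω, |κ n (rot (U ω) (X ω)) * (m (X ω) + ε ω - m x)| ^ (2 + δ) ∂P ≤
        CK ^ δ * (CM * (Mf * CK)) * (T n ^ (β + d)) ^ δ * T n ^ (2 * β + d) := by
    filter_upwards [hTtop.eventually_ge_atTop 1] with n hn
    obtain ⟨hK1, hK2⟩ := hK (T n) hn x
    have hTn := hT_pos n
    have hκK : ∀ z, |κ n z| ≤ ‖deconvKernel B fU (T n) x z‖ := fun z => by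
      rw [hκ_def]
      exact Complex.abs_re_le_norm _
    have hκ2 : ∫ z, κ n z ^ 2 ∂surf d ≤ CK * T n ^ (2 * β + d) := by
      refine le_trans (integral_mono (integrable_surf_of_continuous ((hκ n).pow 2))
        (integrable_surf_of_continuous ((continuous_deconvKernel hB fU (T n) x).norm.pow 2))
        fun z => ?_) hK2
      simp only
      rw [← sq_abs]
      exact pow_le_pow_left₀ (abs_nonneg _) (hκK z) 2
    calc ∫ ω, |κ n (rot (U ω) (X ω)) * (m (X ω) + ε ω - m x)| ^ (2 + δ) ∂P
        ≤ (CK * T n ^ (β + d)) ^ δ *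
            ∫ ω, κ n (rot (U ω) (X ω)) ^ 2 * |m (X ω) + ε ω - m x| ^ (2 + δ) ∂P :=
          (integral_abs_rpow_le ((hκ n).measurable.comp hrm) (hym.sub_const _) hδ
            (fun ω => (hκK _).trans (hK1 _)) (hmomK (κ n) (hκ n)).1).2
      _ ≤ (CK * T n ^ (β + d)) ^ δ * (CM * (Mf * (CK * T n ^ (2 * β + d)))) := by
          gcongr
          refine (hmomK (κ n) (hκ n)).2.trans ?_
          gcongr
          refine (integral_sq_comp_rot_le hX hU hε hindep hfc hf0 hfX hMf' (hκ n)).trans ?_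
          gcongr
      _ = _ := by
          rw [Real.mul_rpow hCK.le (by positivity)]
          ring
  have harray := isLindebergArray_of_rates
    (G := fun n i ω => κ n (Z i ω) * (Y i ω - m x))
    (F := fun n ω => κ n (rot (U ω) (X ω)) * (m (X ω) + ε ω - m x))
    (fun n => hiid.comp (fun _ p => κ n p.1 * (p.2 - m x)) fun _ => hψ n)
    (fun n i => (hlaw i).comp (hψ n))
    (fun n => ((hκ n).measurable.comp hrm).mul (hym.sub_const _)) (fun n => (hsq n).1)
    hT_pos hβ hk0 hT (mul_pos hcε hcB) hlow hbias hδ hmomI hmomB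
  -- the normalization leaves the empirical likelihood unchanged
  have hscale : ∀ (n : ℕ) (ω : Ω), empLik (fun i : Fin n =>
      (√(n * ∫ ω, (κ n (rot (U ω) (X ω)) * (m (X ω) + ε ω - m x)) ^ 2 ∂P))⁻¹ *
        (κ n (Z i ω) * (Y i ω - m x))) =
      regEmpLik B fU (T n) (fun i : Fin n => Z i ω) (fun i => Y i ω) x (m x) := by
    intro n ω
    simp only [regEmpLik, ← hκ_def]
    rcases Nat.eq_zero_or_pos n with rfl | hn
    · exact congrArg empLik (Subsingleton.elim _ _)
    · refine empLik_const_mul (inv_ne_zero (Real.sqrt_ne_zero'.2 (mul_pos (by exact_mod_cast hn)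
        (lt_of_lt_of_le ?_ (hlow n hn))))) _
      have := hT_pos n
      positivity
  have hmain := harray.tendstoInDistribution_negTwoLog_empLik
  simp only [hscale] at hmain
  exact ⟨hmain, fun α h0 h1 => ⟨fun n ω => Set.ext fun θ => negTwoLog_le_coe_iff,
    tendsto_measureReal_le_chiSqOneUpper hmain h0 h1⟩⟩
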